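/- **Fiber enhancements in codimension three of the resolved $SU(5)$ model.** Let $B$ be a complex threefold with line bundles $\mathscr L,\mathscr S$, a section $w$ of $\mathscr S$ and sections $\beta_j$ of $\mathscr L^{6-j}\otimes\mathscr S^{j-5}$ ($j=0,2,3,4,5$), and let $\mathscr E\to B$ be the Weierstrass model $$zy^2+\beta_5xyz+\beta_3w^2yz^2=x^3+\beta_4wx^2z+\beta_2w^3xz^2+\beta_0w^5z^3 .$$ Blow up its singular locus $x=y=w=0$; in the chart where $x$ and $y$ are replaced by $xw$ and $yw$, blow up the remaining locus $x=y=w=0$. The remaining singularities considered lie in the chart of the second blow-up in which $(x,y,w)$ is replaced by $(x,xy,xw)$; there the space is the binomial variety $ys=xwt$ with $s=y+\beta_5+w\beta_3$, $t=x+\beta_4+w\beta_2+w^2\beta_0$, where now $xw$ is the given section $w$ of the base. For $\{i,j,k\}=\{x,w,t\}$ let $\mathscr E_{ij}$ be obtained by replacing this chart by its small resolution $$u_i\alpha_+=\sigma_+y,\qquad u_j\alpha_-=\sigma_-s,\qquad \alpha_-\alpha_+=\sigma_-\sigma_+u_k,$$ where $(u_x,u_w,u_t)=(x,w,t)$ and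 $[\alpha_+:\sigma_+],[\alpha_-:\sigma_-]\in\mathbb P^1$. This gives six resolutions $\mathscr E_{xw},\mathscr E_{wx},\mathscr E_{xt},\mathscr E_{tx},\mathscr E_{wt},\mathscr E_{tw}$. Put $P=\beta_3^2\beta_4-\beta_2\beta_3\beta_5+\beta_0\beta_5^2$, $R=4\beta_0\beta_4\beta_5-\beta_3^3-\beta_2^2\beta_5$ and $\Sigma_5: w=P=0$, $\Sigma_{10}: w=\beta_5=0$, $\Pi_3: w=\beta_5=\beta_3=0$, $\Pi_4: w=\beta_5=\beta_4=0$, $\Pi_7: w=P=R=0$. Assume that the sections are general, in the sense that the four loci $w=\beta_5=\beta_3=\beta_4=0$, $w=\beta_5=\beta_3=\beta_0=0$, $w=\beta_5=\beta_3=\beta_2^2-4\beta_4\beta_0=0$ and $w=\beta_3=\beta_2=\beta_0=0$, each given by four conditions, are empty. The (reduced) fiber of $\mathscr E_{ij}$ over a point of $B$ is said to have dual graph $G$ if its irreducible components (its nodes) are projective lines corresponding to the vertices of $G$, two components meet in exactly one point, transversally, if they are joined by an edge and are disjoint otherwise, and no three components have a common point. Then $\Sigma_5\cap\Sigma_{10}=\Pi_3\cup\Pi_4$,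 and: 1. Over every point of $\Pi_3$, the fiber of each of the six resolutions has dual graph the affine Dynkin diagram $\tilde D_6$. 2. Over every point of $\Pi_4$, the fiber of each of the six resolutions has six nodes, as many as over the codimension-two points of $\Sigma_5$ (those where $\beta_3\beta_5\neq0$) and of $\Sigma_{10}$ (those where $\beta_3\beta_4\ne0$). For $\mathscr E_{wx},\mathscr E_{tw},\mathscr E_{wt},\mathscr E_{xw}$ its dual graph is the projective (i.e. finite) Dynkin diagram $E_6$. For $\mathscr E_{xt}$ and $\mathscr E_{tx}$ the fiber is of type $\tilde E_6^-$: it consists of three 2-chains of projective lines, the first lines of the three chains passing through one common point, the second line of each chain meeting the first line of that chain in one other point, all intersections being transversal and there being no other intersections. The intersection graph of its components is not a finite or affine Dynkin diagram of type $A$, $D$ or $E$. 3. Over every point of $\Pi_7\setminus\Pi_3$ there is no enhancement: the fiber of each of the six resolutions has dual graph $\tilde A_5$ (a hexagon), the same as over the codimension-two points of $\Sigma_5$. -/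

import Mathlib

open Topology

/-! ### Classical complex varieties as spaces with functions -/

/-- A topological space in which it is specified which complex valued functions are regular at
which points (`IsRegularAt f x` only concerns the behaviour of `f` near `x`). -/
class SpaceWithFunctions (X : Type*) extends TopologicalSpace X where
  IsRegularAt : (X → ℂ) → X → Prop

open SpaceWithFunctions (IsRegularAt)

/-- The affine space `ℂ ^ ι`. -/
def Aff (ι : Type) : Type := ι → ℂ

/-- The affine space with its Zariski topology (the non-vanishing loci of polynomials form a basis);
a function is regular at `p` if it is a quotient of polynomials on a neighbourhood of `p`. -/
instance Aff.spaceWithFunctions (ι : Type) : SpaceWithFunctions (Aff ι) where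
  toTopologicalSpace := TopologicalSpace.generateFrom
    {D | ∃ Q : MvPolynomial ι ℂ, D = {p : Aff ι | MvPolynomial.eval p Q ≠ 0}}
  IsRegularAt f p := ∃ P Q : MvPolynomial ι ℂ, MvPolynomial.eval p Q ≠ 0 ∧
    ∀ q : Aff ι, MvPolynomial.eval q Q ≠ 0 →
      f q = MvPolynomial.eval q P / MvPolynomial.eval q Q

/-- Subspaces: a function is regular at a point if it extends, locally, to a function on the ambient
space that is regular there. -/
instance Subtype.spaceWithFunctions {X : Type*} [SpaceWithFunctions X] (S : X → Prop) :
    SpaceWithFunctions (Subtype S) where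
  toTopologicalSpace := instTopologicalSpaceSubtype
  IsRegularAt f p := ∃ F : X → ℂ, IsRegularAt F p.1 ∧ ∀ᶠ q in 𝓝 p, f q = F q.1

/-- Disjoint unions. -/
instance Sum.spaceWithFunctions {X Y : Type*} [SpaceWithFunctions X] [SpaceWithFunctions Y] :
    SpaceWithFunctions (X ⊕ Y) where
  toTopologicalSpace := instTopologicalSpaceSum
  IsRegularAt f p := match p with
    | Sum.inl x => IsRegularAt (fun x' => f (Sum.inl x')) x
    | Sum.inr y => IsRegularAt (fun y' => f (Sum.inr y')) y

/-- Quotients (used for homogeneous coordinates and for gluing): the quotient topology, and a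
function is regular at a point if its pull-back is regular at all points above it. -/
instance Quot.spaceWithFunctions {X : Type*} [SpaceWithFunctions X] (R : X → X → Prop) :
    SpaceWithFunctions (Quot R) where
  toTopologicalSpace := instTopologicalSpaceQuot
  IsRegularAt f p := ∀ x : X, Quot.mk R x = p → IsRegularAt (fun x' => f (Quot.mk R x')) x

/-- The complex projective line, as the quotient of `ℂ ^ 2 ∖ {0}` by scaling. -/
def ProjLine : Type :=
  Quot (fun p q : {v : Aff (Fin 2) // v 0 ≠ 0 ∨ v 1 ≠ 0} =>
    ∃ a : ℂˣ, q.1 0 = a * p.1 0 ∧ q.1 1 = a * p.1 1)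

instance : SpaceWithFunctions ProjLine := Quot.spaceWithFunctions _

/-- Isomorphisms of spaces with functions. -/
def AreIsomorphic (X Y : Type*) [SpaceWithFunctions X] [SpaceWithFunctions Y] : Prop :=
  ∃ e : X ≃ₜ Y, ∀ (f : Y → ℂ) (x : X),
    IsRegularAt f (e x) ↔ IsRegularAt (fun x' => f (e x')) x

/-- `C` and `D` meet transversally at the common point `x`, i.e. with intersection multiplicity one:
in the local ring of `X` at `x`, the maximal ideal is the sum of the ideals of `C` and of `D`
(the scheme-theoretic intersection of `C` and `D` is a reduced point at `x`). -/
def MeetTransversallyAt {X : Type*} [SpaceWithFunctions X] (C D : Set X) (x : X) : Prop :=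
  x ∈ C ∧ x ∈ D ∧ ∀ f : X → ℂ, IsRegularAt f x → f x = 0 →
    ∃ g h : X → ℂ, IsRegularAt g x ∧ IsRegularAt h x ∧
      (∀ᶠ z in 𝓝 x, f z = g z + h z) ∧
      (∀ᶠ z in 𝓝 x, z ∈ C → g z = 0) ∧ (∀ᶠ z in 𝓝 x, z ∈ D → h z = 0)

/-! ### Dual graphs -/

/-- The intersection graph of the irreducible components of `X`. -/
def dualGraph (X : Type*) [TopologicalSpace X] : SimpleGraph (irreducibleComponents X) where
  Adj C D := C ≠ D ∧ (C.1 ∩ D.1).Nonempty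
  symm := ⟨fun _ _ h => ⟨h.1.symm, by rw [Set.inter_comm]; exact h.2⟩⟩
  loopless := ⟨fun _ h => h.1 rfl⟩

/-- The irreducible components of `X` are projective lines, and any two of them are disjoint or meet
in exactly one point, transversally. -/
def IsConfigurationOfLines (X : Type*) [SpaceWithFunctions X] : Prop :=
  (∀ C ∈ irreducibleComponents X, AreIsomorphic ProjLine C) ∧
  ∀ C ∈ irreducibleComponents X, ∀ D ∈ irreducibleComponents X, C ≠ D →
    (C ∩ D).Subsingleton ∧ ∀ x ∈ C ∩ D, MeetTransversallyAt C D x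

/-- `X` is a curve with dual graph `G`: its nodes are projective lines, no three nodes pass through
a point, and two nodes meet in one point, transversally, if they are joined by an edge of `G`, and
are disjoint otherwise. -/
def HasDualGraph (X : Type*) [SpaceWithFunctions X] {V : Type*} (G : SimpleGraph V) : Prop :=
  IsConfigurationOfLines X ∧
  (∀ C ∈ irreducibleComponents X, ∀ D ∈ irreducibleComponents X, ∀ E ∈ irreducibleComponents X,
    C ≠ D → C ≠ E → D ≠ E → C ∩ D ∩ E = ∅) ∧
  Nonempty (dualGraph X ≃g G)

/-- `X` is a bouquet of three 2-chains (type `Ẽ₆⁻`): it consists of six projective lines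
`C i 0`, `C i 1` (`i = 0, 1, 2`); the three lines `C i 0` meet at one point, `C i 1` meets `C i 0`
away from that point, and there are no other intersections. -/
def IsBouquetOfThreeTwoChains (X : Type*) [SpaceWithFunctions X] : Prop :=
  IsConfigurationOfLines X ∧
  ∃ C : Fin 3 → Fin 2 → Set X, Function.Injective (fun k : Fin 3 × Fin 2 => C k.1 k.2) ∧
    Set.range (fun k : Fin 3 × Fin 2 => C k.1 k.2) = irreducibleComponents X ∧
    (∃ p : X, ∀ i, p ∈ C i 0 ∧ p ∉ C i 1) ∧
    (∀ i, (C i 0 ∩ C i 1).Nonempty) ∧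
    (∀ i j, i ≠ j → Disjoint (C i 1) (C j 0) ∧ Disjoint (C i 1) (C j 1))

/-- The graph `T_{p,q,r}`: three chains of `p`, `q` and `r` vertices with one end in common
(the vertex `none`); it has `p + q + r - 2` vertices. -/
def graphT (p q r : ℕ) : SimpleGraph (Option (Σ i : Fin 3, Fin (![p, q, r] i - 1))) :=
  SimpleGraph.fromRel fun a b => match a, b with
    | none, some ⟨_, k⟩ => k.val = 0
    | some ⟨i, k⟩, some ⟨j, l⟩ => i = j ∧ l.val = k.val + 1
    | _, none => False

/-- The affine Dynkin diagram `D̃ₙ` (`4 ≤ n`) with `n + 1` vertices: the chain `1 - 2 - ⋯ - (n - 1)`,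
with the vertices `0` and `n` attached to `2` and `n - 2` respectively. -/
def graphAffineD (n : ℕ) : SimpleGraph (Fin (n + 1)) :=
  SimpleGraph.fromRel fun a b =>
    (1 ≤ a.val ∧ b.val = a.val + 1 ∧ b.val + 1 ≤ n) ∨
    (a.val = 0 ∧ b.val = 2) ∨ (a.val + 2 = n ∧ b.val = n)

/-- The graph is a projective (i.e. finite) or affine Dynkin diagram of type `A`, `D` or `E`.
(The diagrams `Ã₀` and `Ã₁`, which are not simple graphs, are left out.) -/
def IsADE {V : Type*} (G : SimpleGraph V) : Prop :=
  (∃ n, 1 ≤ n ∧ Nonempty (G ≃g SimpleGraph.pathGraph n)) ∨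
  (∃ n, 4 ≤ n ∧ Nonempty (G ≃g graphT 2 2 (n - 2))) ∨
  (∃ n, 6 ≤ n ∧ n ≤ 8 ∧ Nonempty (G ≃g graphT 2 3 (n - 3))) ∨
  (∃ n, 3 ≤ n ∧ Nonempty (G ≃g SimpleGraph.cycleGraph n)) ∨
  (∃ n, 4 ≤ n ∧ Nonempty (G ≃g graphAffineD n)) ∨
  Nonempty (G ≃g graphT 3 3 3) ∨ Nonempty (G ≃g graphT 2 4 4) ∨ Nonempty (G ≃g graphT 2 3 6)

namespace SU5

/-! ### The model and the loci in the base -/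

/-- The values at a point of the base of the sections defining the model, in a trivialization. -/
structure Coeffs where
  w : ℂ
  β0 : ℂ
  β2 : ℂ
  β3 : ℂ
  β4 : ℂ
  β5 : ℂ

/-- The polynomial `P`. -/
def Coeffs.P (c : Coeffs) : ℂ := c.β3 ^ 2 * c.β4 - c.β2 * c.β3 * c.β5 + c.β0 * c.β5 ^ 2

/-- The polynomial `R`. -/
def Coeffs.R (c : Coeffs) : ℂ := 4 * c.β0 * c.β4 * c.β5 - c.β3 ^ 3 - c.β2 ^ 2 * c.β5

end SU5

open SU5 in
/-- The data of an `SU(5)` model over a base with set of points `B`: two line bundles `ℒ` and `𝒮`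
(the latter cutting out the divisor `w = 0`), given by a trivializing cover `U` and transition
functions `l` and `m`, a section `w` of `𝒮` and sections `βⱼ` of `ℒ ^ (6 - j) ⊗ 𝒮 ^ (j - 5)` for
`j = 0, 2, 3, 4, 5`, given by their values in the trivializations. -/
structure SU5Model (B : Type*) where
  I : Type*
  U : I → Set B
  cover : ∀ b, ∃ i, b ∈ U i
  l : I → I → B → ℂˣ
  m : I → I → B → ℂˣ
  l_cocycle : ∀ i j k b, b ∈ U i → b ∈ U j → b ∈ U k → l i j b * l j k b = l i k b
  m_cocycle : ∀ i j k b, b ∈ U i → b ∈ U j → b ∈ U k → m i j b * m j k b = m i k b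
  coeffs : I → B → Coeffs
  w_glue : ∀ i j b, b ∈ U i → b ∈ U j →
    (coeffs i b).w = (m i j b : ℂ) * (coeffs j b).w
  β0_glue : ∀ i j b, b ∈ U i → b ∈ U j →
    (coeffs i b).β0 = (l i j b : ℂ) ^ 6 * (m i j b : ℂ) ^ (-5 : ℤ) * (coeffs j b).β0
  β2_glue : ∀ i j b, b ∈ U i → b ∈ U j →
    (coeffs i b).β2 = (l i j b : ℂ) ^ 4 * (m i j b : ℂ) ^ (-3 : ℤ) * (coeffs j b).β2
  β3_glue : ∀ i j b, b ∈ U i → b ∈ U j →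
    (coeffs i b).β3 = (l i j b : ℂ) ^ 3 * (m i j b : ℂ) ^ (-2 : ℤ) * (coeffs j b).β3
  β4_glue : ∀ i j b, b ∈ U i → b ∈ U j →
    (coeffs i b).β4 = (l i j b : ℂ) ^ 2 * (m i j b : ℂ) ^ (-1 : ℤ) * (coeffs j b).β4
  β5_glue : ∀ i j b, b ∈ U i → b ∈ U j →
    (coeffs i b).β5 = (l i j b : ℂ) * (coeffs j b).β5

namespace SU5Model

variable {B : Type*} (M : SU5Model B)

/-- The locus of the base defined by equations (and inequations) in the sections; all those used
below are homogeneous, hence do not depend on the trivialization. -/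
def locus (φ : SU5.Coeffs → Prop) : Set B := {b | ∀ i, b ∈ M.U i → φ (M.coeffs i b)}

/-- The curve `Σ₅ : w = P = 0`. -/
def sigma5 : Set B := M.locus fun c => c.w = 0 ∧ c.P = 0

/-- The curve `Σ₁₀ : w = β₅ = 0`. -/
def sigma10 : Set B := M.locus fun c => c.w = 0 ∧ c.β5 = 0

/-- The points `Π₃ : w = β₅ = β₃ = 0`. -/
def pi3 : Set B := M.locus fun c => c.w = 0 ∧ c.β5 = 0 ∧ c.β3 = 0

/-- The points `Π₄ : w = β₅ = β₄ = 0`. -/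
def pi4 : Set B := M.locus fun c => c.w = 0 ∧ c.β5 = 0 ∧ c.β4 = 0

/-- The points `Π₇ : w = P = R = 0`. They contain the points of `Π₃`. -/
def pi7 : Set B := M.locus fun c => c.w = 0 ∧ c.P = 0 ∧ c.R = 0

/-- The points of codimension two of `Σ₅`: those where `β₅` and `β₃` do not vanish. -/
def generalSigma5 : Set B := M.locus fun c => c.w = 0 ∧ c.P = 0 ∧ c.β5 ≠ 0 ∧ c.β3 ≠ 0

/-- The points of codimension two of `Σ₁₀`: those where `β₃` and `β₄` do not vanish. -/
def generalSigma10 : Set B := M.locus fun c => c.w = 0 ∧ c.β5 = 0 ∧ c.β3 ≠ 0 ∧ c.β4 ≠ 0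

/-- The sections are general, the base being a threefold: the loci defined by four conditions
`w = β₅ = β₃ = β₄ = 0`, `w = β₅ = β₃ = β₀ = 0`, `w = β₅ = β₃ = β₂ ^ 2 - 4 β₄ β₀ = 0` and
`w = β₃ = β₂ = β₀ = 0` are empty. -/
def IsGeneral : Prop := ∀ i, ∀ b ∈ M.U i, (M.coeffs i b).w = 0 →
  ((M.coeffs i b).β5 = 0 → (M.coeffs i b).β3 = 0 →
    (M.coeffs i b).β4 ≠ 0 ∧ (M.coeffs i b).β0 ≠ 0 ∧
      (M.coeffs i b).β2 ^ 2 - 4 * (M.coeffs i b).β4 * (M.coeffs i b).β0 ≠ 0) ∧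
  ¬ ((M.coeffs i b).β3 = 0 ∧ (M.coeffs i b).β2 = 0 ∧ (M.coeffs i b).β0 = 0)

end SU5Model

namespace SU5

/-! ### The blow-up of the Weierstrass model

The Weierstrass model `z y ^ 2 + β₅ x y z + β₃ w ^ 2 y z ^ 2 = x ^ 3 + β₄ w x ^ 2 z + β₂ w ^ 3 x z ^ 2
+ β₀ w ^ 5 z ^ 3` lives in a `ℙ ^ 2`-bundle with coordinates `[x : y : z]`. Its singular locus
`x = y = w = 0` is blown up: new coordinates `[u1 : u2 : u3]`, proportional to `(x, y, w z)`.
In the chart `u3 ≠ 0`, with affine coordinates `u1 / u3`, `u2 / u3`, `w`, the remaining singular locus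
`u1 / u3 = u2 / u3 = w = 0` is blown up: new coordinates `[v1 : v2 : v3]`,
proportional to `(u1, u2, w u3)`. -/

/-- Homogeneous coordinates on the fibre of the (twice blown up) ambient space. -/
inductive BVar
  | x | y | z | u1 | u2 | u3 | v1 | v2 | v3

/-- `p` gives homogeneous coordinates of a point, in the fibre with coefficients `c`, of the proper
transform of the Weierstrass model under the two blow-ups. The first six equations are those of the
blow-ups of the ambient space. The last one is the Weierstrass equation, divided by the squares
of the equations of the two exceptional divisors. -/
def IsBlowUpPoint (c : Coeffs) (p : Aff BVar) : Prop :=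
  (p .x ≠ 0 ∨ p .y ≠ 0 ∨ p .z ≠ 0) ∧ (p .u1 ≠ 0 ∨ p .u2 ≠ 0 ∨ p .u3 ≠ 0) ∧
  (p .v1 ≠ 0 ∨ p .v2 ≠ 0 ∨ p .v3 ≠ 0) ∧
  p .x * p .u2 = p .y * p .u1 ∧
  p .x * p .u3 = c.w * p .z * p .u1 ∧
  p .y * p .u3 = c.w * p .z * p .u2 ∧
  p .u1 * p .v2 = p .u2 * p .v1 ∧
  p .u1 * p .v3 = c.w * p .u3 * p .v1 ∧
  p .u2 * p .v3 = c.w * p .u3 * p .v2 ∧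
  p .z * (p .v2 ^ 2 + c.β5 * p .v1 * p .v2 + c.β3 * p .v2 * p .v3) =
    p .x * p .v1 ^ 2 + c.w * p .z * (c.β4 * p .v1 ^ 2 + c.β2 * p .v1 * p .v3 + c.β0 * p .v3 ^ 2)

/-! In the chart `u3 ≠ 0`, `v1 ≠ 0` there are affine coordinates `x = u1 / u3`, `y = v2 / v1`,
`w = v3 / v1` (the section `w` of the base becomes `x w`), in which the blown-up model is the binomial
variety `y s = x w t`, with `s` and `t` as follows. -/

/-- The function `s = y + β₅ + w β₃`. -/
def fs (c : Coeffs) (y w : ℂ) : ℂ := y + c.β5 + w * c.β3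

/-- The function `t = x + β₄ + w β₂ + w ^ 2 β₀`. -/
def ft (c : Coeffs) (x w : ℂ) : ℂ := x + c.β4 + w * c.β2 + w ^ 2 * c.β0

/-- The point lies on the singular locus `y = s = x w = w t = x t = 0` of the binomial variety. -/
def IsSingularPoint (c : Coeffs) (p : Aff BVar) : Prop :=
  p .u3 ≠ 0 ∧ p .v1 ≠ 0 ∧
  p .v2 / p .v1 = 0 ∧
  fs c (p .v2 / p .v1) (p .v3 / p .v1) = 0 ∧
  (p .u1 / p .u3) * (p .v3 / p .v1) = 0 ∧
  (p .v3 / p .v1) * ft c (p .u1 / p .u3) (p .v3 / p .v1) = 0 ∧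
  (p .u1 / p .u3) * ft c (p .u1 / p .u3) (p .v3 / p .v1) = 0

/-! ### The six small resolutions -/

/-- The six small resolutions `ℰ_{ij}`, where `i ≠ j` are in `{x, w, t}`. -/
inductive Resolution
  | wx | tw | xt | wt | xw | tx

/-- For the resolution `ℰ_{ij}`, the permutation `(i, j, k)` of `(x, w, t)`. -/
def Resolution.perm (r : Resolution) (x w t : ℂ) : ℂ × ℂ × ℂ :=
  match r with
  | .wx => (w, x, t)
  | .tw => (t, w, x)
  | .xt => (x, t, w)
  | .wt => (w, t, x)
  | .xw => (x, w, t)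
  | .tx => (t, x, w)

/-- The coordinates `x, y, w`, `[α₊ : σ₊]` and `[α₋ : σ₋]`. -/
inductive AVar
  | x | y | w | αp | σp | αm | σm

/-- `p` gives coordinates of a point, in the fibre with coefficients `c`, of the small resolution
`u_i α₊ = σ₊ y`, `u_j α₋ = σ₋ s`, `α₋ α₊ = σ₋ σ₊ u_k` of the binomial variety. -/
def IsResolutionPoint (r : Resolution) (c : Coeffs) (p : Aff AVar) : Prop :=
  (p .αp ≠ 0 ∨ p .σp ≠ 0) ∧ (p .αm ≠ 0 ∨ p .σm ≠ 0) ∧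
  p .x * p .w = c.w ∧
  (r.perm (p .x) (p .w) (ft c (p .x) (p .w))).1 * p .αp = p .σp * p .y ∧
  (r.perm (p .x) (p .w) (ft c (p .x) (p .w))).2.1 * p .αm = p .σm * fs c (p .y) (p .w) ∧
  p .αm * p .αp = p .σm * p .σp * (r.perm (p .x) (p .w) (ft c (p .x) (p .w))).2.2

/-- The disjoint union of the (homogeneous) coordinates on the two pieces of the fibre of `ℰ_{ij}`:
the small resolution of the binomial variety, and the non-singular part of the blown-up model. -/
def FibreCover (r : Resolution) (c : Coeffs) : Type :=
  {p : Aff AVar // IsResolutionPoint r c p} ⊕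
    {p : Aff BVar // IsBlowUpPoint c p ∧ ¬ IsSingularPoint c p}

instance (r : Resolution) (c : Coeffs) : SpaceWithFunctions (FibreCover r c) :=
  Sum.spaceWithFunctions

/-- Two coordinate vectors represent the same point: rescaling of homogeneous coordinates on each
piece, and the gluing `[x : y : z] = [w x ^ 2 : w x ^ 2 y : 1]`, `[u1 : u2 : u3] = [x : x y : 1]`,
`[v1 : v2 : v3] = [1 : y : w]` of the two pieces. (The relation generates an equivalence relation.) -/
def FibreRel (r : Resolution) (c : Coeffs) : FibreCover r c → FibreCover r c → Prop
  | .inl p, .inl q => ∃ a d : ℂˣ, q.1 .x = p.1 .x ∧ q.1 .y = p.1 .y ∧ q.1 .w = p.1 .w ∧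
      q.1 .αp = a * p.1 .αp ∧ q.1 .σp = a * p.1 .σp ∧
      q.1 .αm = d * p.1 .αm ∧ q.1 .σm = d * p.1 .σm
  | .inr p, .inr q => ∃ a d e : ℂˣ,
      q.1 .x = a * p.1 .x ∧ q.1 .y = a * p.1 .y ∧ q.1 .z = a * p.1 .z ∧
      q.1 .u1 = d * p.1 .u1 ∧ q.1 .u2 = d * p.1 .u2 ∧ q.1 .u3 = d * p.1 .u3 ∧
      q.1 .v1 = e * p.1 .v1 ∧ q.1 .v2 = e * p.1 .v2 ∧ q.1 .v3 = e * p.1 .v3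
  | .inl p, .inr q => ∃ a d e : ℂˣ,
      q.1 .x = a * (p.1 .w * p.1 .x ^ 2) ∧ q.1 .y = a * (p.1 .w * p.1 .x ^ 2 * p.1 .y) ∧
      q.1 .z = a ∧
      q.1 .u1 = d * p.1 .x ∧ q.1 .u2 = d * (p.1 .x * p.1 .y) ∧ q.1 .u3 = d ∧
      q.1 .v1 = e ∧ q.1 .v2 = e * p.1 .y ∧ q.1 .v3 = e * p.1 .w
  | .inr _, .inl _ => False

/-- The (reduced) fibre of the resolution `r` over a point of the base at which the sections have the
values `c`. -/
def Fibre (r : Resolution) (c : Coeffs) : Type := Quot (FibreRel r c)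

instance (r : Resolution) (c : Coeffs) : SpaceWithFunctions (Fibre r c) :=
  Quot.spaceWithFunctions _

/-- The number of nodes of the fibre. -/
noncomputable def nodes (r : Resolution) (c : Coeffs) : ℕ :=
  (irreducibleComponents (Fibre r c)).ncard

end SU5

/-! Over a point with w = 0 the fibre is computed explicitly. On the blown-up model it consists of
three kinds of curves (`isBlowUpPoint_cases`): C₀, the strict transform of the cubic, where u3 = 0;
the curves C₁ on the first exceptional divisor, where v3 = 0 and y (y + β₅) = 0; the curves C₂ on
the second one, where x = 0 and y (y + β₅ + β₃ w) = 0. The small resolution only changes the points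
y = s = xw = wt = xt = 0. Where exactly one of x, w, t is nonzero it inserts one line
(`exists_contractedLine`); where all three vanish it inserts two lines, E : α₋ = 0 and E' : α₊ = 0,
meeting in one point (`exists_contractedLines`).

On Σ₅ with β₃β₅ ≠ 0, both C₁ and C₂ split, and the one line inserted where the two C₂ would cross
closes a hexagon. On Σ₁₀ with β₃β₄ ≠ 0, C₁ is a single line carrying two singular points, x = 0 and
x = -β₄, and the graph is D̃₅. On Π₃, C₂ is a single line too; besides x = 0 and x = -β₄ on C₁ there
are singular points at the two roots of t on C₂, and four inserted lines give D̃₆. On Π₄ the two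
singular points of C₁ coalesce and E, E' are inserted. The two lines C₂ are attached to E' and E
respectively, while C₁ is attached to E if u_i = w, to E' if u_j = w, and to the point E ∩ E' if u_k
= w. The first two cases give E₆, the last one three concurrent lines; their triangle, in a graph
with six vertices, excludes every ADE diagram. Finally P = R = 0 outside Π₃ forces β₃β₅ ≠ 0, so
nothing happens at Π₇.

The geometric notions are reduced to explicit parametrizations. A `Line` is a subset parametrized by
ℂ and a point at infinity, with a regular coordinate around each point. In a T1 space this forces
the topology and the regular functions to be those of the projective line (`Line.areIsomorphic`). If
the coordinate of one line is constant on another curve, they are transversal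
(`meetTransversallyAt_of_coordinate`). A finite family of closed lines that covers the space,
pairwise disjoint or meeting in one point, is the family of its irreducible components
(`IsLineConfiguration.irreducibleComponents_eq`). -/

/-! ### The algebra of regular functions -/

/-- The functions that are regular at a point form a `ℂ`-algebra, and are invertible where they do
not vanish. -/
class HasRegularAlgebra (X : Type*) [SpaceWithFunctions X] : Prop where
  const (a : ℂ) (x : X) : IsRegularAt (fun _ => a) x
  add {f g : X → ℂ} {x : X} : IsRegularAt f x → IsRegularAt g x → IsRegularAt (fun z => f z + g z) x
  mul {f g : X → ℂ} {x : X} : IsRegularAt f x → IsRegularAt g x → IsRegularAt (fun z => f z * g z) x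
  inv {f : X → ℂ} {x : X} : IsRegularAt f x → f x ≠ 0 → IsRegularAt (fun z => (f z)⁻¹) x

/-- Regularity at a point depends on the behaviour of the function near that point only. -/
class HasLocalRegularity (X : Type*) [SpaceWithFunctions X] : Prop where
  congr {f g : X → ℂ} {x : X} : (∀ᶠ z in 𝓝 x, g z = f z) → IsRegularAt f x → IsRegularAt g x

instance Aff.hasRegularAlgebra (ι : Type) : HasRegularAlgebra (Aff ι) where
  const a x := ⟨MvPolynomial.C a, 1, by simp, fun q _ => by
    rw [map_one, div_one]; exact (MvPolynomial.eval_C a).symm⟩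
  add := by
    rintro f g x ⟨P, Q, hQ, h⟩ ⟨P', Q', hQ', h'⟩
    refine ⟨P * Q' + P' * Q, Q * Q', by simp [hQ, hQ'], fun q hq => ?_⟩
    simp only [map_mul, ne_eq, mul_eq_zero, not_or] at hq
    simp only [map_mul, map_add, h q hq.1, h' q hq.2]
    rw [div_add_div _ _ hq.1 hq.2]; ring
  mul := by
    rintro f g x ⟨P, Q, hQ, h⟩ ⟨P', Q', hQ', h'⟩
    refine ⟨P * P', Q * Q', by simp [hQ, hQ'], fun q hq => ?_⟩
    simp only [map_mul, ne_eq, mul_eq_zero, not_or] at hq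
    simp only [map_mul, h q hq.1, h' q hq.2]
    rw [div_mul_div_comm]
  inv := by
    rintro f x ⟨P, Q, hQ, h⟩ hf
    rw [h x hQ] at hf
    have hP : MvPolynomial.eval x P ≠ 0 := fun h0 => hf (by rw [h0, zero_div])
    refine ⟨Q * Q, P * Q, by simp [hQ, hP], fun q hq => ?_⟩
    simp only [map_mul, ne_eq, mul_eq_zero, not_or] at hq
    simp only [map_mul, h q hq.2]
    rw [inv_div, mul_div_mul_right _ _ hq.2]

instance Subtype.hasRegularAlgebra {X : Type*} [SpaceWithFunctions X] [HasRegularAlgebra X]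
    (S : X → Prop) : HasRegularAlgebra (Subtype S) where
  const a x := ⟨fun _ => a, HasRegularAlgebra.const a _, .of_forall fun _ => rfl⟩
  add := by
    rintro f g x ⟨F, hF, h⟩ ⟨G, hG, h'⟩
    refine ⟨_, HasRegularAlgebra.add hF hG, ?_⟩
    filter_upwards [h, h'] with q h1 h2 using by rw [h1, h2]
  mul := by
    rintro f g x ⟨F, hF, h⟩ ⟨G, hG, h'⟩
    refine ⟨_, HasRegularAlgebra.mul hF hG, ?_⟩
    filter_upwards [h, h'] with q h1 h2 using by rw [h1, h2]
  inv := by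
    rintro f x ⟨F, hF, h⟩ hf
    refine ⟨_, HasRegularAlgebra.inv hF (by rwa [← h.self_of_nhds]), ?_⟩
    filter_upwards [h] with q h1 using by rw [h1]

instance Sum.hasRegularAlgebra {X Y : Type*} [SpaceWithFunctions X] [SpaceWithFunctions Y]
    [HasRegularAlgebra X] [HasRegularAlgebra Y] : HasRegularAlgebra (X ⊕ Y) where
  const a x := by
    cases x with
    | inl x => exact HasRegularAlgebra.const (X := X) a x
    | inr y => exact HasRegularAlgebra.const (X := Y) a y
  add {f g x} hf hg := by
    cases x with
    | inl x => exact HasRegularAlgebra.add (X := X) hf hg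
    | inr y => exact HasRegularAlgebra.add (X := Y) hf hg
  mul {f g x} hf hg := by
    cases x with
    | inl x => exact HasRegularAlgebra.mul (X := X) hf hg
    | inr y => exact HasRegularAlgebra.mul (X := Y) hf hg
  inv {f x} hf h := by
    cases x with
    | inl x => exact HasRegularAlgebra.inv (X := X) hf h
    | inr y => exact HasRegularAlgebra.inv (X := Y) hf h

instance Quot.hasRegularAlgebra {X : Type*} [SpaceWithFunctions X] [HasRegularAlgebra X]
    (R : X → X → Prop) : HasRegularAlgebra (Quot R) where
  const a _ x _ := HasRegularAlgebra.const a x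
  add hf hg x hx := HasRegularAlgebra.add (hf x hx) (hg x hx)
  mul hf hg x hx := HasRegularAlgebra.mul (hf x hx) (hg x hx)
  inv := by
    rintro f p hf h x rfl
    exact HasRegularAlgebra.inv (hf x rfl) h

/-- No locality of X is needed: regularity on a subspace is defined through germs of ambient
functions. -/
instance Subtype.hasLocalRegularity {X : Type*} [SpaceWithFunctions X] (S : X → Prop) :
    HasLocalRegularity (Subtype S) where
  congr := by
    rintro f g x h ⟨F, hF, h'⟩
    refine ⟨F, hF, ?_⟩
    filter_upwards [h, h'] with q h1 h2 using by rw [h1, h2]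

theorem Quot.continuous_mk' {X : Type*} [SpaceWithFunctions X] (R : X → X → Prop) :
    Continuous (Quot.mk R) := continuous_coinduced_rng

instance Quot.hasLocalRegularity {X : Type*} [SpaceWithFunctions X] [HasLocalRegularity X]
    (R : X → X → Prop) : HasLocalRegularity (Quot R) where
  congr := by
    rintro f g p h hf x rfl
    exact HasLocalRegularity.congr ((Quot.continuous_mk' R).continuousAt.eventually h) (hf x rfl)

theorem Aff.isRegularAt_coord {ι : Type} (i : ι) (p : Aff ι) : IsRegularAt (fun q : Aff ι => q i) p :=
  ⟨MvPolynomial.X i, 1, by simp, fun q _ => by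
    rw [map_one, div_one]; exact (MvPolynomial.eval_X i).symm⟩

theorem Subtype.isRegularAt_comp_val {X : Type*} [SpaceWithFunctions X] {S : X → Prop} {F : X → ℂ}
    {p : Subtype S} (hF : IsRegularAt F p.1) : IsRegularAt (fun q : Subtype S => F q.1) p :=
  ⟨F, hF, .of_forall fun _ => rfl⟩

section RegularAlgebra

variable {X : Type*} [SpaceWithFunctions X] [HasRegularAlgebra X] {f g : X → ℂ} {x : X}

theorem isRegularAt_div (hf : IsRegularAt f x) (hg : IsRegularAt g x) (h : g x ≠ 0) :
    IsRegularAt (fun z => f z / g z) x := by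
  simpa only [div_eq_mul_inv] using HasRegularAlgebra.mul hf (HasRegularAlgebra.inv hg h)

theorem isRegularAt_sub (hf : IsRegularAt f x) (hg : IsRegularAt g x) :
    IsRegularAt (fun z => f z - g z) x := by
  have := HasRegularAlgebra.add hf (HasRegularAlgebra.mul (HasRegularAlgebra.const (-1) x) hg)
  simpa only [neg_one_mul, ← sub_eq_add_neg] using this

theorem isRegularAt_eval (hf : IsRegularAt f x) (P : Polynomial ℂ) :
    IsRegularAt (fun z => P.eval (f z)) x := by
  induction P using Polynomial.induction_on with
  | C a => simpa using HasRegularAlgebra.const a x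
  | add P Q hP hQ => simpa using HasRegularAlgebra.add hP hQ
  | monomial n a h =>
    simpa [pow_succ, mul_assoc] using HasRegularAlgebra.mul h hf

theorem isRegularAt_eval_div_eval (hf : IsRegularAt f x) (P : Polynomial ℂ) {Q : Polynomial ℂ}
    (hQ : Q.eval (f x) ≠ 0) : IsRegularAt (fun z => P.eval (f z) / Q.eval (f z)) x :=
  isRegularAt_div (isRegularAt_eval hf P) (isRegularAt_eval hf Q) hQ

end RegularAlgebra

/-! ### Parametrized curves -/

/-- The neighbourhoods of `t` in the Zariski topology of the affine line. -/
def cofiniteAt (t : ℂ) : Filter ℂ := Filter.cofinite ⊔ pure t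

theorem eventually_cofiniteAt {p : ℂ → Prop} {t : ℂ} :
    (∀ᶠ s in cofiniteAt t, p s) ↔ {s | ¬ p s}.Finite ∧ p t := by
  simp [cofiniteAt, Filter.eventually_sup, Filter.eventually_cofinite]

theorem eventually_eval_ne_zero {Q : Polynomial ℂ} {t : ℂ} (h : Q.eval t ≠ 0) :
    ∀ᶠ s in cofiniteAt t, Q.eval s ≠ 0 := by
  refine eventually_cofiniteAt.2 ⟨?_, h⟩
  have hQ : Q ≠ 0 := by rintro rfl; simp at h
  simpa using (Q.rootSet_finite ℂ).subset fun s hs => by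
    simpa [Polynomial.mem_rootSet, hQ] using hs

/-- `f` is a quotient of polynomials on a neighbourhood of `t`. -/
def IsRationalAt (f : ℂ → ℂ) (t : ℂ) : Prop :=
  ∃ P Q : Polynomial ℂ, Q.eval t ≠ 0 ∧ ∀ᶠ s in cofiniteAt t, f s = P.eval s / Q.eval s

theorem IsRationalAt.congr {f g : ℂ → ℂ} {t : ℂ} (hf : IsRationalAt f t)
    (h : ∀ᶠ s in cofiniteAt t, g s = f s) : IsRationalAt g t := by
  obtain ⟨P, Q, hQ, h'⟩ := hf
  exact ⟨P, Q, hQ, by filter_upwards [h, h'] with s h1 h2 using h1.trans h2⟩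

/-- `γ` is a morphism near `t`, from the affine line to `X`. -/
structure IsCurveAt {X : Type*} [SpaceWithFunctions X] (γ : ℂ → X) (t : ℂ) : Prop where
  tendsto : Filter.Tendsto γ (cofiniteAt t) (𝓝 (γ t))
  isRationalAt (f : X → ℂ) : IsRegularAt f (γ t) → IsRationalAt (fun s => f (γ s)) t

theorem IsCurveAt.congr {X : Type*} [SpaceWithFunctions X] {γ δ : ℂ → X} {t : ℂ}
    (hγ : IsCurveAt γ t) (h : ∀ᶠ s in cofiniteAt t, δ s = γ s) : IsCurveAt δ t := by
  have ht : δ t = γ t := (eventually_cofiniteAt.1 h).2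
  refine ⟨?_, fun f hf => ?_⟩
  · rw [ht]; exact hγ.tendsto.congr' (by filter_upwards [h] with s hs using hs.symm)
  · rw [ht] at hf
    exact (hγ.isRationalAt f hf).congr (by filter_upwards [h] with s hs using by rw [hs])

theorem MvPolynomial.eval_eval_polynomial {ι : Type} (ℓ : ι → Polynomial ℂ) (Q : MvPolynomial ι ℂ)
    (t : ℂ) : MvPolynomial.eval (fun i => (ℓ i).eval t) Q = (MvPolynomial.aeval ℓ Q).eval t := by
  induction Q using MvPolynomial.induction_on with
  | C a => simp
  | add p q hp hq => simp [hp, hq]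
  | mul_X p i hp => simp [hp]

theorem Aff.isCurveAt {ι : Type} (ℓ : ι → Polynomial ℂ) (t : ℂ) :
    IsCurveAt (X := Aff ι) (fun s i => (ℓ i).eval s) t := by
  have key : ∀ Q : MvPolynomial ι ℂ, MvPolynomial.eval (fun i => (ℓ i).eval t) Q ≠ 0 →
      ∀ᶠ s in cofiniteAt t, MvPolynomial.eval (fun i => (ℓ i).eval s) Q ≠ 0 := by
    intro Q hQ
    simp only [MvPolynomial.eval_eval_polynomial] at hQ ⊢
    exact eventually_eval_ne_zero hQ
  constructor
  · refine TopologicalSpace.tendsto_nhds_generateFrom_iff.2 ?_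
    rintro _ ⟨Q, rfl⟩ hQ
    exact key Q hQ
  · rintro f ⟨P, Q, hQ, h⟩
    refine ⟨MvPolynomial.aeval ℓ P, MvPolynomial.aeval ℓ Q, ?_, ?_⟩
    · rwa [← MvPolynomial.eval_eval_polynomial]
    · filter_upwards [key Q hQ] with s hs
      rw [← MvPolynomial.eval_eval_polynomial, ← MvPolynomial.eval_eval_polynomial]
      exact h _ hs

theorem Subtype.isCurveAt {X : Type*} [SpaceWithFunctions X] {S : X → Prop} {γ : ℂ → Subtype S}
    {t : ℂ} (h : IsCurveAt (fun s => (γ s).1) t) : IsCurveAt γ t := by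
  have h1 : Filter.Tendsto γ (cofiniteAt t) (𝓝 (γ t)) := by
    rw [tendsto_subtype_rng]; exact h.tendsto
  refine ⟨h1, ?_⟩
  rintro f ⟨F, hF, hf⟩
  exact (h.isRationalAt F hF).congr (h1.eventually hf)

theorem Sum.isCurveAt_inl {X Y : Type*} [SpaceWithFunctions X] [SpaceWithFunctions Y] {γ : ℂ → X}
    {t : ℂ} (h : IsCurveAt γ t) : IsCurveAt (fun s => (Sum.inl (γ s) : X ⊕ Y)) t :=
  ⟨(continuous_inl (X := X) (Y := Y)).continuousAt.tendsto.comp h.tendsto,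
    fun _ hf => h.isRationalAt _ hf⟩

theorem Sum.isCurveAt_inr {X Y : Type*} [SpaceWithFunctions X] [SpaceWithFunctions Y] {γ : ℂ → Y}
    {t : ℂ} (h : IsCurveAt γ t) : IsCurveAt (fun s => (Sum.inr (γ s) : X ⊕ Y)) t :=
  ⟨(continuous_inr (X := X) (Y := Y)).continuousAt.tendsto.comp h.tendsto,
    fun _ hf => h.isRationalAt _ hf⟩

theorem Quot.isCurveAt {X : Type*} [SpaceWithFunctions X] (R : X → X → Prop) {γ : ℂ → X} {t : ℂ}
    (h : IsCurveAt γ t) : IsCurveAt (fun s => Quot.mk R (γ s)) t :=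
  ⟨(Quot.continuous_mk' R).continuousAt.tendsto.comp h.tendsto,
    fun _ hf => h.isRationalAt _ (hf _ rfl)⟩

/-- A subset of the space `X`, parametrized by the projective line: `γ` parametrizes the affine part,
`o` is the point at infinity, `τ` and `τ'` are coordinate functions around these. -/
structure Line (X : Type*) [SpaceWithFunctions X] where
  γ : ℂ → X
  o : X
  τ : X → ℂ
  τ' : X → ℂ
  γ_ne : ∀ t, γ t ≠ o
  curve : ∀ t, IsCurveAt γ t
  curve' : IsCurveAt (fun t => if t = 0 then o else γ t⁻¹) 0
  τ_regular : ∀ t, IsRegularAt τ (γ t)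
  τ'_regular : IsRegularAt τ' o
  τ_γ : ∀ t, τ (γ t) = t
  τ'_γ : ∀ t, τ' (γ t) = t⁻¹
  τ'_o : τ' o = 0

namespace Line

variable {X : Type*} [SpaceWithFunctions X] (L : Line X)

/-- The points of the line. -/
def set : Set X := {x | x = L.o ∨ ∃ t, L.γ t = x}

/-- The parametrization around the point at infinity. -/
noncomputable def δ (t : ℂ) : X := if t = 0 then L.o else L.γ t⁻¹

theorem δ_zero : L.δ 0 = L.o := if_pos rfl

theorem δ_of_ne {t : ℂ} (h : t ≠ 0) : L.δ t = L.γ t⁻¹ := if_neg h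

theorem curve_δ : IsCurveAt L.δ 0 :=
  L.curve'

theorem τ'_δ (t : ℂ) : L.τ' (L.δ t) = t := by
  by_cases h : t = 0
  · rw [h, δ_zero, L.τ'_o]
  · rw [L.δ_of_ne h, L.τ'_γ, inv_inv]

theorem γ_injective : Function.Injective L.γ := fun s t h => by
  rw [← L.τ_γ s, h, L.τ_γ]

theorem γ_mem (t : ℂ) : L.γ t ∈ L.set := .inr ⟨t, rfl⟩

theorem o_mem : L.o ∈ L.set := .inl rfl

theorem δ_mem (t : ℂ) : L.δ t ∈ L.set := by
  by_cases h : t = 0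
  · rw [h, δ_zero]; exact L.o_mem
  · rw [L.δ_of_ne h]; exact L.γ_mem _

theorem diff_range_γ : (L.set \ Set.range L.γ).Finite :=
  (Set.finite_singleton L.o).subset <| by
    rintro x ⟨h | h, h'⟩
    · exact h
    · exact (h' h).elim

theorem diff_range_δ : (L.set \ Set.range L.δ).Finite :=
  (Set.finite_singleton (L.γ 0)).subset <| by
    rintro x ⟨rfl | ⟨t, rfl⟩, h'⟩
    · exact (h' ⟨0, L.δ_zero⟩).elim
    · by_cases h : t = 0
      · rw [h]; rfl
      · exact (h' ⟨t⁻¹, by rw [L.δ_of_ne (inv_ne_zero h), inv_inv]⟩).elim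

/-- Open sets meeting the line contain almost all of its points. -/
theorem finite_compl {U : Set X} (hU : IsOpen U) (h : (L.set ∩ U).Nonempty) :
    {t | L.γ t ∉ U}.Finite := by
  obtain ⟨x, rfl | ⟨t, rfl⟩, hx⟩ := h
  · have := L.curve_δ.tendsto (hU.mem_nhds (by rwa [δ_zero]))
    have h1 := (eventually_cofiniteAt.1 this).1
    -- Inversion carries the finite bad set of the chart at infinity to the affine chart; only the
    -- parameter 0 is not reached.
    refine ((h1.image (·⁻¹)).insert 0).subset fun t ht => ?_
    by_cases h0 : t = 0
    · exact .inl h0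
    · exact .inr ⟨t⁻¹, by rw [Set.mem_ofPred_eq, L.δ_of_ne (inv_ne_zero h0), inv_inv]; exact ht,
        inv_inv t⟩
  · exact (eventually_cofiniteAt.1 ((L.curve t).tendsto (hU.mem_nhds hx))).1

/-- Two open sets meeting the line each contain all but finitely many of its points, and ℂ is
infinite. -/
theorem isIrreducible : IsIrreducible L.set := by
  refine ⟨⟨_, L.o_mem⟩, fun U V hU hV h h' => ?_⟩
  obtain ⟨t, ht⟩ := ((L.finite_compl hU h).union (L.finite_compl hV h')).infinite_compl.nonempty
  simp only [Set.mem_compl_iff, Set.mem_union, Set.mem_ofPred_eq, not_or, not_not] at ht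
  exact ⟨_, L.γ_mem t, ht⟩

theorem infinite : L.set.Infinite :=
  (Set.infinite_range_of_injective L.γ_injective).mono (by rintro _ ⟨t, rfl⟩; exact L.γ_mem t)

/-- The line, as a line in the subspace consisting of its points. -/
def toSubtype : Line L.set where
  γ t := ⟨L.γ t, L.γ_mem t⟩
  o := ⟨L.o, L.o_mem⟩
  τ x := L.τ x
  τ' x := L.τ' x
  γ_ne t h := L.γ_ne t (congrArg Subtype.val h)
  curve t := Subtype.isCurveAt (L.curve t)
  curve' := Subtype.isCurveAt (L.curve'.congr (.of_forall fun t => by split_ifs <;> rfl))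
  τ_regular t := Subtype.isRegularAt_comp_val (L.τ_regular t)
  τ'_regular := Subtype.isRegularAt_comp_val L.τ'_regular
  τ_γ := L.τ_γ
  τ'_γ := L.τ'_γ
  τ'_o := L.τ'_o

theorem toSubtype_set : L.toSubtype.set = Set.univ := by
  ext ⟨x, rfl | ⟨t, rfl⟩⟩
  · exact iff_of_true L.toSubtype.o_mem trivial
  · exact iff_of_true (L.toSubtype.γ_mem t) trivial

end Line

/-- Conversely, if f ∘ γ is P / Q near t, then f agrees with the regular function P(τ) / Q(τ)
outside a finite set of points different from γ t: those off the curve and those where the two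
expressions differ. This set is closed since the space is T1. -/
theorem isRegularAt_iff_of_curve {Y : Type*} [SpaceWithFunctions Y] [HasRegularAlgebra Y]
    [HasLocalRegularity Y] [T1Space Y] {γ : ℂ → Y} {t : ℂ} {τ : Y → ℂ} (hγ : IsCurveAt γ t)
    (hfin : (Set.range γ)ᶜ.Finite) (hτ : IsRegularAt τ (γ t)) (hτγ : ∀ s, τ (γ s) = s)
    (f : Y → ℂ) : IsRegularAt f (γ t) ↔ IsRationalAt (fun s => f (γ s)) t := by
  refine ⟨hγ.isRationalAt f, ?_⟩
  rintro ⟨P, Q, hQ, h⟩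
  rw [eventually_cofiniteAt] at h
  refine HasLocalRegularity.congr ?_
    (isRegularAt_eval_div_eval hτ P (Q := Q) (by rwa [hτγ]))
  have hS : ((Set.range γ)ᶜ ∪ γ '' {s | ¬ f (γ s) = P.eval s / Q.eval s}).Finite :=
    hfin.union (h.1.image γ)
  have ht : γ t ∉ (Set.range γ)ᶜ ∪ γ '' {s | ¬ f (γ s) = P.eval s / Q.eval s} := by
    rintro (h1 | ⟨s, hs, hst⟩)
    · exact h1 ⟨t, rfl⟩
    · have : s = t := by rw [← hτγ s, hst, hτγ]
      exact hs (this ▸ h.2)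
  filter_upwards [hS.isClosed.isOpen_compl.mem_nhds ht] with z hz
  simp only [Set.mem_compl_iff, Set.mem_union, not_or, not_not] at hz
  obtain ⟨⟨s, rfl⟩, hz⟩ := hz
  rw [hτγ]
  by_contra hne
  exact hz ⟨s, hne, rfl⟩

/-! ### Spaces parametrized by the projective line are isomorphic -/

namespace Line

variable {Y : Type*} [SpaceWithFunctions Y] (L : Line Y)

/-- Finite sets are closed because the space is T1, and nonempty open sets are cofinite because γ is
continuous for the cofinite topology; so the topology depends on the set of points only. -/
theorem isOpen_iff [T1Space Y] (hL : L.set = Set.univ) (U : Set Y) :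
    IsOpen U ↔ U = ∅ ∨ Uᶜ.Finite := by
  constructor
  · intro hU
    rcases U.eq_empty_or_nonempty with h | h
    · exact .inl h
    · refine .inr <| (((L.finite_compl hU (by rwa [hL, Set.univ_inter])).image L.γ).insert L.o).subset
        fun x hx => ?_
      rcases (hL.symm ▸ Set.mem_univ x : x ∈ L.set) with h' | ⟨t, rfl⟩
      · exact .inl h'
      · exact .inr ⟨t, hx, rfl⟩
  · rintro (rfl | h)
    · exact isOpen_empty
    · simpa using h.isClosed.isOpen_compl

/-- The points of the line are the points of the affine line and the point at infinity. -/
noncomputable def equiv (hL : L.set = Set.univ) : Option ℂ ≃ Y :=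
  Equiv.ofBijective (fun a => a.elim L.o L.γ) <| by
    constructor
    · rintro (_ | s) (_ | t) h
      · rfl
      · exact (L.γ_ne t h.symm).elim
      · exact (L.γ_ne s h).elim
      · exact congrArg some (L.γ_injective h)
    · intro x
      rcases (hL.symm ▸ Set.mem_univ x : x ∈ L.set) with h | ⟨t, rfl⟩
      · exact ⟨none, h.symm⟩
      · exact ⟨some t, rfl⟩

theorem isRegularAt_γ_iff [HasRegularAlgebra Y] [HasLocalRegularity Y] [T1Space Y]
    (hL : L.set = Set.univ) (f : Y → ℂ) (t : ℂ) :
    IsRegularAt f (L.γ t) ↔ IsRationalAt (fun s => f (L.γ s)) t :=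
  isRegularAt_iff_of_curve (L.curve t)
    (by rw [Set.compl_eq_univ_sdiff, ← hL]; exact L.diff_range_γ) (L.τ_regular t) L.τ_γ f

theorem isRegularAt_o_iff [HasRegularAlgebra Y] [HasLocalRegularity Y] [T1Space Y]
    (hL : L.set = Set.univ) (f : Y → ℂ) :
    IsRegularAt f L.o ↔ IsRationalAt (fun s => f (L.δ s)) 0 := by
  have := isRegularAt_iff_of_curve L.curve_δ
    (by rw [Set.compl_eq_univ_sdiff, ← hL]; exact L.diff_range_δ)
    (by rw [L.δ_zero]; exact L.τ'_regular) L.τ'_δ f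
  rwa [L.δ_zero] at this

/-- Any two spaces parametrized by the projective line are isomorphic. -/
theorem areIsomorphic [HasRegularAlgebra Y] [HasLocalRegularity Y] [T1Space Y]
    (hL : L.set = Set.univ) {Y' : Type*} [SpaceWithFunctions Y'] [HasRegularAlgebra Y']
    [HasLocalRegularity Y'] [T1Space Y'] (L' : Line Y') (hL' : L'.set = Set.univ) :
    AreIsomorphic Y Y' := by
  let e : Y ≃ Y' := (L.equiv hL).symm.trans (L'.equiv hL')
  have heγ : ∀ t, e (L.γ t) = L'.γ t := fun t => by
    have : (L.equiv hL).symm (L.γ t) = some t := by rw [Equiv.symm_apply_eq]; rfl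
    simp only [e, Equiv.trans_apply, this]; rfl
  have heo : e L.o = L'.o := by
    have : (L.equiv hL).symm L.o = none := by rw [Equiv.symm_apply_eq]; rfl
    simp only [e, Equiv.trans_apply, this]; rfl
  have heδ : ∀ t, e (L.δ t) = L'.δ t := fun t => by
    by_cases h : t = 0
    · rw [h, δ_zero, δ_zero, heo]
    · rw [L.δ_of_ne h, L'.δ_of_ne h, heγ]
  refine ⟨e.toHomeomorph fun s => ?_, fun f x => ?_⟩
  · rw [L.isOpen_iff hL, L'.isOpen_iff hL', ← Set.preimage_compl, ← e.image_symm_eq_preimage,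
      ← e.image_symm_eq_preimage, Set.image_eq_empty,
      Set.finite_image_iff e.symm.injective.injOn]
  · change IsRegularAt f (e x) ↔ IsRegularAt (fun x' => f (e x')) x
    rcases (hL.symm ▸ Set.mem_univ x : x ∈ L.set) with rfl | ⟨t, rfl⟩
    · rw [heo, L'.isRegularAt_o_iff hL', L.isRegularAt_o_iff hL]; simp only [heδ]
    · rw [heγ, L'.isRegularAt_γ_iff hL', L.isRegularAt_γ_iff hL]; simp only [heγ]

end Line

/-! ### Zariski closed sets -/

/-- Polynomial functions on the affine space. -/
def IsPolynomialFun {ι : Type} (f : Aff ι → ℂ) : Prop :=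
  ∃ P : MvPolynomial ι ℂ, ∀ p, f p = MvPolynomial.eval p P

namespace IsPolynomialFun

variable {ι κ : Type} {f g : Aff ι → ℂ}

theorem const (a : ℂ) : IsPolynomialFun fun _ : Aff ι => a :=
  ⟨.C a, fun p => (MvPolynomial.eval_C (f := p) a).symm⟩

theorem coord (i : ι) : IsPolynomialFun fun p : Aff ι => p i :=
  ⟨.X i, fun p => (MvPolynomial.eval_X (f := p) i).symm⟩

theorem add (hf : IsPolynomialFun f) (hg : IsPolynomialFun g) :
    IsPolynomialFun fun p => f p + g p := by
  obtain ⟨P, hP⟩ := hf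
  obtain ⟨Q, hQ⟩ := hg
  exact ⟨P + Q, fun p => by beta_reduce; rw [hP, hQ, map_add]⟩

theorem mul (hf : IsPolynomialFun f) (hg : IsPolynomialFun g) :
    IsPolynomialFun fun p => f p * g p := by
  obtain ⟨P, hP⟩ := hf
  obtain ⟨Q, hQ⟩ := hg
  exact ⟨P * Q, fun p => by beta_reduce; rw [hP, hQ, map_mul]⟩

theorem neg (hf : IsPolynomialFun f) : IsPolynomialFun fun p => -f p := by
  obtain ⟨P, hP⟩ := hf
  exact ⟨-P, fun p => by beta_reduce; rw [hP, map_neg]⟩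

theorem sub (hf : IsPolynomialFun f) (hg : IsPolynomialFun g) :
    IsPolynomialFun fun p => f p - g p := by
  simpa only [sub_eq_add_neg] using hf.add hg.neg

theorem pow (hf : IsPolynomialFun f) (n : ℕ) : IsPolynomialFun fun p => f p ^ n := by
  obtain ⟨P, hP⟩ := hf
  exact ⟨P ^ n, fun p => by beta_reduce; rw [hP, map_pow]⟩

theorem eval (hf : IsPolynomialFun f) (P : Polynomial ℂ) :
    IsPolynomialFun fun p => P.eval (f p) := by
  induction P using Polynomial.induction_on with
  | C a => simpa using const a
  | add P Q hP hQ => simpa using hP.add hQ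
  | monomial n a h => simpa using (const a).mul (hf.pow _)

theorem isRegularAt (hf : IsPolynomialFun f) (p : Aff ι) : IsRegularAt f p := by
  obtain ⟨P, hP⟩ := hf
  exact ⟨P, 1, by simp, fun q _ => by rw [map_one, div_one, hP]⟩

theorem isClosed_eq (hf : IsPolynomialFun f) (hg : IsPolynomialFun g) :
    IsClosed {p | f p = g p} := by
  obtain ⟨P, hP⟩ := hf.sub hg
  constructor
  refine TopologicalSpace.isOpen_generateFrom_of_mem ⟨P, ?_⟩
  ext p
  rw [Set.mem_compl_iff, Set.mem_ofPred_eq, Set.mem_ofPred_eq, ← hP, sub_ne_zero]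

end IsPolynomialFun

theorem Quot.isClosed_iff {X : Type*} [SpaceWithFunctions X] {R : X → X → Prop}
    {S : Set (Quot R)} : IsClosed S ↔ IsClosed (Quot.mk R ⁻¹' S) :=
  (isQuotientMap_quot_mk (r := R)).isClosed_preimage.symm

/-! ### The projective line -/

namespace ProjLine

/-- The point with given homogeneous coordinates. -/
def mk (v : {v : Aff (Fin 2) // v 0 ≠ 0 ∨ v 1 ≠ 0}) : ProjLine := Quot.mk _ v

theorem mk_eq_mk {v w : {v : Aff (Fin 2) // v 0 ≠ 0 ∨ v 1 ≠ 0}} :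
    mk v = mk w ↔ v.1 0 * w.1 1 = v.1 1 * w.1 0 := by
  constructor
  · intro h
    -- The relation in the quotient is only a generating one, so equality of classes is tested by an
    -- invariant: the vanishing of the determinant with a fixed vector.
    have key : ∀ x y : {v : Aff (Fin 2) // v 0 ≠ 0 ∨ v 1 ≠ 0},
        (∃ a : ℂˣ, y.1 0 = a * x.1 0 ∧ y.1 1 = a * x.1 1) →
        (v.1 0 * x.1 1 = v.1 1 * x.1 0) = (v.1 0 * y.1 1 = v.1 1 * y.1 0) := by
      rintro x y ⟨a, h0, h1⟩
      rw [h0, h1, mul_left_comm, mul_left_comm _ (a : ℂ), mul_right_inj' a.ne_zero]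
    have := congrArg (Quot.lift _ key) h
    exact this.mp (mul_comm _ _)
  · intro h
    have h' : ∃ a : ℂˣ, w.1 0 = a * v.1 0 ∧ w.1 1 = a * v.1 1 := by
      rcases v.2 with h0 | h0
      · have : w.1 0 ≠ 0 := by
          intro h1
          rw [h1, mul_zero] at h
          rcases w.2 with h2 | h2
          · exact h2 h1
          · exact mul_ne_zero h0 h2 h
        exact ⟨Units.mk0 (w.1 0 / v.1 0) (div_ne_zero this h0), by simp [h0],
          by simp only [Units.val_mk0]; field_simp; linear_combination h⟩
      · have : w.1 1 ≠ 0 := by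
          intro h1
          rw [h1, mul_zero] at h
          rcases w.2 with h2 | h2
          · exact mul_ne_zero h0 h2 h.symm
          · exact h2 h1
        exact ⟨Units.mk0 (w.1 1 / v.1 1) (div_ne_zero this h0),
          by simp only [Units.val_mk0]; field_simp; linear_combination -h, by simp [h0]⟩
    exact Quot.sound h'

theorem exists_eq_mk (x : ProjLine) : ∃ v, mk v = x := Quot.exists_rep x

instance : HasRegularAlgebra ProjLine := Quot.hasRegularAlgebra _

instance : HasLocalRegularity ProjLine := Quot.hasLocalRegularity _

instance : T1Space ProjLine where
  t1 x := by
    obtain ⟨v, rfl⟩ := exists_eq_mk x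
    refine Quot.isClosed_iff.2 ?_
    have h := (((IsPolynomialFun.const (v.1 0)).mul (.coord 1)).isClosed_eq
      ((IsPolynomialFun.const (v.1 1)).mul (.coord 0))).preimage
      (continuous_subtype_val (p := fun v : Aff (Fin 2) => v 0 ≠ 0 ∨ v 1 ≠ 0))
    refine (congrArg IsClosed (Set.ext fun w => ?_)).mp h
    exact (eq_comm.trans mk_eq_mk).symm

/-- The quotient of the first two coordinates. -/
noncomputable def ratio (i j : Fin 2) : ProjLine → ℂ := Quot.lift (fun v => v.1 i / v.1 j) <| by
  rintro v w ⟨a, h0, h1⟩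
  have : ∀ i, w.1 i = a * v.1 i := by intro i; fin_cases i <;> assumption
  simp only [this, mul_div_mul_left _ _ a.ne_zero]

theorem ratio_mk (i j v) : ratio i j (mk v) = v.1 i / v.1 j := rfl

theorem isRegularAt_ratio {i j : Fin 2} {x : ProjLine} (h : ∀ v, mk v = x → v.1 j ≠ 0) :
    IsRegularAt (ratio i j) x := fun v hv =>
  isRegularAt_div (Subtype.isRegularAt_comp_val (Aff.isRegularAt_coord i _))
    (Subtype.isRegularAt_comp_val (Aff.isRegularAt_coord j _)) (h v hv)

/-- The projective line as a line. -/
noncomputable def line : Line ProjLine where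
  γ t := mk ⟨![1, t], .inl one_ne_zero⟩
  o := mk ⟨![0, 1], .inr one_ne_zero⟩
  τ := ratio 1 0
  τ' := ratio 0 1
  γ_ne t h := by rw [mk_eq_mk] at h; simp at h
  curve t := Quot.isCurveAt _ <| Subtype.isCurveAt <|
    (Aff.isCurveAt ![1, Polynomial.X] t).congr <| .of_forall fun s => by
      funext i; fin_cases i <;> simp
  curve' := by
    have h : IsCurveAt (fun t : ℂ => mk ⟨![t, 1], .inr one_ne_zero⟩) 0 :=
      Quot.isCurveAt _ <| Subtype.isCurveAt <|
        (Aff.isCurveAt ![Polynomial.X, 1] 0).congr <| .of_forall fun s => by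
          funext i; fin_cases i <;> simp
    refine h.congr (.of_forall fun t => ?_)
    split_ifs with h0
    · rw [h0]
    · rw [mk_eq_mk]; simp [h0]
  τ_regular t := isRegularAt_ratio fun v hv => by
    rw [mk_eq_mk] at hv
    intro h
    rcases v.2 with h' | h'
    · exact h' h
    · simp [h] at hv; exact h' hv.symm
  τ'_regular := isRegularAt_ratio fun v hv => by
    rw [mk_eq_mk] at hv
    intro h
    rcases v.2 with h' | h'
    · simp [h] at hv; exact h' hv
    · exact h' h
  τ_γ t := by simp [ratio_mk]
  τ'_γ t := by simp [ratio_mk]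
  τ'_o := by simp [ratio_mk]

theorem line_set : line.set = Set.univ := by
  refine Set.eq_univ_of_forall fun x => ?_
  obtain ⟨v, rfl⟩ := exists_eq_mk x
  by_cases h : v.1 0 = 0
  · refine .inl (mk_eq_mk.2 ?_)
    simp [h]
  · refine .inr ⟨v.1 1 / v.1 0, mk_eq_mk.2 ?_⟩
    simp; field_simp

end ProjLine

theorem Line.areIsomorphic_projLine {X : Type*} [SpaceWithFunctions X] [HasRegularAlgebra X]
    [T1Space X] (L : Line X) : AreIsomorphic ProjLine L.set :=
  ProjLine.line.areIsomorphic ProjLine.line_set L.toSubtype L.toSubtype_set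

/-! ### Transversal intersections -/

theorem MeetTransversallyAt.symm {X : Type*} [SpaceWithFunctions X] {C D : Set X} {x : X}
    (h : MeetTransversallyAt C D x) : MeetTransversallyAt D C x := by
  refine ⟨h.2.1, h.1, fun f hf hfx => ?_⟩
  obtain ⟨g, h, hg, hh, h1, h2, h3⟩ := h.2.2 f hf hfx
  exact ⟨h, g, hh, hg, by simpa only [add_comm] using h1, h3, h2⟩

/-- The two curves meet in exactly one point, transversally. -/
structure Meet {X : Type*} [SpaceWithFunctions X] (C D : Set X) : Prop where
  nonempty : (C ∩ D).Nonempty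
  subsingleton : (C ∩ D).Subsingleton
  transversal : ∀ x ∈ C ∩ D, MeetTransversallyAt C D x

theorem Meet.symm {X : Type*} [SpaceWithFunctions X] {C D : Set X} (h : Meet C D) : Meet D C := by
  obtain ⟨h1, h2, h3⟩ := h
  rw [Set.inter_comm] at h1 h2 h3
  exact ⟨h1, h2, fun x hx => (h3 x hx).symm⟩

/-- If a function is a coordinate on `C` near a point and is constant on `D`, then `C` and `D` are
transversal at that point. -/
theorem meetTransversallyAt_of_coordinate {X : Type*} [SpaceWithFunctions X] [HasRegularAlgebra X]
    [T1Space X] {C D : Set X} {γ : ℂ → X} {t : ℂ} {τ : X → ℂ} (hγ : IsCurveAt γ t)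
    (hfin : (C \ Set.range γ).Finite) (hτ : IsRegularAt τ (γ t)) (hτγ : ∀ s, τ (γ s) = s)
    (hC : γ t ∈ C) (hD : γ t ∈ D) (hτD : ∀ x ∈ D, τ x = t) : MeetTransversallyAt C D (γ t) := by
  refine ⟨hC, hD, fun f hf hft => ?_⟩
  obtain ⟨P, Q, hQ, h⟩ := hγ.isRationalAt f hf
  rw [eventually_cofiniteAt] at h
  -- The decomposition is f = (f - P(τ)/Q(τ)) + P(τ)/Q(τ). The first summand vanishes on C near the
  -- point, where f is P/Q in the coordinate. On D the coordinate τ equals t, so the second summand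
  -- takes there the value of f at γ t, which is 0.
  have hreg : IsRegularAt (fun z => P.eval (τ z) / Q.eval (τ z)) (γ t) :=
    isRegularAt_eval_div_eval hτ P (by rwa [hτγ])
  refine ⟨_, _, isRegularAt_sub hf hreg, hreg, .of_forall fun z => (sub_add_cancel _ _).symm, ?_,
    .of_forall fun z hz => by rw [hτD z hz, ← h.2]; exact hft⟩
  have hS : ((C \ Set.range γ) ∪ γ '' {s | ¬ f (γ s) = P.eval s / Q.eval s}).Finite :=
    hfin.union (h.1.image γ)
  have ht : γ t ∉ (C \ Set.range γ) ∪ γ '' {s | ¬ f (γ s) = P.eval s / Q.eval s} := by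
    rintro (h1 | ⟨s, hs, hst⟩)
    · exact h1.2 ⟨t, rfl⟩
    · have : s = t := by rw [← hτγ s, hst, hτγ]
      exact hs (this ▸ h.2)
  filter_upwards [hS.isClosed.isOpen_compl.mem_nhds ht] with z hz hzC
  simp only [Set.mem_compl_iff, Set.mem_union, Set.mem_sdiff, not_or, not_and, not_not] at hz
  obtain ⟨s, rfl⟩ := hz.1 hzC
  rw [hτγ, sub_eq_zero]
  by_contra hne
  exact hz.2 ⟨s, hne, rfl⟩

namespace Line

variable {X : Type*} [SpaceWithFunctions X] [HasRegularAlgebra X] [T1Space X] (L : Line X)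

/-- Constancy of τ on D gives both facts at once: τ is injective on the affine part of the line, so
there is only one common point, and transversality follows from the coordinate criterion. -/
theorem meet_at_γ {D : Set X} {t : ℂ} (hD : L.γ t ∈ D) (ho : L.o ∉ D) (hτ : ∀ x ∈ D, L.τ x = t) :
    Meet L.set D := by
  have key : ∀ x ∈ L.set ∩ D, x = L.γ t := by
    rintro _ ⟨rfl | ⟨s, rfl⟩, hx⟩
    · exact (ho hx).elim
    · rw [← hτ _ hx, L.τ_γ]
  refine ⟨⟨_, L.γ_mem t, hD⟩, fun x hx y hy => by rw [key x hx, key y hy], fun x hx => ?_⟩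
  rw [key x hx]
  exact meetTransversallyAt_of_coordinate (L.curve t) L.diff_range_γ (L.τ_regular t) L.τ_γ
    (L.γ_mem t) hD hτ

/-- The origin has to be excluded separately: `τ'_γ` at t = 0 reads τ' = 0⁻¹ = 0, so τ' does not
distinguish γ 0 from the point at infinity. -/
theorem meet_at_o {D : Set X} (hD : L.o ∈ D) (h0 : L.γ 0 ∉ D) (hτ : ∀ x ∈ D, L.τ' x = 0) :
    Meet L.set D := by
  have key : ∀ x ∈ L.set ∩ D, x = L.δ 0 := by
    rintro _ ⟨rfl | ⟨s, rfl⟩, hx⟩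
    · exact L.δ_zero.symm
    · have := hτ _ hx
      rw [L.τ'_γ, inv_eq_zero] at this
      exact (h0 (this ▸ hx)).elim
  have hD' : L.δ 0 ∈ D := by rwa [L.δ_zero]
  refine ⟨⟨_, L.δ_mem 0, hD'⟩, fun x hx y hy => by rw [key x hx, key y hy], fun x hx => ?_⟩
  rw [key x hx]
  exact meetTransversallyAt_of_coordinate L.curve_δ L.diff_range_δ
    (by rw [L.δ_zero]; exact L.τ'_regular) L.τ'_δ (L.δ_mem 0) hD' hτ

end Line

/-! ### Configurations of lines -/

/-- A finite family of lines covering `X`, with intersection graph `G`, any two of them meeting in at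
most one point and transversally. -/
structure IsLineConfiguration {X : Type*} [SpaceWithFunctions X] {V : Type*} (L : V → Line X)
    (G : SimpleGraph V) : Prop where
  isClosed : ∀ v, IsClosed (L v).set
  cover : ∀ x, ∃ v, x ∈ (L v).set
  meet : ∀ v w, G.Adj v w → Meet (L v).set (L w).set
  disjoint : ∀ v w, v ≠ w → ¬ G.Adj v w → Disjoint (L v).set (L w).set

namespace IsLineConfiguration

variable {X : Type*} [SpaceWithFunctions X] {V : Type*} {L : V → Line X} {G : SimpleGraph V}
  (h : IsLineConfiguration L G)

include h

theorem subsingleton {v w : V} (hvw : v ≠ w) : ((L v).set ∩ (L w).set).Subsingleton := by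
  by_cases hG : G.Adj v w
  · exact (h.meet v w hG).subsingleton
  · rw [(h.disjoint v w hvw hG).inter_eq]; exact Set.subsingleton_empty

theorem eq_of_subset {v w : V} (hvw : (L v).set ⊆ (L w).set) : v = w := by
  by_contra hne
  have := h.subsingleton hne
  rw [Set.inter_eq_left.2 hvw] at this
  exact (L v).infinite this.finite

theorem set_injective : Function.Injective fun v => (L v).set :=
  fun _ _ hvw => h.eq_of_subset hvw.subset

/-- An irreducible set inside a finite union of closed sets lies in one of them, so every component
is contained in a line. No line contains another one, because lines are infinite and two of them
share at most one point. -/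
theorem irreducibleComponents_eq [Finite V] :
    irreducibleComponents X = Set.range fun v => (L v).set := by
  classical
  cases nonempty_fintype V
  have key : ∀ s : Set X, IsIrreducible s → ∃ v, s ⊆ (L v).set := by
    intro s hs
    obtain ⟨_, hz, hsz⟩ := isIrreducible_iff_sUnion_isClosed.1 hs
      (Finset.univ.image fun v => (L v).set) (by simpa using h.isClosed)
      (fun x _ => by simpa using h.cover x)
    obtain ⟨v, -, rfl⟩ := Finset.mem_image.1 hz
    exact ⟨v, hsz⟩
  ext s
  constructor
  · intro hs
    obtain ⟨v, hv⟩ := key s hs.1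
    exact ⟨v, (hs.2 (L v).isIrreducible hv).antisymm hv⟩
  · rintro ⟨v, rfl⟩
    refine ⟨(L v).isIrreducible, fun s hs hvs => ?_⟩
    obtain ⟨w, hw⟩ := key s hs
    have := h.eq_of_subset (hvs.trans hw)
    subst this
    exact hw

theorem ncard_irreducibleComponents [Finite V] : (irreducibleComponents X).ncard = Nat.card V := by
  rw [h.irreducibleComponents_eq, ← Set.image_univ, Set.ncard_image_of_injective _ h.set_injective,
    Set.ncard_univ]

theorem isConfigurationOfLines [HasRegularAlgebra X] [T1Space X] [Finite V] :
    IsConfigurationOfLines X := by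
  unfold IsConfigurationOfLines
  rw [h.irreducibleComponents_eq]
  refine ⟨?_, ?_⟩
  · rintro _ ⟨v, rfl⟩
    exact (L v).areIsomorphic_projLine
  · rintro _ ⟨v, rfl⟩ _ ⟨w, rfl⟩ hvw
    have hne : v ≠ w := fun e => hvw (by rw [e])
    refine ⟨h.subsingleton hne, fun x hx => ?_⟩
    by_cases hG : G.Adj v w
    · exact (h.meet v w hG).transversal x hx
    · exact ((h.disjoint v w hne hG).le_bot hx).elim

theorem adj_iff {v w : V} : G.Adj v w ↔ v ≠ w ∧ ((L v).set ∩ (L w).set).Nonempty := by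
  refine ⟨fun hG => ⟨hG.ne, (h.meet v w hG).nonempty⟩, fun ⟨hne, hx⟩ => ?_⟩
  by_contra hG
  exact Set.not_nonempty_iff_eq_empty.2 (h.disjoint v w hne hG).inter_eq hx

theorem dualGraph_iso [Finite V] : Nonempty (dualGraph X ≃g G) := by
  let e : V ≃ irreducibleComponents X :=
    (Equiv.ofInjective _ h.set_injective).trans (Equiv.setCongr h.irreducibleComponents_eq.symm)
  refine ⟨(⟨e, fun {v w} => ?_⟩ : G ≃g dualGraph X).symm⟩
  rw [h.adj_iff]
  exact and_congr e.injective.ne_iff Iff.rfl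

/-- Three lines through a common point would be pairwise adjacent in G; hence a graph without
triangles excludes triple points. -/
theorem hasDualGraph [HasRegularAlgebra X] [T1Space X] [Finite V]
    (hG : ∀ u v w, G.Adj u v → G.Adj u w → ¬ G.Adj v w) {W : Type*} {H : SimpleGraph W}
    (hGH : Nonempty (G ≃g H)) : HasDualGraph X H := by
  refine ⟨h.isConfigurationOfLines, ?_, ?_⟩
  · rw [h.irreducibleComponents_eq]
    rintro _ ⟨u, rfl⟩ _ ⟨v, rfl⟩ _ ⟨w, rfl⟩ huv huw hvw
    rw [Set.eq_empty_iff_forall_notMem]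
    rintro x ⟨⟨hu, hv⟩, hw⟩
    have key : ∀ a b, (L a).set ≠ (L b).set → x ∈ (L a).set → x ∈ (L b).set → G.Adj a b :=
      fun a b hab ha hb => h.adj_iff.2 ⟨fun e => hab (by rw [e]), x, ha, hb⟩
    exact hG u v w (key u v huv hu hv) (key u w huw hu hw) (key v w hvw hv hw)
  · obtain ⟨e⟩ := h.dualGraph_iso
    obtain ⟨e'⟩ := hGH
    exact ⟨e.trans e'⟩

end IsLineConfiguration

/-! ### Proportional vectors -/

theorem exists_unit_mul_eq_pair {a b a' b' : ℂ} (h : a ≠ 0 ∨ b ≠ 0) (h' : a' ≠ 0 ∨ b' ≠ 0)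
    (e : a * b' = b * a') : ∃ l : ℂˣ, a' = l * a ∧ b' = l * b := by
  by_cases ha : a = 0
  · have hb : b ≠ 0 := by tauto
    have ha' : a' = 0 := by simpa [ha, hb] using e.symm
    have hb' : b' ≠ 0 := by tauto
    exact ⟨Units.mk0 (b' / b) (div_ne_zero hb' hb), by simp [ha, ha'], by simp [hb]⟩
  · have ha' : a' ≠ 0 := fun h0 => by
      have : b' = 0 := by simpa [h0, ha] using e
      tauto
    refine ⟨Units.mk0 (a' / a) (div_ne_zero ha' ha), by simp [ha], ?_⟩
    simp only [Units.val_mk0]; field_simp; linear_combination e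

theorem exists_unit_mul_eq_triple {a b c a' b' c' : ℂ} (h : a ≠ 0 ∨ b ≠ 0 ∨ c ≠ 0)
    (h' : a' ≠ 0 ∨ b' ≠ 0 ∨ c' ≠ 0) (e1 : a * b' = b * a') (e2 : a * c' = c * a')
    (e3 : b * c' = c * b') : ∃ l : ℂˣ, a' = l * a ∧ b' = l * b ∧ c' = l * c := by
  by_cases ha : a = 0
  · have ha' : a' = 0 := by
      by_contra hne
      have hb : b = 0 := by simpa [ha, hne] using e1.symm
      have hc : c = 0 := by simpa [ha, hne] using e2.symm
      tauto
    obtain ⟨l, hb, hc⟩ := exists_unit_mul_eq_pair (a := b) (b := c) (by tauto)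
      (by tauto : b' ≠ 0 ∨ c' ≠ 0) e3
    exact ⟨l, by simp [ha, ha'], hb, hc⟩
  · have ha' : a' ≠ 0 := fun h0 => by
      have hb : b' = 0 := by simpa [h0, ha] using e1
      have hc : c' = 0 := by simpa [h0, ha] using e2
      tauto
    refine ⟨Units.mk0 (a' / a) (div_ne_zero ha' ha), by simp [ha], ?_, ?_⟩
    · simp only [Units.val_mk0]; field_simp; linear_combination e1
    · simp only [Units.val_mk0]; field_simp; linear_combination e2

namespace SU5

/-! ### Points of the fibre -/

/-- A vector of coordinates on the small resolution. -/
def avec {R : Type} (x y w αp σp αm σm : R) : AVar → R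
  | .x => x | .y => y | .w => w | .αp => αp | .σp => σp | .αm => αm | .σm => σm

/-- A vector of coordinates on the blown-up Weierstrass model. -/
def bvec {R : Type} (x y z u1 u2 u3 v1 v2 v3 : R) : BVar → R
  | .x => x | .y => y | .z => z | .u1 => u1 | .u2 => u2 | .u3 => u3 | .v1 => v1 | .v2 => v2 | .v3 => v3

/-- The map from the small resolution to the blown-up Weierstrass model, in coordinates. -/
def toBlowUp (p : Aff AVar) : Aff BVar :=
  bvec (p .w * p .x ^ 2) (p .w * p .x ^ 2 * p .y) 1 (p .x) (p .x * p .y) 1 1 (p .y) (p .w)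

theorem isPolynomialFun_toBlowUp (a : BVar) : IsPolynomialFun fun p => toBlowUp p a := by
  cases a
  · exact (IsPolynomialFun.coord _).mul ((IsPolynomialFun.coord _).pow 2)
  · exact ((IsPolynomialFun.coord _).mul ((IsPolynomialFun.coord _).pow 2)).mul
      (IsPolynomialFun.coord _)
  · exact .const 1
  · exact .coord _
  · exact (IsPolynomialFun.coord _).mul (IsPolynomialFun.coord _)
  · exact .const 1
  · exact .const 1
  · exact .coord _
  · exact .coord _

/-- The values of `u_i`, `u_j` and `u_k` at a point. -/
def uvals (r : Resolution) (c : Coeffs) (x w : ℂ) : ℂ × ℂ × ℂ := r.perm x w (ft c x w)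

theorem uvals_prod (r : Resolution) (c : Coeffs) (x w : ℂ) :
    (uvals r c x w).1 * (uvals r c x w).2.1 * (uvals r c x w).2.2 = x * w * ft c x w := by
  cases r <;> simp only [uvals, Resolution.perm] <;> ring

/-- At most one of `u_i`, `u_j`, `u_k` is different from zero. -/
theorem uvals_pairs (r : Resolution) (c : Coeffs) (x w : ℂ) :
    ((uvals r c x w).1 * (uvals r c x w).2.1 = 0 ∧ (uvals r c x w).1 * (uvals r c x w).2.2 = 0 ∧
      (uvals r c x w).2.1 * (uvals r c x w).2.2 = 0) ↔
    (x * w = 0 ∧ w * ft c x w = 0 ∧ x * ft c x w = 0) := by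
  cases r <;> simp only [uvals, Resolution.perm] <;> grind

section

variable {r : Resolution} {c : Coeffs}

/-- The small resolution maps to the binomial variety: where σ₊σ₋ ≠ 0, multiply the first two
equations and insert the third. If σ₊ = 0 then u_i = 0, α₋ = 0 and s = 0; if σ₋ = 0 then u_j = 0, α₊
= 0 and y = 0; both sides vanish in these cases. -/
theorem IsResolutionPoint.eq {p : Aff AVar} (h : IsResolutionPoint r c p) :
    p .y * fs c (p .y) (p .w) = p .x * p .w * ft c (p .x) (p .w) := by
  rw [← uvals_prod r]
  obtain ⟨h1, h2, -, h4, h5, h6⟩ := h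
  change (uvals r c (p .x) (p .w)).1 * _ = _ at h4
  change (uvals r c (p .x) (p .w)).2.1 * _ = _ at h5
  change _ = _ * (uvals r c (p .x) (p .w)).2.2 at h6
  generalize uvals r c (p .x) (p .w) = u at *
  by_cases hp : p .σp = 0
  · have hp' : p .αp ≠ 0 := by tauto
    grind
  · by_cases hm : p .σm = 0
    · have hm' : p .αm ≠ 0 := by tauto
      grind
    · apply mul_left_cancel₀ (mul_ne_zero hp hm)
      linear_combination -(p .αp * u.1) * h5 - (p .σm * fs c (p .y) (p .w)) * h4
        + u.1 * u.2.1 * h6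

theorem isSingularPoint_toBlowUp {p : Aff AVar} : IsSingularPoint c (toBlowUp p) ↔
    p .y = 0 ∧ fs c (p .y) (p .w) = 0 ∧ p .x * p .w = 0 ∧ p .w * ft c (p .x) (p .w) = 0 ∧
      p .x * ft c (p .x) (p .w) = 0 := by
  simp [IsSingularPoint, toBlowUp, bvec]

theorem IsResolutionPoint.isBlowUpPoint {p : Aff AVar} (h : IsResolutionPoint r c p) :
    IsBlowUpPoint c (toBlowUp p) := by
  have h1 := h.eq
  have h2 := h.2.2.1
  simp only [fs, ft] at h1
  simp only [IsBlowUpPoint, toBlowUp, bvec, ← h2]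
  refine ⟨by simp, by simp, by simp, ?_, ?_, ?_, ?_, ?_, ?_, ?_⟩
  all_goals first | linear_combination h1 | ring

/-- Over a non-singular point, the coordinates of the point of the small resolution are determined. -/
theorem IsResolutionPoint.minors {p q : Aff AVar} (hp : IsResolutionPoint r c p)
    (hq : IsResolutionPoint r c q) (hx : q .x = p .x) (hy : q .y = p .y) (hw : q .w = p .w)
    (hs : ¬ IsSingularPoint c (toBlowUp p)) :
    p .αp * q .σp = p .σp * q .αp ∧ p .αm * q .σm = p .σm * q .αm := by
  rw [isSingularPoint_toBlowUp, ← uvals_pairs r] at hs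
  obtain ⟨h1, h2, -, h4, h5, h6⟩ := hp
  obtain ⟨h1', h2', -, h4', h5', h6'⟩ := hq
  rw [hx, hw] at h4' h5' h6'
  rw [hy] at h4' h5'
  change (uvals r c (p .x) (p .w)).1 * _ = _ at h4 h4'
  change (uvals r c (p .x) (p .w)).2.1 * _ = _ at h5 h5'
  change _ = _ * (uvals r c (p .x) (p .w)).2.2 at h6 h6'
  generalize uvals r c (p .x) (p .w) = u at *
  generalize fs c (p .y) (p .w) = s at *
  generalize p .y = y at *
  obtain ⟨a, b, d⟩ := u
  simp only at *
  clear hx hy hw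
  -- The equation u_i α₊ = σ₊ y determines [α₊ : σ₊] as soon as y or u_i is nonzero; likewise u_j α₋
  -- = σ₋ s determines [α₋ : σ₋]. If only one ratio is determined this way, the third equation α₋α₊
  -- = σ₋σ₊u_k gives the other one; if neither is, the point is singular.
  have hP : y ≠ 0 ∨ a ≠ 0 → p .αp * q .σp = p .σp * q .αp := by
    rintro (h | h)
    · apply mul_left_cancel₀ h; linear_combination -(p .αp) * h4' + q .αp * h4
    · apply mul_left_cancel₀ h; linear_combination (q .σp) * h4 - p .σp * h4'
  have hM : s ≠ 0 ∨ b ≠ 0 → p .αm * q .σm = p .σm * q .αm := by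
    rintro (h | h)
    · apply mul_left_cancel₀ h; linear_combination -(p .αm) * h5' + q .αm * h5
    · apply mul_left_cancel₀ h; linear_combination (q .σm) * h5 - p .σm * h5'
  by_cases hA : y ≠ 0 ∨ a ≠ 0
  · refine ⟨hP hA, ?_⟩
    by_cases hB : s ≠ 0 ∨ b ≠ 0
    · exact hM hB
    · push Not at hB
      grind
  · push Not at hA
    by_cases hB : s ≠ 0 ∨ b ≠ 0
    · refine ⟨?_, hM hB⟩
      grind
    · push Not at hB
      grind

/-- The coordinates on the blown-up model of a point of the cover of the fibre. -/
def FibreCover.toBlowUp : FibreCover r c → Aff BVar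
  | .inl p => SU5.toBlowUp p.1
  | .inr q => q.1

/-- The two vectors are homogeneous coordinates of the same point of the ambient space. -/
def Scaled (p q : Aff BVar) : Prop := ∃ a d e : ℂˣ,
  q .x = a * p .x ∧ q .y = a * p .y ∧ q .z = a * p .z ∧
  q .u1 = d * p .u1 ∧ q .u2 = d * p .u2 ∧ q .u3 = d * p .u3 ∧
  q .v1 = e * p .v1 ∧ q .v2 = e * p .v2 ∧ q .v3 = e * p .v3

/-- The homogeneous coordinates of the two vectors are proportional. -/
def Proportional (p q : Aff BVar) : Prop :=
  (p .x * q .y = p .y * q .x ∧ p .x * q .z = p .z * q .x ∧ p .y * q .z = p .z * q .y) ∧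
  (p .u1 * q .u2 = p .u2 * q .u1 ∧ p .u1 * q .u3 = p .u3 * q .u1 ∧
    p .u2 * q .u3 = p .u3 * q .u2) ∧
  (p .v1 * q .v2 = p .v2 * q .v1 ∧ p .v1 * q .v3 = p .v3 * q .v1 ∧
    p .v2 * q .v3 = p .v3 * q .v2)

theorem FibreRel.scaled {a b : FibreCover r c} (h : FibreRel r c a b) :
    Scaled a.toBlowUp b.toBlowUp := by
  rcases a with p | p <;> rcases b with q | q
  · obtain ⟨-, -, hx, hy, hw, -⟩ := h
    refine ⟨1, 1, 1, ?_⟩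
    simp [FibreCover.toBlowUp, SU5.toBlowUp, bvec, hx, hy, hw]
  · obtain ⟨a, d, e, h⟩ := h
    refine ⟨a, d, e, ?_⟩
    simpa [FibreCover.toBlowUp, SU5.toBlowUp, bvec] using h
  · exact h.elim
  · exact h

/-- `Scaled` is what the gluing provides and `Proportional` what can be checked by polynomial
equations. They agree on points of the blow-up because none of the three coordinate triples vanishes
there. -/
theorem Proportional.scaled {p q : Aff BVar} (h : Proportional p q) (hp : IsBlowUpPoint c p)
    (hq : IsBlowUpPoint c q) : Scaled p q := by
  obtain ⟨⟨h1, h2, h3⟩, ⟨h4, h5, h6⟩, h7, h8, h9⟩ := h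
  obtain ⟨a, ha⟩ := exists_unit_mul_eq_triple hp.1 hq.1 h1 h2 h3
  obtain ⟨d, hd⟩ := exists_unit_mul_eq_triple hp.2.1 hq.2.1 h4 h5 h6
  obtain ⟨e, he⟩ := exists_unit_mul_eq_triple hp.2.2.1 hq.2.2.1 h7 h8 h9
  exact ⟨a, d, e, ha.1, ha.2.1, ha.2.2, hd.1, hd.2.1, hd.2.2, he⟩

theorem Proportional.refl (p : Aff BVar) : Proportional p p := by
  refine ⟨⟨?_, ?_, ?_⟩, ⟨?_, ?_, ?_⟩, ?_, ?_, ?_⟩ <;> ring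

theorem Scaled.proportional_iff {p q : Aff BVar} (h : Scaled p q) (o : Aff BVar) :
    Proportional o p ↔ Proportional o q := by
  obtain ⟨a, d, e, h1, h2, h3, h4, h5, h6, h7, h8, h9⟩ := h
  have key : ∀ (l : ℂˣ) (x y x' y' : ℂ), x * (l * y') = y * (l * x') ↔ x * y' = y * x' := by
    intro l x y x' y'
    rw [mul_left_comm, mul_left_comm y, mul_right_inj' l.ne_zero]
  simp only [Proportional, h1, h2, h3, h4, h5, h6, h7, h8, h9, key]

theorem Scaled.isSingularPoint_iff {p q : Aff BVar} (h : Scaled p q) :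
    IsSingularPoint c p ↔ IsSingularPoint c q := by
  obtain ⟨a, d, e, h1, h2, h3, h4, h5, h6, h7, h8, h9⟩ := h
  simp only [IsSingularPoint, h4, h6, h7, h8, h9, mul_div_mul_left _ _ (Units.ne_zero _), ne_eq,
    mul_eq_zero, Units.ne_zero, false_or]

end

/-! ### Equality of points and topology of the fibre -/

namespace Fibre

variable {r : Resolution} {c : Coeffs}

/-- The point of the fibre given by a point of its cover. -/
def mk (a : FibreCover r c) : Fibre r c := Quot.mk _ a

/-- The point with given coordinates on the small resolution. -/
def inl (p : Aff AVar) (h : IsResolutionPoint r c p) : Fibre r c := mk (.inl ⟨p, h⟩)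

/-- The point with given coordinates on the blown-up model. -/
def inr (q : Aff BVar) (h : IsBlowUpPoint c q) (h' : ¬ IsSingularPoint c q) : Fibre r c :=
  mk (.inr ⟨q, h, h'⟩)

theorem cases {P : Fibre r c → Prop} (h : ∀ p hp, P (inl p hp)) (h' : ∀ q hq hq', P (inr q hq hq'))
    (x : Fibre r c) : P x := by
  obtain ⟨p | q, rfl⟩ := Quot.exists_rep x
  · exact h p.1 p.2
  · exact h' q.1 q.2.1 q.2.2

/-- The point lies over a singular point of the blown-up model. -/
def IsExceptional : Fibre r c → Prop := Quot.lift (fun a => IsSingularPoint c a.toBlowUp)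
  fun _ _ h => propext h.scaled.isSingularPoint_iff

theorem isExceptional_inl {p : Aff AVar} {h : IsResolutionPoint r c p} :
    IsExceptional (inl p h) ↔ IsSingularPoint c (toBlowUp p) := Iff.rfl

theorem not_isExceptional_inr {q : Aff BVar} {h : IsBlowUpPoint c q} {h' : ¬ IsSingularPoint c q} :
    ¬ IsExceptional (inr (r := r) q h h') := h'

/-- Being proportional to a fixed vector is invariant under the generating relation, hence under the
equivalence relation it generates. -/
theorem proportional_of_mk_eq {a b : FibreCover r c} (h : mk a = mk b) :
    Proportional a.toBlowUp b.toBlowUp := by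
  have := congrArg (Quot.lift (fun e : FibreCover r c => Proportional a.toBlowUp e.toBlowUp)
    fun _ _ h => propext (h.scaled.proportional_iff _)) h
  exact this.mp (.refl _)

theorem mk_inr_eq {a b : {q // IsBlowUpPoint c q ∧ ¬ IsSingularPoint c q}}
    (h : Proportional a.1 b.1) : mk (r := r) (.inr a) = mk (.inr b) :=
  Quot.sound (h.scaled a.2.1 b.2.1)

theorem inr_eq_inr {p q : Aff BVar} {hp hp' hq hq'} :
    inr (r := r) (c := c) p hp hp' = inr q hq hq' ↔ Proportional p q :=
  ⟨fun h => proportional_of_mk_eq h, fun h => mk_inr_eq h⟩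

theorem inl_eq_inr {p : Aff AVar} {q : Aff BVar} {hp hq hq'} :
    inl (r := r) (c := c) p hp = inr q hq hq' ↔ Proportional (toBlowUp p) q := by
  refine ⟨fun h => proportional_of_mk_eq h, fun h => Quot.sound ?_⟩
  obtain ⟨a, d, e, h⟩ := h.scaled hp.isBlowUpPoint hq
  exact ⟨a, d, e, by simpa [toBlowUp, bvec] using h⟩

theorem inl_eq_inr_toBlowUp {p : Aff AVar} {hp : IsResolutionPoint r c p}
    (h : ¬ IsSingularPoint c (toBlowUp p)) : inl p hp = inr (toBlowUp p) hp.isBlowUpPoint h :=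
  inl_eq_inr.2 (.refl _)

/-- The gluing might identify two points of the small resolution through a chain passing the other
piece. It does not: the predicate `S`, being the point p, is invariant under each generating
relation. The crucial case is the gluing of the two pieces, which happens over non-singular points
only, where `IsResolutionPoint.minors` recovers α and σ from x, y, w. -/
theorem inl_eq_inl {p q : Aff AVar} {hp hq} :
    inl (r := r) (c := c) p hp = inl q hq ↔ q .x = p .x ∧ q .y = p .y ∧ q .w = p .w ∧
      p .αp * q .σp = p .σp * q .αp ∧ p .αm * q .σm = p .σm * q .αm := by
  constructor
  · intro h
    let S : FibreCover r c → Prop := fun e => match e with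
      | .inl q => q.1 .x = p .x ∧ q.1 .y = p .y ∧ q.1 .w = p .w ∧
          p .αp * q.1 .σp = p .σp * q.1 .αp ∧ p .αm * q.1 .σm = p .σm * q.1 .αm
      | .inr q => Proportional (toBlowUp p) q.1
    have key : ∀ a b, FibreRel r c a b → S a = S b := by
      intro a b hab
      apply propext
      rcases a with a | a <;> rcases b with b | b
      · obtain ⟨l, m, h1, h2, h3, h4, h5, h6, h7⟩ := hab
        have key : ∀ (l : ℂˣ) (x y x' y' : ℂ), x * (l * y') = y * (l * x') ↔ x * y' = y * x' := by
          intro l x y x' y'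
          rw [mul_left_comm, mul_left_comm y, mul_right_inj' l.ne_zero]
        simp only [S, h1, h2, h3, h4, h5, h6, h7, key]
      · have hsc := hab.scaled
        change _ ↔ Proportional (toBlowUp p) b.1
        refine Iff.trans ?_ (hsc.proportional_iff (toBlowUp p))
        change _ ↔ Proportional (toBlowUp p) (toBlowUp a.1)
        constructor
        · rintro ⟨h1, h2, h3, -⟩
          have : toBlowUp a.1 = toBlowUp p := by
            simp only [toBlowUp, h1, h2, h3]; rfl
          rw [this]; exact .refl _
        · rintro ⟨-, ⟨-, h1, -⟩, h2, h3, -⟩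
          simp only [toBlowUp, bvec, mul_one, one_mul] at h1 h2 h3
          refine ⟨h1.symm, h2, h3, hp.minors a.2 h1.symm h2 h3 fun hs => b.2.2 ?_⟩
          have : toBlowUp a.1 = toBlowUp p := by
            simp only [toBlowUp, h1, h2, h3]; rfl
          rw [← this] at hs
          exact hsc.isSingularPoint_iff.1 hs
      · exact hab.elim
      · exact Scaled.proportional_iff (FibreRel.scaled hab) _
    have := congrArg (Quot.lift S key) h
    exact this.mp ⟨rfl, rfl, rfl, mul_comm _ _, mul_comm _ _⟩
  · rintro ⟨h1, h2, h3, h4, h5⟩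
    obtain ⟨a, ha⟩ := exists_unit_mul_eq_pair hp.1 hq.1 h4
    obtain ⟨d, hd⟩ := exists_unit_mul_eq_pair hp.2.1 hq.2.1 h5
    exact Quot.sound ⟨a, d, h1, h2, h3, ha.1, ha.2, hd⟩

theorem isClosed_of {S : Set (Fibre r c)} {A : Set (Aff AVar)} {B : Set (Aff BVar)}
    (hA : IsClosed A) (hB : IsClosed B) (hSA : ∀ p hp, inl p hp ∈ S ↔ p ∈ A)
    (hSB : ∀ q hq hq', inr q hq hq' ∈ S ↔ q ∈ B) : IsClosed S := by
  refine Quot.isClosed_iff.2 (isClosed_sum_iff.2 ⟨?_, ?_⟩)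
  · have := hA.preimage (continuous_subtype_val (p := IsResolutionPoint r c))
    exact (congrArg IsClosed (Set.ext fun (p : {p // IsResolutionPoint r c p}) => (hSA p.1 p.2).symm)).mp this
  · have := hB.preimage
      (continuous_subtype_val (p := fun p => IsBlowUpPoint c p ∧ ¬ IsSingularPoint c p))
    exact (congrArg IsClosed (Set.ext fun
      (p : {p // IsBlowUpPoint c p ∧ ¬ IsSingularPoint c p}) => (hSB p.1 p.2.1 p.2.2).symm)).mp this

instance : HasRegularAlgebra (FibreCover r c) := Sum.hasRegularAlgebra

instance : HasRegularAlgebra (Fibre r c) := Quot.hasRegularAlgebra _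

theorem isClosed_proportional {ι : Type} {f : Aff ι → Aff BVar}
    (hf : ∀ a, IsPolynomialFun fun p => f p a) (q : Aff BVar) :
    IsClosed {p | Proportional (f p) q} := by
  have key : ∀ a b, IsClosed {p | f p a * q b = f p b * q a} := fun a b =>
    ((hf a).mul (.const (q b))).isClosed_eq ((hf b).mul (.const (q a)))
  exact ((key _ _).inter ((key _ _).inter (key _ _))).inter
    (((key _ _).inter ((key _ _).inter (key _ _))).inter
      ((key _ _).inter ((key _ _).inter (key _ _))))

/-- A point is cut out by polynomial equations on both pieces. An exceptional point needs the
equations in α and σ and does not occur on the second piece; every other point can be represented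
there. -/
instance : T1Space (Fibre r c) where
  t1 x := by
    have h1 : ∀ q hq hq', IsClosed {inr (r := r) (c := c) q hq hq'} := fun q hq hq' =>
      isClosed_of (isClosed_proportional isPolynomialFun_toBlowUp q)
        (isClosed_proportional IsPolynomialFun.coord q) (fun _ _ => inl_eq_inr)
        (fun _ _ _ => inr_eq_inr)
    induction x using cases with
    | h p hp =>
      by_cases hs : IsSingularPoint c (toBlowUp p)
      · have hA : IsClosed {q : Aff AVar | p .x = q .x ∧ p .y = q .y ∧ p .w = q .w ∧
            q .αp * p .σp = q .σp * p .αp ∧ q .αm * p .σm = q .σm * p .αm} := by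
          have key : ∀ a b, IsClosed {q : Aff AVar | q a * p b = q b * p a} := fun a b =>
            ((IsPolynomialFun.coord _).mul (.const (p b))).isClosed_eq
              ((IsPolynomialFun.coord _).mul (.const (p a)))
          have key' : ∀ a, IsClosed {q : Aff AVar | p a = q a} := fun a =>
            (IsPolynomialFun.const _).isClosed_eq (.coord _)
          exact (key' _).inter ((key' _).inter ((key' _).inter ((key _ _).inter (key _ _))))
        refine isClosed_of hA isClosed_empty (fun q hq => inl_eq_inl) fun q hq hq' => ?_
        refine iff_of_false (fun h => hq' ?_) id
        have h : inr q hq hq' = inl p hp := h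
        have : IsExceptional (inr (r := r) q hq hq') := by rw [h]; exact hs
        exact this
      · rw [inl_eq_inr_toBlowUp hs]; exact h1 _ _ _
    | h' q hq hq' => exact h1 _ _ _

/-! ### Functions on the fibre -/

/-- A pair of coordinates on the blown-up model whose quotient is a function. -/
def IsPair (a b : BVar) : Prop := ∀ p q : Aff BVar, Scaled p q → p a / p b = q a / q b

theorem isPair_u1_u3 : IsPair .u1 .u3 := by
  rintro p q ⟨a, d, e, h1, h2, h3, h4, h5, h6, -⟩
  rw [h4, h6, mul_div_mul_left _ _ d.ne_zero]

theorem isPair_u3_u1 : IsPair .u3 .u1 := by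
  rintro p q ⟨a, d, e, h1, h2, h3, h4, h5, h6, -⟩
  rw [h4, h6, mul_div_mul_left _ _ d.ne_zero]

theorem isPair_v3_v1 : IsPair .v3 .v1 := by
  rintro p q ⟨a, d, e, h1, h2, h3, h4, h5, h6, h7, h8, h9⟩
  rw [h7, h9, mul_div_mul_left _ _ e.ne_zero]

theorem isPair_v1_v3 : IsPair .v1 .v3 := by
  rintro p q ⟨a, d, e, h1, h2, h3, h4, h5, h6, h7, h8, h9⟩
  rw [h7, h9, mul_div_mul_left _ _ e.ne_zero]

theorem isPair_v2_v1 : IsPair .v2 .v1 := by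
  rintro p q ⟨a, d, e, h1, h2, h3, h4, h5, h6, h7, h8, h9⟩
  rw [h7, h8, mul_div_mul_left _ _ e.ne_zero]

theorem isPair_v1_v2 : IsPair .v1 .v2 := by
  rintro p q ⟨a, d, e, h1, h2, h3, h4, h5, h6, h7, h8, h9⟩
  rw [h7, h8, mul_div_mul_left _ _ e.ne_zero]

/-- The quotient of two coordinates on the blown-up model, as a function on the fibre. -/
noncomputable def ratio {a b : BVar} (h : IsPair a b) : Fibre r c → ℂ :=
  Quot.lift (fun e => e.toBlowUp a / e.toBlowUp b) fun _ _ hab => h _ _ hab.scaled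

theorem ratio_inl {a b : BVar} (h : IsPair a b) (p hp) :
    ratio h (inl (r := r) (c := c) p hp) = toBlowUp p a / toBlowUp p b := rfl

theorem ratio_inr {a b : BVar} (h : IsPair a b) (q hq hq') :
    ratio h (inr (r := r) (c := c) q hq hq') = q a / q b := rfl

theorem isRegularAt_ratio {a b : BVar} (h : IsPair a b) {x : Fibre r c}
    (h1 : ∀ p hp, inl p hp = x → toBlowUp p b ≠ 0) (h2 : ∀ q hq hq', inr q hq hq' = x → q b ≠ 0) :
    IsRegularAt (ratio h) x := by
  rintro (p | q) rfl
  · exact Subtype.isRegularAt_comp_val <| isRegularAt_div ((isPolynomialFun_toBlowUp a).isRegularAt _)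
      ((isPolynomialFun_toBlowUp b).isRegularAt _) (h1 p.1 p.2 rfl)
  · exact Subtype.isRegularAt_comp_val <| isRegularAt_div (Aff.isRegularAt_coord a _)
      (Aff.isRegularAt_coord b _) (h2 q.1 q.2.1 q.2.2 rfl)

/-- A pair of coordinates on the small resolution whose quotient is a function. -/
def IsAPair (a b : AVar) : Prop :=
  (a = .αp ∧ b = .σp) ∨ (a = .σp ∧ b = .αp) ∨ (a = .αm ∧ b = .σm) ∨ (a = .σm ∧ b = .αm)

/-- The quotient of two coordinates on the small resolution, as a function on the fibre (extended by
zero). -/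
noncomputable def aratio (a b : AVar) (x : Fibre r c) : ℂ := open Classical in
  if h : ∃ p : {p // IsResolutionPoint r c p}, inl p.1 p.2 = x then
    h.choose.1 a / h.choose.1 b else 0

theorem aratio_inl {a b : AVar} (hab : IsAPair a b) (p hp) :
    aratio a b (inl (r := r) (c := c) p hp) = p a / p b := by
  have h : ∃ q : {q // IsResolutionPoint r c q}, inl q.1 q.2 = inl p hp := ⟨⟨p, hp⟩, rfl⟩
  rw [aratio, dif_pos h]
  have h' := inl_eq_inl.1 h.choose_spec
  generalize h.choose = q at h'
  obtain ⟨l, hl⟩ := exists_unit_mul_eq_pair q.2.1 hp.1 h'.2.2.2.1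
  obtain ⟨m, hm⟩ := exists_unit_mul_eq_pair q.2.2.1 hp.2.1 h'.2.2.2.2
  rcases hab with ⟨rfl, rfl⟩ | ⟨rfl, rfl⟩ | ⟨rfl, rfl⟩ | ⟨rfl, rfl⟩
  · rw [hl.1, hl.2, mul_div_mul_left _ _ l.ne_zero]
  · rw [hl.1, hl.2, mul_div_mul_left _ _ l.ne_zero]
  · rw [hm.1, hm.2, mul_div_mul_left _ _ m.ne_zero]
  · rw [hm.1, hm.2, mul_div_mul_left _ _ m.ne_zero]

/-- The arbitrary values of `aratio` off the small resolution do no harm: all representatives of an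
exceptional point lie on the small resolution, where the function is an honest quotient of
coordinates. -/
theorem isRegularAt_aratio {a b : AVar} (hab : IsAPair a b) {x : Fibre r c} (hx : IsExceptional x)
    (h1 : ∀ p hp, inl p hp = x → p b ≠ 0) : IsRegularAt (aratio a b) x := by
  rintro (p | q) rfl
  · change IsRegularAt (fun p : {p // IsResolutionPoint r c p} => aratio a b (inl p.1 p.2)) p
    simp only [aratio_inl hab]
    exact Subtype.isRegularAt_comp_val <| isRegularAt_div (Aff.isRegularAt_coord a _)
      (Aff.isRegularAt_coord b _) (h1 p.1 p.2 rfl)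
  · exact (q.2.2 hx).elim

/-! ### Curves on the fibre -/

theorem isCurveAt_inl {p : ℂ → Aff AVar} (P : AVar → Polynomial ℂ)
    (hP : ∀ s a, p s a = (P a).eval s) (h : ∀ s, IsResolutionPoint r c (p s)) (t : ℂ) :
    IsCurveAt (fun s => inl (p s) (h s)) t :=
  Quot.isCurveAt _ <| Sum.isCurveAt_inl <| Subtype.isCurveAt <|
    (Aff.isCurveAt P t).congr (.of_forall fun s => funext (hP s))

theorem isCurveAt_inr {γ : ℂ → Fibre r c} {t : ℂ} {p : ℂ → Aff BVar} (P : BVar → Polynomial ℂ)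
    (hP : ∀ s a, p s a = (P a).eval s)
    (h : ∀ᶠ s in cofiniteAt t, ∃ h h', γ s = inr (p s) h h') : IsCurveAt γ t := by
  classical
  let S : Aff BVar → Prop := fun q => IsBlowUpPoint c q ∧ ¬ IsSingularPoint c q
  have ht : S (p t) := by
    obtain ⟨h1, h2, -⟩ := (eventually_cofiniteAt.1 h).2
    exact ⟨h1, h2⟩
  -- The coordinates need to describe a point of the piece only for parameters near t; elsewhere the
  -- constant value at t is used.
  let δ : ℂ → Subtype S := fun s => if hs : S (p s) then ⟨_, hs⟩ else ⟨_, ht⟩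
  have hδ : IsCurveAt δ t := Subtype.isCurveAt <| (Aff.isCurveAt P t).congr <| by
    filter_upwards [h] with s ⟨h1, h2, _⟩
    have hs : S (p s) := ⟨h1, h2⟩
    simp only [δ, dif_pos hs]
    exact funext (hP s)
  refine (Quot.isCurveAt (FibreRel r c) (Sum.isCurveAt_inr hδ)).congr ?_
  filter_upwards [h] with s ⟨h1, h2, h3⟩
  have hs : S (p s) := ⟨h1, h2⟩
  simp only [δ, dif_pos hs]
  exact h3

/-! ### The strict transform of the curve `x = y = z = 0` over `w = 0` -/

/-- Coordinates on the component `C₀`. -/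
def c0vec (c : Coeffs) (a b : ℂ) : Aff BVar :=
  bvec ((b ^ 2 + c.β5 * a * b) * a) ((b ^ 2 + c.β5 * a * b) * b) (a ^ 3) a b 0 a b 0

theorem c0vec_isBlowUpPoint (hw : c.w = 0) {a b : ℂ} (h : a ≠ 0 ∨ b ≠ 0) :
    IsBlowUpPoint c (c0vec c a b) := by
  simp only [IsBlowUpPoint, c0vec, bvec, hw]
  refine ⟨?_, by tauto, by tauto, ?_⟩
  · by_cases ha : a = 0
    · subst ha
      have hb : b ≠ 0 := by tauto
      simp [hb]
    · simp [ha]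
  · refine ⟨?_, ?_, ?_, ?_, ?_, ?_, ?_⟩ <;> ring

theorem c0vec_not_singular {a b : ℂ} : ¬ IsSingularPoint c (c0vec c a b) := fun h => h.1 rfl

/-- The component `C₀`. -/
noncomputable def line0 (r : Resolution) (hw : c.w = 0) : Line (Fibre r c) where
  γ t := inr (c0vec c 1 t) (c0vec_isBlowUpPoint hw (.inl one_ne_zero)) c0vec_not_singular
  o := inr (c0vec c 0 1) (c0vec_isBlowUpPoint hw (.inr one_ne_zero)) c0vec_not_singular
  τ := ratio isPair_v2_v1
  τ' := ratio isPair_v1_v2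
  γ_ne t h := by
    rw [inr_eq_inr] at h
    simp [Proportional, c0vec, bvec] at h
  curve t := isCurveAt_inr (bvec (.X ^ 2 + .C c.β5 * .X) ((.X ^ 2 + .C c.β5 * .X) * .X) 1 1 .X 0 1 .X 0)
    (p := fun s => c0vec c 1 s) (by intro s a; cases a <;> simp [c0vec, bvec])
    (.of_forall fun s => ⟨_, _, rfl⟩)
  curve' := by
    refine isCurveAt_inr (bvec ((1 + .C c.β5 * .X) * .X) (1 + .C c.β5 * .X) (.X ^ 3) .X 1 0 .X 1 0)
      (p := fun s => c0vec c s 1) (by intro s a; cases a <;> simp [c0vec, bvec])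
      (.of_forall fun s => ⟨c0vec_isBlowUpPoint hw (.inr one_ne_zero), c0vec_not_singular, ?_⟩)
    split_ifs with h
    · rw [inr_eq_inr, h]; exact .refl _
    · rw [inr_eq_inr]
      simp only [Proportional, c0vec, bvec]
      refine ⟨⟨?_, ?_, ?_⟩, ⟨?_, ?_, ?_⟩, ?_, ?_, ?_⟩ <;> field_simp <;> ring
  τ_regular t := by
    refine isRegularAt_ratio _ (fun p _ _ => one_ne_zero) fun q hq _ h => ?_
    rw [inr_eq_inr] at h
    have := hq.2.2.1
    simp only [Proportional, c0vec, bvec] at h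
    grind
  τ'_regular := by
    refine isRegularAt_ratio _ (fun p _ h => ?_) fun q hq _ h => ?_
    · rw [inl_eq_inr] at h
      simp [Proportional, c0vec, bvec, toBlowUp] at h
    · rw [inr_eq_inr] at h
      have := hq.2.2.1
      simp only [Proportional, c0vec, bvec] at h
      grind
  τ_γ t := by rw [ratio_inr]; simp [c0vec, bvec]
  τ'_γ t := by rw [ratio_inr]; simp [c0vec, bvec]
  τ'_o := by rw [ratio_inr]; simp [c0vec, bvec]

theorem inl_notMem_line0 (hw : c.w = 0) (p hp) : inl p hp ∉ (line0 r hw).set := by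
  rintro (h | ⟨t, h⟩)
  · have h : Proportional (toBlowUp p) (c0vec c 0 1) := proportional_of_mk_eq h
    simp [Proportional, c0vec, bvec, toBlowUp] at h
  · have h : Proportional (toBlowUp p) (c0vec c 1 t) := proportional_of_mk_eq h.symm
    simp [Proportional, c0vec, bvec, toBlowUp] at h

theorem inr_mem_line0 (hw : c.w = 0) (q hq hq') : inr q hq hq' ∈ (line0 r hw).set ↔ q .u3 = 0 := by
  constructor
  · rintro (h | ⟨t, h⟩)
    · have h : Proportional q (c0vec c 0 1) := proportional_of_mk_eq h
      simp only [Proportional, c0vec, bvec] at h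
      grind
    · have h : Proportional (c0vec c 1 t) q := proportional_of_mk_eq h
      simp only [Proportional, c0vec, bvec] at h
      grind
  · intro h
    obtain ⟨h1, h2, h3, h4, h5, h6, h7, h8, h9, h10⟩ := hq
    rw [hw] at h5 h6 h8 h9 h10
    have hv3 : q .v3 = 0 := by grind
    rw [hv3] at h10 h3
    by_cases hv : q .v1 = 0
    · refine .inl (mk_inr_eq ?_)
      simp only [Proportional, c0vec, bvec]
      grind
    · refine .inr ⟨q .v2 / q .v1, mk_inr_eq ?_⟩
      change Proportional (c0vec c 1 (q .v2 / q .v1)) q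
      obtain ⟨t, ht⟩ : ∃ t, q .v2 = t * q .v1 := ⟨q .v2 / q .v1, by field_simp⟩
      have hu : q .u2 = t * q .u1 := by
        apply mul_right_cancel₀ hv; rw [← h7, ht]; ring
      have hu1 : q .u1 ≠ 0 := by grind
      have hy : q .y = t * q .x := by
        apply mul_right_cancel₀ hu1; rw [← h4, hu]; ring
      have hx : q .x = q .z * (t ^ 2 + c.β5 * t) := by
        apply mul_right_cancel₀ (pow_ne_zero 2 hv)
        rw [ht] at h10; linear_combination -h10
      rw [ht, mul_div_cancel_right₀ _ hv]
      simp only [Proportional, c0vec, bvec, h, hv3, ht, hu, hy, hx]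
      refine ⟨⟨?_, ?_, ?_⟩, ⟨?_, ?_, ?_⟩, ?_, ?_, ?_⟩ <;> ring

/-! ### The strict transform of the exceptional divisor of the first blow-up -/

/-- Coordinates on the component `C₁`, if `β₅ = 0`. -/
def c1vec (r : Resolution) (t : ℂ) : Aff AVar :=
  -- On C₁ one has y = s = w = 0, while x and t are generically nonzero. If u_i = w this forces α₋ =
  -- σ₊ = 0, if u_j = w it forces α₊ = σ₋ = 0, and if u_k = w it forces α₊ = α₋ = 0.
  match r with
  | .wx | .wt => avec t 0 0 1 0 0 1
  | .xt | .tx => avec t 0 0 0 1 0 1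
  | .tw | .xw => avec t 0 0 0 1 1 0

theorem c1vec_isResolutionPoint (hw : c.w = 0) (h5 : c.β5 = 0) (t : ℂ) :
    IsResolutionPoint r c (c1vec r t) := by
  cases r <;> simp [IsResolutionPoint, c1vec, avec, hw, h5, Resolution.perm, fs]

/-- Coordinates on the component `C₁`, at infinity. -/
def c1vec' (s : ℂ) : Aff BVar := bvec 0 0 1 1 0 s 1 0 0

theorem c1vec'_isBlowUpPoint (hw : c.w = 0) (s : ℂ) : IsBlowUpPoint c (c1vec' s) := by
  simp [IsBlowUpPoint, c1vec', bvec, hw]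

/-- In this chart x = 1 / s and w = 0, so x t is proportional to 1 + β₄ s. -/
theorem c1vec'_not_singular {s : ℂ} (h : 1 + c.β4 * s ≠ 0) : ¬ IsSingularPoint c (c1vec' s) := by
  rintro ⟨h1, -, -, -, -, -, h2⟩
  simp only [c1vec', bvec, ft] at h1 h2
  apply h
  field_simp at h2
  grind

theorem proportional_c1vec {t : ℂ} {q : Aff BVar} : Proportional (toBlowUp (c1vec r t)) q ↔
    Proportional (bvec 0 0 1 t 0 1 1 0 0) q := by
  have : toBlowUp (c1vec r t) = bvec 0 0 1 t 0 1 1 0 0 := by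
    cases r <;> simp [toBlowUp, c1vec, avec] <;> rfl
  rw [this]

/-- The component `C₁`, if `β₅ = 0`. -/
noncomputable def line1 (r : Resolution) (hw : c.w = 0) (h5 : c.β5 = 0) : Line (Fibre r c) where
  γ t := inl (c1vec r t) (c1vec_isResolutionPoint hw h5 t)
  o := inr (c1vec' 0) (c1vec'_isBlowUpPoint hw 0) (c1vec'_not_singular (by simp))
  τ := ratio isPair_u1_u3
  τ' := ratio isPair_u3_u1
  γ_ne t h := by
    rw [inl_eq_inr, proportional_c1vec] at h
    simp [Proportional, c1vec', bvec] at h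
  curve t := isCurveAt_inl (match r with
    | .wx | .wt => avec .X 0 0 1 0 0 1
    | .xt | .tx => avec .X 0 0 0 1 0 1
    | .tw | .xw => avec .X 0 0 0 1 1 0) (by intro s a; cases r <;> cases a <;> simp [c1vec, avec]) _ _
  curve' := by
    refine isCurveAt_inr (bvec 0 0 1 1 0 .X 1 0 0) (p := c1vec')
      (by intro s a; cases a <;> simp [c1vec', bvec]) ?_
    filter_upwards [eventually_eval_ne_zero (Q := 1 + .C c.β4 * .X) (t := 0) (by simp)] with s hs
    refine ⟨c1vec'_isBlowUpPoint hw s, c1vec'_not_singular (by simpa using hs), ?_⟩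
    split_ifs with h
    · rw [inr_eq_inr, h]; exact .refl _
    · rw [inl_eq_inr, proportional_c1vec]
      simp [Proportional, c1vec', bvec, h]
  τ_regular t := by
    refine isRegularAt_ratio _ (fun p _ _ => one_ne_zero) fun q hq _ h => ?_
    have h := inl_eq_inr.1 h.symm
    rw [proportional_c1vec] at h
    have := hq.2.1
    simp only [Proportional, bvec] at h
    grind
  τ'_regular := by
    refine isRegularAt_ratio _ (fun p _ h => ?_) fun q hq _ h => ?_
    · rw [inl_eq_inr] at h
      simp [Proportional, c1vec', bvec, toBlowUp] at h
    · rw [inr_eq_inr] at h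
      have := hq.2.1
      simp only [Proportional, c1vec', bvec] at h
      grind
  τ_γ t := by rw [ratio_inl]; cases r <;> simp [c1vec, avec, toBlowUp, bvec]
  τ'_γ t := by rw [ratio_inl]; cases r <;> simp [c1vec, avec, toBlowUp, bvec]
  τ'_o := by rw [ratio_inr]; simp [c1vec', bvec]

theorem inl_mem_line1 (hw : c.w = 0) (h5 : c.β5 = 0) (p hp) :
    inl p hp ∈ (line1 r hw h5).set ↔ p .y = 0 ∧ p .w = 0 ∧
      c1vec r 0 .αp * p .σp = c1vec r 0 .σp * p .αp ∧
      c1vec r 0 .αm * p .σm = c1vec r 0 .σm * p .αm := by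
  have key : ∀ t, inl (c1vec r t) (c1vec_isResolutionPoint hw h5 t) = inl p hp ↔
      p .x = t ∧ p .y = 0 ∧ p .w = 0 ∧ c1vec r 0 .αp * p .σp = c1vec r 0 .σp * p .αp ∧
      c1vec r 0 .αm * p .σm = c1vec r 0 .σm * p .αm := fun t => by
    rw [inl_eq_inl]; cases r <;> rfl
  constructor
  · rintro (h | ⟨t, h⟩)
    · have h : Proportional (toBlowUp p) (c1vec' 0) := proportional_of_mk_eq h
      simp [Proportional, c1vec', bvec, toBlowUp] at h
    · exact ((key t).1 h).2
  · exact fun h => .inr ⟨p .x, (key _).2 ⟨rfl, h⟩⟩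

theorem inr_mem_line1 (hw : c.w = 0) (h5 : c.β5 = 0) (q hq hq') :
    inr q hq hq' ∈ (line1 r hw h5).set ↔ q .v2 = 0 ∧ q .v3 = 0 := by
  constructor
  · rintro (h | ⟨t, h⟩)
    · have h : Proportional q (c1vec' 0) := proportional_of_mk_eq h
      simp only [Proportional, c1vec', bvec] at h
      grind
    · have h : Proportional (toBlowUp (c1vec r t)) q := proportional_of_mk_eq h
      rw [proportional_c1vec] at h
      simp only [Proportional, bvec] at h
      grind
  · rintro ⟨h, h'⟩
    obtain ⟨h1, h2, h3, h4, h5', h6, h7, h8, h9, h10⟩ := hq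
    simp only [h, h', hw] at h1 h2 h3 h4 h5' h6 h7 h8 h9 h10
    have hv1 : q .v1 ≠ 0 := by tauto
    have hu2 : q .u2 = 0 := by simpa [hv1] using h7
    by_cases hu : q .u3 = 0
    · refine .inl (mk_inr_eq ?_)
      simp only [Proportional, c1vec', bvec]
      grind
    · refine .inr ⟨q .u1 / q .u3, inl_eq_inr.2 (proportional_c1vec.2 ?_)⟩
      have hx : q .x = 0 := by simpa [hu] using h5'
      have hy : q .y = 0 := by simpa [hu] using h6
      simp [Proportional, bvec, h, h', hu2, hx, hy, hu]

/-- Coordinates on the components `C₁` (there are two of them if `β₅ ≠ 0`). -/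
def c1vecB (c : Coeffs) (κ a b : ℂ) : Aff BVar := bvec 0 0 1 b (-κ * c.β5 * b) a 1 (-κ * c.β5) 0

theorem c1vecB_isBlowUpPoint (hw : c.w = 0) {κ : ℂ} (hκ : κ * (κ - 1) = 0) {a b : ℂ}
    (h : a ≠ 0 ∨ b ≠ 0) : IsBlowUpPoint c (c1vecB c κ a b) := by
  simp only [IsBlowUpPoint, c1vecB, bvec, hw]
  refine ⟨by simp, by tauto, by simp, ?_, ?_, ?_, ?_, ?_, ?_, ?_⟩
  all_goals first | linear_combination c.β5 ^ 2 * hκ | ring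

/-- On w = 0 the functions y and s differ by β₅, so they cannot vanish together. -/
theorem c1vecB_not_singular (h5 : c.β5 ≠ 0) {κ a b : ℂ} :
    ¬ IsSingularPoint c (c1vecB c κ a b) := by
  rintro ⟨-, -, h1, h2, -⟩
  simp only [c1vecB, bvec, fs] at h1 h2
  grind

/-- The components `C₁` (`κ = 0, 1`), if `β₅ ≠ 0`. -/
noncomputable def line1B (r : Resolution) (hw : c.w = 0) (h5 : c.β5 ≠ 0) {κ : ℂ}
    (hκ : κ * (κ - 1) = 0) : Line (Fibre r c) where
  γ t := inr (c1vecB c κ 1 t) (c1vecB_isBlowUpPoint hw hκ (.inl one_ne_zero)) (c1vecB_not_singular h5)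
  o := inr (c1vecB c κ 0 1) (c1vecB_isBlowUpPoint hw hκ (.inr one_ne_zero)) (c1vecB_not_singular h5)
  τ := ratio isPair_u1_u3
  τ' := ratio isPair_u3_u1
  γ_ne t h := by
    rw [inr_eq_inr] at h
    simp [Proportional, c1vecB, bvec] at h
  curve t := isCurveAt_inr (bvec 0 0 1 .X (.C (-κ * c.β5) * .X) 1 1 (.C (-κ * c.β5)) 0)
    (p := fun s => c1vecB c κ 1 s) (by intro s a; cases a <;> simp [c1vecB, bvec])
    (.of_forall fun s => ⟨_, _, rfl⟩)
  curve' := by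
    refine isCurveAt_inr (bvec 0 0 1 1 (.C (-κ * c.β5)) .X 1 (.C (-κ * c.β5)) 0)
      (p := fun s => c1vecB c κ s 1) (by intro s a; cases a <;> simp [c1vecB, bvec])
      (.of_forall fun s => ⟨c1vecB_isBlowUpPoint hw hκ (.inr one_ne_zero), c1vecB_not_singular h5, ?_⟩)
    split_ifs with h
    · rw [inr_eq_inr, h]; exact .refl _
    · rw [inr_eq_inr]
      simp [Proportional, c1vecB, bvec, h]
      ring
  τ_regular t := by
    refine isRegularAt_ratio _ (fun p _ _ => one_ne_zero) fun q hq _ h => ?_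
    rw [inr_eq_inr] at h
    have := hq.2.1
    simp only [Proportional, c1vecB, bvec] at h
    grind
  τ'_regular := by
    refine isRegularAt_ratio _ (fun p _ h => ?_) fun q hq _ h => ?_
    · rw [inl_eq_inr] at h
      simp [Proportional, c1vecB, bvec, toBlowUp] at h
    · rw [inr_eq_inr] at h
      have := hq.2.1
      simp only [Proportional, c1vecB, bvec] at h
      grind
  τ_γ t := by rw [ratio_inr]; simp [c1vecB, bvec]
  τ'_γ t := by rw [ratio_inr]; simp [c1vecB, bvec]
  τ'_o := by rw [ratio_inr]; simp [c1vecB, bvec]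

theorem inr_mem_line1B (hw : c.w = 0) (h5 : c.β5 ≠ 0) {κ : ℂ} (hκ : κ * (κ - 1) = 0) (q hq hq') :
    inr q hq hq' ∈ (line1B r hw h5 hκ).set ↔ q .v2 = -κ * c.β5 * q .v1 ∧ q .v3 = 0 := by
  constructor
  · rintro (h | ⟨t, h⟩)
    · have h : Proportional q (c1vecB c κ 0 1) := proportional_of_mk_eq h
      simp only [Proportional, c1vecB, bvec] at h
      grind
    · have h : Proportional (c1vecB c κ 1 t) q := proportional_of_mk_eq h
      simp only [Proportional, c1vecB, bvec] at h
      grind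
  · rintro ⟨h, h'⟩
    obtain ⟨h1, h2, h3, h4, h5', h6, h7, h8, h9, h10⟩ := hq
    simp only [h, h', hw] at h1 h2 h3 h4 h5' h6 h7 h8 h9 h10
    have hv1 : q .v1 ≠ 0 := by grind
    have hu2 : q .u2 = -κ * c.β5 * q .u1 := by
      apply mul_right_cancel₀ hv1; rw [← h7]; ring
    have hx : q .x = 0 := by
      apply mul_right_cancel₀ (pow_ne_zero 2 hv1)
      linear_combination -h10 + q .z * q .v1 ^ 2 * c.β5 ^ 2 * hκ
    by_cases hu : q .u3 = 0
    · have hu1 : q .u1 ≠ 0 := by grind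
      have hy : q .y = 0 := by
        apply mul_right_cancel₀ hu1; rw [← h4, hx]; ring
      refine .inl (mk_inr_eq ?_)
      simp only [Proportional, c1vecB, bvec]
      grind
    · refine .inr ⟨q .u1 / q .u3, mk_inr_eq ?_⟩
      change Proportional (c1vecB c κ 1 (q .u1 / q .u3)) q
      have hy : q .y = 0 := by simpa [hu] using h6
      simp only [Proportional, c1vecB, bvec, h, h', hu2, hx, hy]
      refine ⟨⟨?_, ?_, ?_⟩, ⟨?_, ?_, ?_⟩, ?_, ?_, ?_⟩
      all_goals first | trivial | ring1 | field_simp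

theorem inl_mem_line1B (hw : c.w = 0) (h5 : c.β5 ≠ 0) {κ : ℂ} (hκ : κ * (κ - 1) = 0) (p hp) :
    inl p hp ∈ (line1B r hw h5 hκ).set ↔ p .y = -κ * c.β5 ∧ p .w = 0 := by
  by_cases hs : IsSingularPoint c (toBlowUp p)
  · refine iff_of_false ?_ ?_
    · rintro (h | ⟨t, h⟩)
      · have : IsExceptional (line1B r hw h5 hκ).o := h ▸ isExceptional_inl (h := hp).2 hs
        exact c1vecB_not_singular h5 this
      · have : IsExceptional ((line1B r hw h5 hκ).γ t) := h ▸ isExceptional_inl (h := hp).2 hs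
        exact c1vecB_not_singular h5 this
    · rw [isSingularPoint_toBlowUp] at hs
      rintro ⟨h1, h2⟩
      simp only [fs] at hs
      grind
  · rw [inl_eq_inr_toBlowUp hs, inr_mem_line1B]
    simp [toBlowUp, bvec]

/-! ### The strict transform of the exceptional divisor of the second blow-up -/

/-- Coordinates on a component of the fibre contained in the exceptional divisor `x = 0`, on which
`y = - κ (β₅ + β₃ w)`, as functions of `w`. -/
structure Branch (r : Resolution) (c : Coeffs) (κ : ℂ) where
  αp : Polynomial ℂ
  σp : Polynomial ℂ
  αm : Polynomial ℂ
  σm : Polynomial ℂ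
  hw : c.w = 0
  hκ : κ * (κ - 1) = 0
  hc : c.β3 ≠ 0 ∨ c.β0 ≠ 0
  isResolutionPoint (t : ℂ) : IsResolutionPoint r c
    (avec 0 (-κ * (c.β5 + c.β3 * t)) t (αp.eval t) (σp.eval t) (αm.eval t) (σm.eval t))

/-- Coordinates on the component, at infinity. -/
def c2vec' (c : Coeffs) (κ s : ℂ) : Aff BVar :=
  bvec 0 0 1 0 0 1 s (-κ * (c.β5 * s + c.β3)) 1

theorem c2vec'_isBlowUpPoint {κ : ℂ} (hw : c.w = 0) (hκ : κ * (κ - 1) = 0) (s : ℂ) :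
    IsBlowUpPoint c (c2vec' c κ s) := by
  simp only [IsBlowUpPoint, c2vec', bvec, hw]
  refine ⟨by simp, by simp, by simp, by simp, by simp, by simp, by simp, by simp, by simp, ?_⟩
  linear_combination (c.β5 * s + c.β3) ^ 2 * hκ

/-- Here w = 1 / s tends to infinity. If β₃ ≠ 0, then y and s differ by β₅ + β₃ w, which is nonzero
for large w; if β₀ ≠ 0, then w t is nonzero for large w. Either condition allows the curve to be
followed in the second piece up to its point at infinity. -/
theorem c2vec'_not_singular {κ : ℂ} (hc : c.β3 ≠ 0 ∨ c.β0 ≠ 0) :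
    ∀ᶠ s in cofiniteAt 0, ¬ IsSingularPoint c (c2vec' c κ s) := by
  rcases hc with hc | hc
  · filter_upwards [eventually_eval_ne_zero (Q := .C c.β5 * .X + .C c.β3) (t := 0) (by simpa)]
      with s hs
    rintro ⟨-, h1, h2, h3, -⟩
    simp only [c2vec', bvec, fs] at h1 h2 h3
    simp only [Polynomial.eval_add, Polynomial.eval_mul, Polynomial.eval_C, Polynomial.eval_X] at hs
    rw [h2] at h3
    field_simp at h3
    exact hs (by linear_combination h3)
  · filter_upwards [eventually_eval_ne_zero
      (Q := .C c.β4 * .X ^ 2 + .C c.β2 * .X + .C c.β0) (t := 0) (by simpa)] with s hs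
    rintro ⟨-, h1, h2, h3, -, h4, -⟩
    simp only [c2vec', bvec, ft] at h1 h4
    simp only [Polynomial.eval_add, Polynomial.eval_mul, Polynomial.eval_C, Polynomial.eval_X,
      Polynomial.eval_pow] at hs
    field_simp at h4
    exact hs (by linear_combination h4)

namespace Branch

variable {κ : ℂ} (b : Branch r c κ)

/-- Coordinates on the component. -/
noncomputable def vec (t : ℂ) : Aff AVar :=
  avec 0 (-κ * (c.β5 + c.β3 * t)) t (b.αp.eval t) (b.σp.eval t) (b.αm.eval t) (b.σm.eval t)

theorem toBlowUp_vec (t : ℂ) :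
    toBlowUp (b.vec t) = bvec 0 0 1 0 0 1 1 (-κ * (c.β5 + c.β3 * t)) t := by
  simp [toBlowUp, vec, avec]; rfl

theorem isResolutionPoint_vec (t : ℂ) : IsResolutionPoint r c (b.vec t) := b.isResolutionPoint t

/-- The component. -/
noncomputable def line : Line (Fibre r c) where
  γ t := inl (b.vec t) (b.isResolutionPoint_vec t)
  o := inr (c2vec' c κ 0) (c2vec'_isBlowUpPoint b.hw b.hκ 0)
    (eventually_cofiniteAt.1 (c2vec'_not_singular b.hc)).2
  τ := ratio isPair_v3_v1
  τ' := ratio isPair_v1_v3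
  γ_ne t h := by
    rw [inl_eq_inr, toBlowUp_vec] at h
    simp [Proportional, c2vec', bvec] at h
  curve t := isCurveAt_inl (avec 0 (.C (-κ) * (.C c.β5 + .C c.β3 * .X)) .X b.αp b.σp b.αm b.σm)
    (by intro s a; cases a <;> simp [vec, avec]) _ _
  curve' := by
    refine isCurveAt_inr (bvec 0 0 1 0 0 1 .X (.C (-κ) * (.C c.β5 * .X + .C c.β3)) 1)
      (p := c2vec' c κ) (by intro s a; cases a <;> simp [c2vec', bvec]) ?_
    filter_upwards [c2vec'_not_singular b.hc] with s hs
    refine ⟨c2vec'_isBlowUpPoint b.hw b.hκ s, hs, ?_⟩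
    split_ifs with h
    · rw [inr_eq_inr, h]; exact .refl _
    · rw [inl_eq_inr, toBlowUp_vec]
      simp only [Proportional, c2vec', bvec]
      refine ⟨⟨?_, ?_, ?_⟩, ⟨?_, ?_, ?_⟩, ?_, ?_, ?_⟩
      all_goals first | trivial | ring1 | field_simp
  τ_regular t := by
    refine isRegularAt_ratio _ (fun p _ _ => one_ne_zero) fun q hq _ h => ?_
    have h := inl_eq_inr.1 h.symm
    rw [toBlowUp_vec] at h
    have := hq.2.2.1
    simp only [Proportional, bvec] at h
    grind
  τ'_regular := by
    refine isRegularAt_ratio _ (fun p _ h => ?_) fun q hq _ h => ?_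
    · rw [inl_eq_inr] at h
      simp [Proportional, c2vec', bvec, toBlowUp] at h
    · rw [inr_eq_inr] at h
      have := hq.2.2.1
      simp only [Proportional, c2vec', bvec] at h
      grind
  τ_γ t := by rw [ratio_inl, toBlowUp_vec]; simp [bvec]
  τ'_γ t := by rw [ratio_inl, toBlowUp_vec]; simp [bvec]
  τ'_o := by rw [ratio_inr]; simp [c2vec', bvec]

theorem inl_mem_line (p hp) : inl p hp ∈ b.line.set ↔
    p .x = 0 ∧ p .y = -κ * (c.β5 + c.β3 * p .w) ∧
      b.αp.eval (p .w) * p .σp = b.σp.eval (p .w) * p .αp ∧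
      b.αm.eval (p .w) * p .σm = b.σm.eval (p .w) * p .αm := by
  constructor
  · rintro (h | ⟨t, h⟩)
    · have h : Proportional (toBlowUp p) (c2vec' c κ 0) := proportional_of_mk_eq h
      simp [Proportional, c2vec', bvec, toBlowUp] at h
    · obtain ⟨h1, h2, h3, h4, h5⟩ := inl_eq_inl.1 h
      simp only [vec, avec] at h1 h2 h3 h4 h5
      subst h3
      exact ⟨h1, h2, h4, h5⟩
  · rintro ⟨h1, h2, h3, h4⟩
    exact .inr ⟨p .w, inl_eq_inl.2 ⟨h1, h2, rfl, h3, h4⟩⟩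

theorem inr_mem_line (q hq hq') : inr q hq hq' ∈ b.line.set ↔
    q .u1 = 0 ∧ q .u2 = 0 ∧ q .v2 = -κ * (c.β5 * q .v1 + c.β3 * q .v3) := by
  constructor
  · rintro (h | ⟨t, h⟩)
    · have h : Proportional q (c2vec' c κ 0) := proportional_of_mk_eq h
      simp only [Proportional, c2vec', bvec] at h
      grind
    · have h : Proportional (toBlowUp (b.vec t)) q := proportional_of_mk_eq h
      rw [toBlowUp_vec] at h
      simp only [Proportional, bvec] at h
      grind
  · rintro ⟨h1, h2, h3⟩
    have hu3 : q .u3 ≠ 0 := by have := hq.2.1; tauto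
    have hx : q .x = 0 := by
      have := hq.2.2.2.2.1
      rw [b.hw, zero_mul, zero_mul] at this
      simpa [hu3] using this
    have hy : q .y = 0 := by
      have := hq.2.2.2.2.2.1
      rw [b.hw, zero_mul, zero_mul] at this
      simpa [hu3] using this
    by_cases hv : q .v1 = 0
    · refine .inl (mk_inr_eq ?_)
      change Proportional q (c2vec' c κ 0)
      rw [hv, mul_zero, zero_add] at h3
      simp only [Proportional, c2vec', bvec, h1, h2, h3, hx, hy, hv]
      refine ⟨⟨?_, ?_, ?_⟩, ⟨?_, ?_, ?_⟩, ?_, ?_, ?_⟩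
      all_goals first | trivial | ring1
    · refine .inr ⟨q .v3 / q .v1, inl_eq_inr.2 ?_⟩
      rw [toBlowUp_vec]
      simp only [Proportional, bvec, h1, h2, h3, hx, hy]
      refine ⟨⟨?_, ?_, ?_⟩, ⟨?_, ?_, ?_⟩, ?_, ?_, ?_⟩
      all_goals first | trivial | ring1 | field_simp

theorem isClosed : IsClosed b.line.set := by
  have hA : IsClosed {p : Aff AVar | p .x = 0 ∧ p .y = -κ * (c.β5 + c.β3 * p .w) ∧
      b.αp.eval (p .w) * p .σp = b.σp.eval (p .w) * p .αp ∧
      b.αm.eval (p .w) * p .σm = b.σm.eval (p .w) * p .αm} :=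
    ((IsPolynomialFun.coord _).isClosed_eq (.const 0)).inter <|
    ((IsPolynomialFun.coord _).isClosed_eq
      ((IsPolynomialFun.const _).mul ((IsPolynomialFun.const _).add
        ((IsPolynomialFun.const _).mul (.coord _))))).inter <|
    ((((IsPolynomialFun.coord _).eval _).mul (.coord _)).isClosed_eq
      (((IsPolynomialFun.coord _).eval _).mul (.coord _))).inter <|
    (((IsPolynomialFun.coord _).eval _).mul (.coord _)).isClosed_eq
      (((IsPolynomialFun.coord _).eval _).mul (.coord _))
  have hB : IsClosed {q : Aff BVar | q .u1 = 0 ∧ q .u2 = 0 ∧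
      q .v2 = -κ * (c.β5 * q .v1 + c.β3 * q .v3)} :=
    ((IsPolynomialFun.coord _).isClosed_eq (.const 0)).inter <|
    ((IsPolynomialFun.coord _).isClosed_eq (.const 0)).inter <|
    (IsPolynomialFun.coord _).isClosed_eq ((IsPolynomialFun.const _).mul
      (((IsPolynomialFun.const _).mul (.coord _)).add ((IsPolynomialFun.const _).mul (.coord _))))
  exact isClosed_of hA hB b.inl_mem_line b.inr_mem_line

end Branch

theorem isClosed_line0 (hw : c.w = 0) : IsClosed (line0 r hw).set :=
  isClosed_of isClosed_empty ((IsPolynomialFun.coord .u3).isClosed_eq (.const 0))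
    (fun p hp => iff_of_false (inl_notMem_line0 hw p hp) id) (inr_mem_line0 hw)

theorem isClosed_line1 (hw : c.w = 0) (h5 : c.β5 = 0) : IsClosed (line1 r hw h5).set := by
  have hA : IsClosed {p : Aff AVar | p .y = 0 ∧ p .w = 0 ∧
      c1vec r 0 .αp * p .σp = c1vec r 0 .σp * p .αp ∧
      c1vec r 0 .αm * p .σm = c1vec r 0 .σm * p .αm} :=
    ((IsPolynomialFun.coord _).isClosed_eq (.const 0)).inter <|
    ((IsPolynomialFun.coord _).isClosed_eq (.const 0)).inter <|
    (((IsPolynomialFun.const _).mul (.coord _)).isClosed_eq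
      ((IsPolynomialFun.const _).mul (.coord _))).inter <|
    ((IsPolynomialFun.const _).mul (.coord _)).isClosed_eq ((IsPolynomialFun.const _).mul (.coord _))
  have hB : IsClosed {q : Aff BVar | q .v2 = 0 ∧ q .v3 = 0} :=
    ((IsPolynomialFun.coord _).isClosed_eq (.const 0)).inter <|
    (IsPolynomialFun.coord _).isClosed_eq (.const 0)
  exact isClosed_of hA hB (inl_mem_line1 hw h5) (inr_mem_line1 hw h5)

theorem isClosed_line1B (hw : c.w = 0) (h5 : c.β5 ≠ 0) {κ : ℂ} (hκ : κ * (κ - 1) = 0) :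
    IsClosed (line1B r hw h5 hκ).set := by
  have hA : IsClosed {p : Aff AVar | p .y = -κ * c.β5 ∧ p .w = 0} :=
    ((IsPolynomialFun.coord _).isClosed_eq (.const _)).inter <|
    (IsPolynomialFun.coord _).isClosed_eq (.const 0)
  have hB : IsClosed {q : Aff BVar | q .v2 = -κ * c.β5 * q .v1 ∧ q .v3 = 0} :=
    ((IsPolynomialFun.coord _).isClosed_eq ((IsPolynomialFun.const _).mul (.coord _))).inter <|
    (IsPolynomialFun.coord _).isClosed_eq (.const 0)
  exact isClosed_of hA hB (inl_mem_line1B hw h5 hκ) (inr_mem_line1B hw h5 hκ)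

/-! ### The exceptional curves of the small resolution -/

theorem isResolutionPoint_iff {p : Aff AVar} : IsResolutionPoint r c p ↔
    (p .αp ≠ 0 ∨ p .σp ≠ 0) ∧ (p .αm ≠ 0 ∨ p .σm ≠ 0) ∧ p .x * p .w = c.w ∧
    (uvals r c (p .x) (p .w)).1 * p .αp = p .σp * p .y ∧
    (uvals r c (p .x) (p .w)).2.1 * p .αm = p .σm * fs c (p .y) (p .w) ∧
    p .αm * p .αp = p .σm * p .σp * (uvals r c (p .x) (p .w)).2.2 := Iff.rfl

theorem isSingularPoint_toBlowUp' {p : Aff AVar} : IsSingularPoint c (toBlowUp p) ↔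
    p .y = 0 ∧ fs c (p .y) (p .w) = 0 ∧
      ((uvals r c (p .x) (p .w)).1 * (uvals r c (p .x) (p .w)).2.1 = 0 ∧
      (uvals r c (p .x) (p .w)).1 * (uvals r c (p .x) (p .w)).2.2 = 0 ∧
      (uvals r c (p .x) (p .w)).2.1 * (uvals r c (p .x) (p .w)).2.2 = 0) := by
  rw [isSingularPoint_toBlowUp, uvals_pairs r]

/-- A line in the fibre that is contracted by the small resolution: `V s t` are coordinates of the
point where the homogeneous coordinates `a` and `b` have the values `s` and `t`, and `Q`
are the equations of the line. -/
structure ContractedLine (r : Resolution) (c : Coeffs) (a b : AVar) (Q : Aff AVar → Prop) where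
  V : ℂ → ℂ → Aff AVar
  P : AVar → Polynomial ℂ
  P' : AVar → Polynomial ℂ
  hab : IsAPair a b
  V_left s t : V s t a = s
  V_right s t : V s t b = t
  V_eq s u : V s 1 u = (P u).eval s
  V_eq' t u : V 1 t u = (P' u).eval t
  isResolutionPoint {s t : ℂ} : s ≠ 0 ∨ t ≠ 0 → IsResolutionPoint r c (V s t)
  isSingularPoint s t : IsSingularPoint c (toBlowUp (V s t))
  inl_eq_inl {s t : ℂ} {hp} {q : Aff AVar} {hq} : s ≠ 0 ∨ t ≠ 0 →
    (inl (r := r) (c := c) (V s t) hp = inl q hq ↔ Q q ∧ s * q b = t * q a)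

theorem IsAPair.symm {a b : AVar} (h : IsAPair a b) : IsAPair b a := by
  simp only [IsAPair] at h ⊢; tauto

theorem IsAPair.ne_zero {a b : AVar} (h : IsAPair a b) {p : Aff AVar} (hp : IsResolutionPoint r c p) :
    p a ≠ 0 ∨ p b ≠ 0 := by
  obtain ⟨h1, h2, -⟩ := hp
  rcases h with ⟨rfl, rfl⟩ | ⟨rfl, rfl⟩ | ⟨rfl, rfl⟩ | ⟨rfl, rfl⟩ <;> tauto

namespace ContractedLine

variable {a b : AVar} {Q : Aff AVar → Prop} (E : ContractedLine r c a b Q)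

theorem res₁ (s : ℂ) : IsResolutionPoint r c (E.V s 1) := E.isResolutionPoint (.inr one_ne_zero)

theorem res₂ (t : ℂ) : IsResolutionPoint r c (E.V 1 t) := E.isResolutionPoint (.inl one_ne_zero)

/-- The line. -/
noncomputable def line : Line (Fibre r c) where
  γ s := inl (E.V s 1) (E.res₁ s)
  o := inl (E.V 1 0) (E.res₂ 0)
  τ := aratio a b
  τ' := aratio b a
  γ_ne s h := by
    have := ((E.inl_eq_inl (.inr one_ne_zero)).1 h).2
    rw [E.V_left, E.V_right] at this
    simp at this
  curve s := isCurveAt_inl E.P E.V_eq _ _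
  curve' := by
    refine (isCurveAt_inl E.P' E.V_eq' E.res₂ 0).congr (.of_forall fun s => ?_)
    split_ifs with h
    · subst h; rfl
    · refine (E.inl_eq_inl (.inr one_ne_zero)).2 ⟨?_, ?_⟩
      · exact ((E.inl_eq_inl (.inl one_ne_zero)).1 (rfl : inl _ (E.res₂ s) = inl _ (E.res₂ s))).1
      · rw [E.V_left, E.V_right]; field_simp
  τ_regular s := by
    refine isRegularAt_aratio E.hab (isExceptional_inl.2 (E.isSingularPoint _ _)) fun p hp h h0 => ?_
    have := ((E.inl_eq_inl (.inr one_ne_zero)).1 h.symm).2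
    rw [h0, mul_zero, one_mul] at this
    exact (E.hab.ne_zero hp).elim (fun h => h this.symm) fun h => h h0
  τ'_regular := by
    refine isRegularAt_aratio E.hab.symm (isExceptional_inl.2 (E.isSingularPoint _ _))
      fun p hp h h0 => ?_
    have := ((E.inl_eq_inl (.inl one_ne_zero)).1 h.symm).2
    rw [h0, mul_zero, one_mul] at this
    exact (E.hab.ne_zero hp).elim (fun h => h h0) fun h => h this
  τ_γ s := by rw [aratio_inl E.hab, E.V_left, E.V_right, div_one]
  τ'_γ s := by rw [aratio_inl E.hab.symm, E.V_left, E.V_right, one_div]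
  τ'_o := by rw [aratio_inl E.hab.symm, E.V_left, E.V_right, zero_div]

theorem inl_mem_line (p hp) : inl p hp ∈ E.line.set ↔ Q p := by
  constructor
  · rintro (h | ⟨s, h⟩)
    · exact ((E.inl_eq_inl (.inl one_ne_zero)).1 h.symm).1
    · exact ((E.inl_eq_inl (.inr one_ne_zero)).1 h).1
  · intro h
    by_cases h0 : p b = 0
    · exact .inl ((E.inl_eq_inl (.inl one_ne_zero)).2 ⟨h, by simp [h0]⟩).symm
    · exact .inr ⟨p a / p b, (E.inl_eq_inl (.inr one_ne_zero)).2 ⟨h, by field_simp⟩⟩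

theorem inr_notMem_line (q hq hq') : inr q hq hq' ∉ E.line.set := by
  have key : ∀ x ∈ E.line.set, IsExceptional x := by
    rintro x (rfl | ⟨s, rfl⟩) <;> exact isExceptional_inl.2 (E.isSingularPoint _ _)
  exact fun h => not_isExceptional_inr (key _ h)

theorem isClosed (hQ : IsClosed {p | Q p}) : IsClosed E.line.set :=
  isClosed_of hQ isClosed_empty E.inl_mem_line fun q hq hq' => iff_of_false (E.inr_notMem_line q hq hq') id

end ContractedLine

/-- Coordinates on a contracted line on which `α₊ / σ₊` is not constant. -/
noncomputable def plusVec (r : Resolution) (c : Coeffs) (x₀ w₀ s t : ℂ) : Aff AVar :=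
  -- If u_k ≠ 0, the equation α₋α₊ = σ₋σ₊u_k forces [α₋ : σ₋] = [u_k σ₊ : α₊], so both ratios move
  -- along the line. If u_k = 0, the component α₋ = 0 is taken, with σ₋ = 1.
  avec x₀ 0 w₀ s t ((uvals r c x₀ w₀).2.2 * t) (if (uvals r c x₀ w₀).2.2 = 0 then 1 else s)

/-- Coordinates on a contracted line on which `α₊ / σ₊` is constant. -/
def minusVec (x₀ w₀ s t : ℂ) : Aff AVar := avec x₀ 0 w₀ 0 1 t s

/-- The line over the singular point `x = x₀`, `y = 0`, `w = w₀` with coordinate `α₊ / σ₊`. -/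
noncomputable def plusLine {x₀ w₀ : ℂ} (hw : c.w = 0) (hxw : x₀ * w₀ = 0) (hs : fs c 0 w₀ = 0)
    (hi : (uvals r c x₀ w₀).1 = 0) (hjk : (uvals r c x₀ w₀).2.1 * (uvals r c x₀ w₀).2.2 = 0) :
    ContractedLine r c .αp .σp fun q => q .x = x₀ ∧ q .y = 0 ∧ q .w = w₀ ∧
      ((uvals r c x₀ w₀).2.2 = 0 → q .αm = 0) where
  V := plusVec r c x₀ w₀
  P := avec (.C x₀) 0 (.C w₀) .X 1 (.C (uvals r c x₀ w₀).2.2)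
    (if (uvals r c x₀ w₀).2.2 = 0 then 1 else .X)
  P' := avec (.C x₀) 0 (.C w₀) 1 .X (.C (uvals r c x₀ w₀).2.2 * .X) 1
  hab := .inl ⟨rfl, rfl⟩
  V_left _ _ := rfl
  V_right _ _ := rfl
  V_eq s u := by
    cases u <;> simp [plusVec, avec]
    split_ifs <;> simp
  V_eq' s u := by
    cases u <;> simp [plusVec, avec]
  isResolutionPoint {s t} hst := by
    rw [isResolutionPoint_iff]
    simp only [plusVec, avec, hi, hs, hw, hxw]
    split_ifs with hk
    · simp [hk, hst]
    · have hj : (uvals r c x₀ w₀).2.1 = 0 := by simpa [hk] using hjk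
      refine ⟨hst, ?_, trivial, by simp, by simp [hj], by ring⟩
      simp only [ne_eq, mul_eq_zero, hk, false_or]
      exact hst.symm
  isSingularPoint s t := by
    rw [isSingularPoint_toBlowUp' (r := r)]
    exact ⟨rfl, hs, by simp [plusVec, avec, hi], by simp [plusVec, avec, hi], hjk⟩
  inl_eq_inl {s t hp q hq} hst := by
    rw [inl_eq_inl]
    simp only [plusVec, avec]
    constructor
    · rintro ⟨h1, h2, h3, h4, h5⟩
      refine ⟨⟨h1, h2, h3, fun hk => ?_⟩, h4⟩
      simpa [hk] using h5.symm
    · rintro ⟨⟨h1, h2, h3, h4⟩, h5⟩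
      refine ⟨h1, h2, h3, h5, ?_⟩
      split_ifs with hk
      · simp [hk, h4 hk]
      -- After rescaling (α₊, σ₊) by l, the third equation of the resolution at q is the required
      -- proportionality.
      · obtain ⟨l, hl, hl'⟩ := exists_unit_mul_eq_pair hst hq.1 h5
        have h6 := (isResolutionPoint_iff.1 hq).2.2.2.2.2
        rw [h1, h3, hl, hl'] at h6
        refine mul_left_cancel₀ l.ne_zero ?_
        linear_combination -h6

/-- The line over the singular point `x = x₀`, `y = 0`, `w = w₀` with coordinate `σ₋ / α₋`. -/
noncomputable def minusLine {x₀ w₀ : ℂ} (hw : c.w = 0) (hxw : x₀ * w₀ = 0) (hs : fs c 0 w₀ = 0)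
    (hj : (uvals r c x₀ w₀).2.1 = 0) (hk : (uvals r c x₀ w₀).2.2 = 0) :
    ContractedLine r c .σm .αm fun q => q .x = x₀ ∧ q .y = 0 ∧ q .w = w₀ ∧ q .αp = 0 where
  V := minusVec x₀ w₀
  P := avec (.C x₀) 0 (.C w₀) 0 1 1 .X
  P' := avec (.C x₀) 0 (.C w₀) 0 1 .X 1
  hab := .inr (.inr (.inr ⟨rfl, rfl⟩))
  V_left _ _ := rfl
  V_right _ _ := rfl
  V_eq s u := by cases u <;> simp [minusVec, avec]
  V_eq' s u := by cases u <;> simp [minusVec, avec]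
  isResolutionPoint {s t} hst := by
    rw [isResolutionPoint_iff]
    simp only [minusVec, avec, hj, hk, hs, hw, hxw]
    simp [hst.symm]
  isSingularPoint s t := by
    rw [isSingularPoint_toBlowUp' (r := r)]
    exact ⟨rfl, hs, by simp [minusVec, avec, hj], by simp [minusVec, avec, hk], by simp [minusVec, avec, hk]⟩
  inl_eq_inl {s t hp q hq} hst := by
    rw [inl_eq_inl]
    simp only [minusVec, avec]
    constructor
    · rintro ⟨h1, h2, h3, h4, h5⟩
      exact ⟨⟨h1, h2, h3, by simpa using h4.symm⟩, h5.symm⟩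
    · rintro ⟨⟨h1, h2, h3, h4⟩, h5⟩
      exact ⟨h1, h2, h3, by simp [h4], h5.symm⟩

/-! ### Equations of the lines -/

/-- The line is closed, and given by the conditions `A` and `B` on the two pieces of the fibre. -/
structure IsGivenBy (L : Line (Fibre r c)) (A : Aff AVar → Prop) (B : Aff BVar → Prop) : Prop where
  isClosed : IsClosed L.set
  inl_mem p hp : inl p hp ∈ L.set ↔ A p
  inr_mem q hq hq' : inr q hq hq' ∈ L.set ↔ B q

theorem isGivenBy_line0 (hw : c.w = 0) :
    IsGivenBy (line0 r hw) (fun _ => False) (fun q => q .u3 = 0) :=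
  ⟨isClosed_line0 hw, fun p hp => iff_of_false (inl_notMem_line0 hw p hp) id, inr_mem_line0 hw⟩

theorem isGivenBy_line1 (hw : c.w = 0) (h5 : c.β5 = 0) :
    IsGivenBy (line1 r hw h5) (fun p => p .y = 0 ∧ p .w = 0 ∧
      c1vec r 0 .αp * p .σp = c1vec r 0 .σp * p .αp ∧
      c1vec r 0 .αm * p .σm = c1vec r 0 .σm * p .αm) (fun q => q .v2 = 0 ∧ q .v3 = 0) :=
  ⟨isClosed_line1 hw h5, inl_mem_line1 hw h5, inr_mem_line1 hw h5⟩

theorem isGivenBy_line1B (hw : c.w = 0) (h5 : c.β5 ≠ 0) {κ : ℂ} (hκ : κ * (κ - 1) = 0) :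
    IsGivenBy (line1B r hw h5 hκ) (fun p => p .y = -κ * c.β5 ∧ p .w = 0)
      (fun q => q .v2 = -κ * c.β5 * q .v1 ∧ q .v3 = 0) :=
  ⟨isClosed_line1B hw h5 hκ, inl_mem_line1B hw h5 hκ, inr_mem_line1B hw h5 hκ⟩

theorem Branch.isGivenBy {κ : ℂ} (b : Branch r c κ) :
    IsGivenBy b.line (fun p => p .x = 0 ∧ p .y = -κ * (c.β5 + c.β3 * p .w) ∧
      b.αp.eval (p .w) * p .σp = b.σp.eval (p .w) * p .αp ∧
      b.αm.eval (p .w) * p .σm = b.σm.eval (p .w) * p .αm)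
      (fun q => q .u1 = 0 ∧ q .u2 = 0 ∧ q .v2 = -κ * (c.β5 * q .v1 + c.β3 * q .v3)) :=
  ⟨b.isClosed, b.inl_mem_line, b.inr_mem_line⟩

theorem ContractedLine.isGivenBy {a b : AVar} {Q : Aff AVar → Prop} (E : ContractedLine r c a b Q)
    (hQ : IsClosed {p | Q p}) : IsGivenBy E.line Q (fun _ => False) :=
  ⟨E.isClosed hQ, E.inl_mem_line, fun q hq hq' => iff_of_false (E.inr_notMem_line q hq hq') id⟩

theorem isClosed_point (x₀ w₀ : ℂ) {Q : Aff AVar → Prop} (hQ : IsClosed {p | Q p}) :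
    IsClosed {p : Aff AVar | p .x = x₀ ∧ p .y = 0 ∧ p .w = w₀ ∧ Q p} :=
  ((IsPolynomialFun.coord _).isClosed_eq (.const x₀)).inter <|
  ((IsPolynomialFun.coord _).isClosed_eq (.const 0)).inter <|
  ((IsPolynomialFun.coord _).isClosed_eq (.const w₀)).inter hQ

/-- Over a singular point where exactly one of `x`, `w` and `t` is different from zero, there is
one contracted line. -/
theorem exists_contractedLine (r : Resolution) {x₀ w₀ : ℂ} (hw : c.w = 0) (hs : fs c 0 w₀ = 0)
    (h1 : x₀ * w₀ = 0) (h2 : w₀ * ft c x₀ w₀ = 0) (h3 : x₀ * ft c x₀ w₀ = 0)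
    (h0 : x₀ ≠ 0 ∨ w₀ ≠ 0 ∨ ft c x₀ w₀ ≠ 0) :
    ∃ L : Line (Fibre r c),
      IsGivenBy L (fun p => p .x = x₀ ∧ p .y = 0 ∧ p .w = w₀) (fun _ => False) := by
  obtain ⟨hij, hik, hjk⟩ := (uvals_pairs r c x₀ w₀).2 ⟨h1, h2, h3⟩
  have h0' : (uvals r c x₀ w₀).1 ≠ 0 ∨ (uvals r c x₀ w₀).2.1 ≠ 0 ∨ (uvals r c x₀ w₀).2.2 ≠ 0 := by
    cases r <;> simp only [uvals, Resolution.perm] <;> tauto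
  -- If u_i = 0, the ratio α₊ / σ₊ is free; when also u_k = 0, then u_j ≠ 0 and the second equation
  -- gives α₋ = 0. If u_i ≠ 0, the first equation gives α₊ = 0 and the ratio σ₋ / α₋ is free. In
  -- each case the extra condition in the equations of the line is automatic.
  by_cases hi : (uvals r c x₀ w₀).1 = 0
  · let E := plusLine hw h1 hs hi hjk
    refine ⟨E.line, ?_, fun p hp => (E.inl_mem_line p hp).trans ?_,
      fun q hq hq' => iff_of_false (E.inr_notMem_line q hq hq') id⟩
    · refine E.isClosed (isClosed_point _ _ ?_)
      by_cases hk : (uvals r c x₀ w₀).2.2 = 0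
      · simp only [hk, true_implies]
        exact (IsPolynomialFun.coord _).isClosed_eq (.const 0)
      · simp [hk]
    · refine ⟨fun h => ⟨h.1, h.2.1, h.2.2.1⟩, fun ⟨hx, hy, hz⟩ => ⟨hx, hy, hz, fun hk => ?_⟩⟩
      have h := (isResolutionPoint_iff.1 hp).2.2.2.2.1
      rw [hx, hy, hz, hs, mul_zero] at h
      exact (mul_eq_zero.1 h).resolve_left (by tauto)
  · have hj := (mul_eq_zero.1 hij).resolve_left hi
    have hk := (mul_eq_zero.1 hik).resolve_left hi
    let E := minusLine hw h1 hs hj hk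
    refine ⟨E.line, ?_, fun p hp => (E.inl_mem_line p hp).trans ?_,
      fun q hq hq' => iff_of_false (E.inr_notMem_line q hq hq') id⟩
    · exact E.isClosed (isClosed_point _ _ ((IsPolynomialFun.coord _).isClosed_eq (.const 0)))
    · refine ⟨fun h => ⟨h.1, h.2.1, h.2.2.1⟩, fun ⟨hx, hy, hz⟩ => ⟨hx, hy, hz, ?_⟩⟩
      have h := (isResolutionPoint_iff.1 hp).2.2.2.1
      rw [hx, hy, hz, mul_zero] at h
      exact (mul_eq_zero.1 h).resolve_left hi

theorem IsGivenBy.disjoint {L L' : Line (Fibre r c)} {A A' : Aff AVar → Prop}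
    {B B' : Aff BVar → Prop} (h : IsGivenBy L A B) (h' : IsGivenBy L' A' B')
    (hA : ∀ p, IsResolutionPoint r c p → A p → ¬ A' p)
    (hB : ∀ q, IsBlowUpPoint c q → ¬ IsSingularPoint c q → B q → ¬ B' q) :
    Disjoint L.set L'.set := by
  refine Set.disjoint_left.2 fun x => ?_
  induction x using cases with
  | h p hp => rw [h.inl_mem, h'.inl_mem]; exact hA p hp
  | h' q hq hq' => rw [h.inr_mem, h'.inr_mem]; exact hB q hq hq'

/-- The three kinds of components of the fibre of the blown-up model over a point with `w = 0`. -/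
theorem isBlowUpPoint_cases (hw : c.w = 0) {q : Aff BVar} (hq : IsBlowUpPoint c q) :
    q .u3 = 0 ∨ (q .v3 = 0 ∧ q .v2 * (q .v2 + c.β5 * q .v1) = 0) ∨
      (q .u1 = 0 ∧ q .u2 = 0 ∧ q .v2 * (q .v2 + (c.β5 * q .v1 + c.β3 * q .v3)) = 0) := by
  obtain ⟨h1, h2, h3, h4, h5, h6, h7, h8, h9, h10⟩ := hq
  rw [hw] at h5 h6 h8 h9 h10
  by_cases hu3 : q .u3 = 0
  · exact .inl hu3
  have hx : q .x = 0 := by simpa [hu3] using h5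
  have hy : q .y = 0 := by simpa [hu3] using h6
  have hz : q .z ≠ 0 := by tauto
  -- Away from u3 = 0 all of x, y, w vanish, so z is a unit and the Weierstrass equation splits into
  -- two factors.
  have h11 : q .v2 * (q .v2 + (c.β5 * q .v1 + c.β3 * q .v3)) = 0 := by
    refine (mul_eq_zero.1 ?_).resolve_left hz
    rw [hx] at h10
    linear_combination h10
  by_cases hv3 : q .v3 = 0
  · refine .inr (.inl ⟨hv3, ?_⟩)
    rw [hv3] at h11
    linear_combination h11
  · exact .inr (.inr ⟨by simpa [hv3] using h8, by simpa [hv3] using h9, h11⟩)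

/-- Outside the singular points the second piece covers everything, so the first piece only has to
be checked over these; and by symmetry each pair of lines is treated once. -/
theorem isLineConfiguration {V : Type*} [LinearOrder V] {L : V → Line (Fibre r c)}
    {G : SimpleGraph V} (h : ∀ v, IsClosed (L v).set)
    (hA : ∀ p hp, IsSingularPoint c (toBlowUp p) → ∃ v, inl p hp ∈ (L v).set)
    (hB : ∀ q hq hq', ∃ v, inr q hq hq' ∈ (L v).set)
    (meet : ∀ v w, v < w → G.Adj v w → Meet (L v).set (L w).set)
    (disjoint : ∀ v w, v < w → ¬ G.Adj v w → Disjoint (L v).set (L w).set) :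
    IsLineConfiguration L G where
  isClosed := h
  cover x := by
    induction x using cases with
    | h p hp =>
      by_cases hs : IsSingularPoint c (toBlowUp p)
      · exact hA p hp hs
      · rw [inl_eq_inr_toBlowUp hs]
        exact hB _ _ _
    | h' q hq hq' => exact hB q hq hq'
  meet v w hvw := by
    rcases lt_or_gt_of_ne hvw.ne with h' | h'
    · exact meet v w h' hvw
    · exact (meet w v h' hvw.symm).symm
  disjoint v w hne hvw := by
    rcases lt_or_gt_of_ne hne with h' | h'
    · exact disjoint v w h' hvw
    · exact (disjoint w v h' fun h => hvw h.symm).symm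

/-! ### Intersections -/

theorem meet_line0_line1 (hw : c.w = 0) (h5 : c.β5 = 0) :
    Meet (line0 r hw).set (line1 r hw h5).set := by
  refine ((line1 r hw h5).meet_at_o ?_ (inl_notMem_line0 hw _ _) fun x => ?_).symm
  · exact (inr_mem_line0 hw _ (c1vec'_isBlowUpPoint hw 0) (c1vec'_not_singular (by simp))).2 rfl
  · induction x using cases with
    | h p hp => exact fun h => (inl_notMem_line0 hw _ _ h).elim
    | h' q hq hq' =>
      rw [inr_mem_line0]
      intro h
      change q .u3 / q .u1 = 0
      rw [h, zero_div]

theorem meet_line0_line1B (hw : c.w = 0) (h5 : c.β5 ≠ 0) {κ : ℂ} (hκ : κ * (κ - 1) = 0) :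
    Meet (line0 r hw).set (line1B r hw h5 hκ).set := by
  refine ((line1B r hw h5 hκ).meet_at_o ?_ ?_ fun x => ?_).symm
  · exact (inr_mem_line0 hw _ (c1vecB_isBlowUpPoint hw hκ (.inr one_ne_zero)) (c1vecB_not_singular h5)).2 rfl
  · exact fun h => one_ne_zero ((inr_mem_line0 hw _ (c1vecB_isBlowUpPoint hw hκ (.inl one_ne_zero))
      (c1vecB_not_singular h5)).1 h)
  · induction x using cases with
    | h p hp => exact fun h => (inl_notMem_line0 hw _ _ h).elim
    | h' q hq hq' =>
      rw [inr_mem_line0]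
      intro h
      change q .u3 / q .u1 = 0
      rw [h, zero_div]

/-- Since β₅ ≠ 0, the common point w = x = 0 is not singular, so the meeting can be verified in the
blown-up model. The coordinate x on C₁ vanishes on C₂. -/
theorem meet_line1B_branch (hw : c.w = 0) (h5 : c.β5 ≠ 0) {κ : ℂ} (hκ : κ * (κ - 1) = 0)
    (b : Branch r c κ) : Meet (line1B r hw h5 hκ).set b.line.set := by
  refine (line1B r hw h5 hκ).meet_at_γ (t := 0) ?_ ?_ fun x => ?_
  · exact (b.inr_mem_line _ (c1vecB_isBlowUpPoint hw hκ (.inl one_ne_zero)) (c1vecB_not_singular h5)).2 (by simp [c1vecB, bvec])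
  · exact fun h => one_ne_zero ((b.inr_mem_line _ (c1vecB_isBlowUpPoint hw hκ (.inr one_ne_zero))
      (c1vecB_not_singular h5)).1 h).1
  · induction x using cases with
    | h p hp =>
      rw [b.inl_mem_line]
      intro h
      change p .x / 1 = 0
      rw [h.1, zero_div]
    | h' q hq hq' =>
      rw [b.inr_mem_line]
      intro h
      change q .u1 / q .u3 = 0
      rw [h.1, zero_div]

/-- Meant for contracted lines: such a line lies over one point, so the coordinate x of C₁ is
constant on it, and transversality comes for free. `meet_branch` does the same for C₂ with its
coordinate w. -/
theorem IsGivenBy.meet_line1 {L : Line (Fibre r c)} {A : Aff AVar → Prop}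
    (h : IsGivenBy L A (fun _ => False)) (hw : c.w = 0) (h5 : c.β5 = 0) (x₀ : ℂ)
    (hA : A (c1vec r x₀)) (hx : ∀ p, A p → p .x = x₀) : Meet (line1 r hw h5).set L.set := by
  refine (line1 r hw h5).meet_at_γ (t := x₀) ((h.inl_mem _ _).2 hA) ?_ fun x => ?_
  · exact (h.inr_mem _ (c1vec'_isBlowUpPoint hw 0) (c1vec'_not_singular (by simp))).1
  · induction x using cases with
    | h p hp =>
      rw [h.inl_mem]
      intro h
      change p .x / 1 = x₀
      rw [hx p h, div_one]
    | h' q hq hq' => exact fun h' => ((h.inr_mem _ _ _).1 h').elim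

theorem IsGivenBy.meet_branch {L : Line (Fibre r c)} {A : Aff AVar → Prop}
    (h : IsGivenBy L A (fun _ => False)) {κ : ℂ} (b : Branch r c κ) (w₀ : ℂ)
    (hA : A (b.vec w₀)) (hx : ∀ p, A p → p .w = w₀) : Meet b.line.set L.set := by
  refine b.line.meet_at_γ (t := w₀) ((h.inl_mem _ _).2 hA) ?_ fun x => ?_
  · exact (h.inr_mem _ (c2vec'_isBlowUpPoint b.hw b.hκ 0)
      (eventually_cofiniteAt.1 (c2vec'_not_singular b.hc)).2).1
  · induction x using cases with
    | h p hp =>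
      rw [h.inl_mem]
      intro h
      change p .w / 1 = w₀
      rw [hx p h, div_one]
    | h' q hq hq' => exact fun h' => ((h.inr_mem _ _ _).1 h').elim

/-! ### The two branches of the exceptional divisor `x = 0`, if `β₃ ≠ 0` -/

/-- The functions `s' = β₅ + β₃ w`, `w` and `t` on the line `x = 0` of the exceptional divisor satisfy
`w t = N s'`, `s' / w = B_w / A_w` and `s' / t = B_t / A_t`. -/
structure BranchData (c : Coeffs) where
  N : Polynomial ℂ
  Aw : Polynomial ℂ
  Bw : Polynomial ℂ
  At : Polynomial ℂ
  Bt : Polynomial ℂ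
  hw : c.w = 0
  h3 : c.β3 ≠ 0
  ne_w (s : ℂ) : Bw.eval s ≠ 0 ∨ Aw.eval s ≠ 0
  ne_t (s : ℂ) : Bt.eval s ≠ 0 ∨ At.eval s ≠ 0
  ne (s : ℂ) : Bw.eval s ≠ 0 ∨ Bt.eval s ≠ 0
  eq_w (s : ℂ) : Bw.eval s * s = Aw.eval s * (c.β5 + c.β3 * s)
  eq_t (s : ℂ) : Bt.eval s * ft c 0 s = At.eval s * (c.β5 + c.β3 * s)
  eq_Nw (s : ℂ) : N.eval s * Bt.eval s = At.eval s * s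
  eq_Nt (s : ℂ) : N.eval s * Bw.eval s = Aw.eval s * ft c 0 s
  eq_N (s : ℂ) : s * ft c 0 s = N.eval s * (c.β5 + c.β3 * s)

namespace BranchData

variable (D : BranchData c)

/-- The component of the fibre with `x = y = 0`. -/
noncomputable def plus (r : Resolution) : Branch r c 0 where
  -- With y = 0 and s = s': if u_i ≠ x then α₊ = 0, and if u_j = x then σ₋ = 0. Otherwise α₋ / σ₋ =
  -- s' / u_j; when u_i = x, the third equation then gives α₊ / σ₊ = w t / s' = N.
  αp := match r with | .xt | .xw => D.N | _ => 0
  σp := 1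
  αm := match r with | .xt | .wt => D.Bt | .xw | .tw => D.Bw | .wx | .tx => 1
  σm := match r with | .xt | .wt => D.At | .xw | .tw => D.Aw | .wx | .tx => 0
  hw := D.hw
  hκ := by simp
  hc := .inl D.h3
  isResolutionPoint t := by
    have h1 := D.ne_w t
    have h2 := D.ne_t t
    have h3 := D.eq_w t
    have h4 := D.eq_t t
    have h5 := D.eq_Nw t
    have h6 := D.eq_Nt t
    have h7 := D.hw
    cases r <;> simp only [IsResolutionPoint, avec, Resolution.perm, fs] <;>
      simp only [Polynomial.eval_zero, Polynomial.eval_one] <;> grind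

/-- The component of the fibre with `x = s = 0`. -/
noncomputable def minus (r : Resolution) : Branch r c 1 where
  -- With s = 0 and y = -s' the roles are exchanged: α₊ / σ₊ = -s' / u_i unless u_i = x, and α₋ = 0
  -- unless u_j = x, where α₋ / σ₋ = -w t / s' = -N.
  αp := match r with | .xt | .xw => 1 | .tw | .tx => -D.Bt | .wt | .wx => -D.Bw
  σp := match r with | .xt | .xw => 0 | .tw | .tx => D.At | .wt | .wx => D.Aw
  αm := match r with | .wx | .tx => -D.N | _ => 0
  σm := 1
  hw := D.hw
  hκ := by simp
  hc := .inl D.h3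
  isResolutionPoint t := by
    have h1 := D.ne_w t
    have h2 := D.ne_t t
    have h3 := D.eq_w t
    have h4 := D.eq_t t
    have h5 := D.eq_Nw t
    have h6 := D.eq_Nt t
    have h7 := D.hw
    cases r <;> simp only [IsResolutionPoint, avec, Resolution.perm, fs] <;>
      simp only [Polynomial.eval_zero, Polynomial.eval_one, Polynomial.eval_neg] <;> grind

/-- The two curves cross in the blown-up model where s' = 0; there w t = N s' = 0, so every crossing
is a singular point. Over it they are separated by α and σ: if x is u_i or u_j, one ratio is
infinite on one curve and finite on the other, and if x = u_k the field `ne` prevents α₊ and α₋ from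
vanishing on both curves. -/
theorem disjoint_plus_minus (r : Resolution) :
    Disjoint (D.plus r).line.set (D.minus r).line.set := by
  refine (D.plus r).isGivenBy.disjoint (D.minus r).isGivenBy (fun p hp => ?_) fun q hq hq' => ?_
  · rintro ⟨h1, h2, h3, h4⟩ ⟨-, h5, h6, h7⟩
    have h8 := hp.1
    have h9 := hp.2.1
    have h10 := D.ne (p .w)
    cases r <;> simp only [plus, minus, Polynomial.eval_zero, Polynomial.eval_one,
      Polynomial.eval_neg] at h3 h4 h6 h7 <;> grind
  · rintro ⟨h1, h2, h3⟩ ⟨-, -, h4⟩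
    have hu : q .u3 ≠ 0 := by have := hq.2.1; tauto
    have h0 : c.β5 * q .v1 + c.β3 * q .v3 = 0 := by linear_combination h4 - h3
    have hv2 : q .v2 = 0 := by linear_combination h3
    have hv : q .v1 ≠ 0 := fun hv => by
      have := hq.2.2.1
      have h3 := D.h3
      grind
    have hs : c.β5 + c.β3 * (q .v3 / q .v1) = 0 := by field_simp; linear_combination h0
    have hN := D.eq_N (q .v3 / q .v1)
    rw [hs, mul_zero] at hN
    refine hq' ⟨hu, hv, ?_, ?_, ?_, ?_, ?_⟩ <;> simp only [h1, hv2, zero_div, zero_mul, fs]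
    · linear_combination hs
    · exact hN

/-- C₁ and C₂ could only meet over x = y = w = 0, which is singular because β₅ = 0. The conditions
at w = 0 say that the limits of α and σ along C₂ differ from their values on C₁, for every ordering
of x, w, t. -/
theorem disjoint_line1 (h5 : c.β5 = 0) (hA : D.Aw.eval 0 ≠ 0) (hN : D.N.eval 0 ≠ 0 ∨ D.Bt.eval 0 ≠ 0)
    (r : Resolution) : Disjoint (line1 r D.hw h5).set (D.plus r).line.set ∧
      Disjoint (line1 r D.hw h5).set (D.minus r).line.set := by
  have key : ∀ q, IsBlowUpPoint c q → ¬ IsSingularPoint c q → q .v2 = 0 ∧ q .v3 = 0 → q .u1 = 0 →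
      q .u2 = 0 → False := fun q hq hq' h h1 h2 => by
    have hu : q .u3 ≠ 0 := by have := hq.2.1; tauto
    have hv : q .v1 ≠ 0 := by have := hq.2.2.1; tauto
    exact hq' ⟨hu, hv, by simp [h], by simp [h, fs, h5], by simp [h], by simp [h], by simp [h1]⟩
  constructor
  · refine (isGivenBy_line1 D.hw h5).disjoint (D.plus r).isGivenBy (fun p hp => ?_)
      fun q hq hq' h h' => key q hq hq' h h'.1 h'.2.1
    rintro ⟨-, hw, h1, h2⟩ ⟨-, -, h3, h4⟩
    have h8 := hp.1
    have h9 := hp.2.1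
    rw [hw] at h3 h4
    cases r <;> simp only [c1vec, avec] at h1 h2 <;>
      simp only [plus, Polynomial.eval_zero, Polynomial.eval_one] at h3 h4 <;> grind
  · refine (isGivenBy_line1 D.hw h5).disjoint (D.minus r).isGivenBy (fun p hp => ?_)
      fun q hq hq' h h' => key q hq hq' h h'.1 h'.2.1
    rintro ⟨-, hw, h1, h2⟩ ⟨-, -, h3, h4⟩
    have h8 := hp.1
    have h9 := hp.2.1
    rw [hw] at h3 h4
    cases r <;> simp only [c1vec, avec] at h1 h2 <;>
      simp only [minus, Polynomial.eval_zero, Polynomial.eval_one, Polynomial.eval_neg] at h3 h4 <;>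
      grind

end BranchData

theorem disjoint_line0 (hw : c.w = 0) {L : Line (Fibre r c)} {A : Aff AVar → Prop}
    {B : Aff BVar → Prop} (h : IsGivenBy L A B)
    (hB : ∀ q, IsBlowUpPoint c q → ¬ IsSingularPoint c q → B q → q .u3 ≠ 0) :
    Disjoint (line0 r hw).set L.set :=
  (isGivenBy_line0 hw).disjoint h (fun _ _ h => h.elim) fun q hq hq' h h' => hB q hq hq' h' h

theorem disjoint_line0_branch (hw : c.w = 0) {κ : ℂ} (b : Branch r c κ) :
    Disjoint (line0 r hw).set b.line.set :=
  disjoint_line0 hw b.isGivenBy fun q hq _ h => by have := hq.2.1; tauto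

/-- The branches over a point of `Σ₁₀`. -/
noncomputable def branchData10 (hw : c.w = 0) (h5 : c.β5 = 0) (h3 : c.β3 ≠ 0)
    (h4 : c.β4 ≠ 0) : BranchData c where
  -- Here s' = β₃ w, whence N = t / β₃; the fraction s' / t is already reduced since t = β₄ ≠ 0 at w
  -- = 0.
  N := .C c.β3⁻¹ * (.C c.β4 + .X * .C c.β2 + .X ^ 2 * .C c.β0)
  Aw := 1
  Bw := .C c.β3
  At := .C c.β4 + .X * .C c.β2 + .X ^ 2 * .C c.β0
  Bt := .C c.β3 * .X
  hw := hw
  h3 := h3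
  ne_w s := by simp
  ne_t s := by
    by_cases hs : s = 0 <;> simp [hs, h3, h4]
  ne s := by simp [h3]
  eq_w s := by simp [h5]
  eq_t s := by simp [h5, ft]; ring
  eq_Nw s := by simp; field_simp
  eq_Nt s := by simp [ft]; field_simp
  eq_N s := by simp [ft, h5]; field_simp

/-- The branches over a point of `Π₄`. -/
noncomputable def branchData4 (hw : c.w = 0) (h5 : c.β5 = 0) (h4 : c.β4 = 0) (h3 : c.β3 ≠ 0) :
    BranchData c where
  -- Now s' = β₃ w and t = w (β₂ + β₀ w) share the factor w, which is cancelled in s' / t.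
  N := .C c.β3⁻¹ * .X * (.C c.β2 + .X * .C c.β0)
  Aw := 1
  Bw := .C c.β3
  At := .C c.β2 + .X * .C c.β0
  Bt := .C c.β3
  hw := hw
  h3 := h3
  ne_w s := by simp
  ne_t s := by simp [h3]
  ne s := by simp [h3]
  eq_w s := by simp [h5]
  eq_t s := by simp [h5, ft, h4]; ring
  eq_Nw s := by simp; field_simp
  eq_Nt s := by simp [ft, h4]; field_simp
  eq_N s := by simp [ft, h5, h4]; field_simp

/-- The branches over a point of `Σ₅`. -/
noncomputable def branchData5 (hw : c.w = 0) (hP : c.P = 0) (h5 : c.β5 ≠ 0) (h3 : c.β3 ≠ 0) :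
    BranchData c where
  -- The condition P = 0 means that s' divides t: β₃ t = s' (β₂ - β₀β₅/β₃ + β₀ w).
  N := .C c.β3⁻¹ * .X * (.C (c.β2 - c.β0 * c.β5 / c.β3) + .X * .C c.β0)
  Aw := .X
  Bw := .C c.β5 + .C c.β3 * .X
  At := .C (c.β2 - c.β0 * c.β5 / c.β3) + .X * .C c.β0
  Bt := .C c.β3
  hw := hw
  h3 := h3
  ne_w s := by
    by_cases hs : s = 0 <;> simp [hs, h5]
  ne_t s := by simp [h3]
  ne s := by simp [h3]
  eq_w s := by simp; ring
  eq_t s := by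
    simp only [Coeffs.P] at hP
    simp [ft]; field_simp; linear_combination hP
  eq_Nw s := by simp; field_simp
  eq_Nt s := by
    simp only [Coeffs.P] at hP
    simp [ft]; field_simp; linear_combination -hP * s
  eq_N s := by
    simp only [Coeffs.P] at hP
    simp [ft]; field_simp; linear_combination hP * s

end Fibre

end SU5

/-- The graph with the given edges. -/
def edgeGraph {n : ℕ} (E : List (Fin n × Fin n)) : SimpleGraph (Fin n) :=
  SimpleGraph.fromRel fun a b => (a, b) ∈ E

instance {n : ℕ} (E : List (Fin n × Fin n)) : DecidableRel (edgeGraph E).Adj := fun a b =>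
  inferInstanceAs (Decidable (a ≠ b ∧ ((a, b) ∈ E ∨ (b, a) ∈ E)))

namespace SU5

namespace Fibre

variable {r : Resolution} {c : Coeffs}

/-- Over a singular point with `x = w = t = 0`, there are two contracted lines. -/
theorem exists_contractedLines (r : Resolution) (hw : c.w = 0) (h5 : c.β5 = 0) (h4 : c.β4 = 0) :
    ∃ L L' : Line (Fibre r c),
      IsGivenBy L (fun p => p .x = 0 ∧ p .y = 0 ∧ p .w = 0 ∧ p .αm = 0) (fun _ => False) ∧
      IsGivenBy L' (fun p => p .x = 0 ∧ p .y = 0 ∧ p .w = 0 ∧ p .αp = 0) (fun _ => False) ∧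
      Meet L.set L'.set := by
  have hu : uvals r c 0 0 = (0, 0, 0) := by
    cases r <;> simp [uvals, Resolution.perm, ft, h4]
  have hxw : (0 : ℂ) * 0 = 0 := zero_mul 0
  have hs : fs c 0 0 = 0 := by simp [fs, h5]
  have hi : (uvals r c 0 0).1 = 0 := by rw [hu]
  have hj : (uvals r c 0 0).2.1 = 0 := by rw [hu]
  have hk : (uvals r c 0 0).2.2 = 0 := by rw [hu]
  have g (a) : IsClosed {p : Aff AVar | p .x = 0 ∧ p .y = 0 ∧ p .w = 0 ∧ p a = 0} :=
    isClosed_point _ _ ((IsPolynomialFun.coord _).isClosed_eq (.const 0))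
  let E := plusLine hw hxw hs hi (by rw [hj, zero_mul])
  let E' := minusLine hw hxw hs hj hk
  have gE : IsGivenBy E.line (fun p => p .x = 0 ∧ p .y = 0 ∧ p .w = 0 ∧ p .αm = 0)
      (fun _ => False) := by
    have := E.isGivenBy (by simpa only [hk, true_implies] using g _)
    simpa only [hk, true_implies] using this
  have gE' := E'.isGivenBy (g _)
  refine ⟨E.line, E'.line, gE, gE', E.line.meet_at_γ (t := 0) ?_ ?_ fun x => ?_⟩
  · exact (gE'.inl_mem _ (E.res₁ 0)).2 ⟨rfl, rfl, rfl, rfl⟩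
  · exact fun h => one_ne_zero ((gE'.inl_mem _ (E.res₂ 0)).1 h).2.2.2
  · induction x using cases with
    | h p hp =>
      rw [gE'.inl_mem]
      intro h
      change aratio .αp .σp _ = 0
      rw [aratio_inl E.hab, h.2.2.2, zero_div]
    | h' q hq hq' => exact fun h' => ((gE'.inr_mem _ _ _).1 h').elim

/-! ### The fibres -/

/-- The fibre over a point of codimension two of `Σ₅`. -/
theorem exists_isLineConfiguration_sigma5 (r : Resolution) (hw : c.w = 0) (hP : c.P = 0)
    (h5 : c.β5 ≠ 0) (h3 : c.β3 ≠ 0) : ∃ L : Fin 6 → Line (Fibre r c),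
      IsLineConfiguration L (edgeGraph [(0, 1), (1, 2), (2, 3), (3, 4), (4, 5), (0, 5)]) := by
  -- At the zero w = -β₅/β₃ of s', the value of t is P / β₃ ^ 2. This is the only singular point of
  -- the fibre.
  have ht : ft c 0 (-c.β5 / c.β3) = 0 := by
    simp only [Coeffs.P] at hP
    simp only [ft]
    field_simp
    linear_combination hP
  have hs : fs c 0 (-c.β5 / c.β3) = 0 := by simp only [fs]; field_simp; ring
  have hw0 : -c.β5 / c.β3 ≠ 0 := div_ne_zero (neg_ne_zero.2 h5) h3
  obtain ⟨E, gE⟩ := exists_contractedLine r (x₀ := 0) hw hs (by simp) (by simp [ht]) (by simp) (.inr (.inl hw0))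
  let D := branchData5 hw hP h5 h3
  have hκ0 : (0 : ℂ) * (0 - 1) = 0 := by simp
  have hκ1 : (1 : ℂ) * (1 - 1) = 0 := by simp
  have g0 := isGivenBy_line0 (r := r) hw
  have g1 := isGivenBy_line1B (r := r) hw h5 hκ0
  have g5 := isGivenBy_line1B (r := r) hw h5 hκ1
  have g2 := (D.plus r).isGivenBy
  have g4 := (D.minus r).isGivenBy
  have m01 := meet_line0_line1B (r := r) hw h5 hκ0
  have m05 := meet_line0_line1B (r := r) hw h5 hκ1
  have m12 := meet_line1B_branch hw h5 hκ0 (D.plus r)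
  have m45 := (meet_line1B_branch hw h5 hκ1 (D.minus r)).symm
  have m23 : Meet (D.plus r).line.set E.set :=
    gE.meet_branch (D.plus r) _ ⟨rfl, by simp [Branch.vec, avec], rfl⟩ fun p h => h.2.2
  have m34 : Meet E.set (D.minus r).line.set :=
    (gE.meet_branch (D.minus r) _ ⟨rfl, by simp [Branch.vec, avec]; field_simp; ring, rfl⟩
      fun p h => h.2.2).symm
  have d24 := D.disjoint_plus_minus r
  have d02 := disjoint_line0_branch hw (D.plus r)
  have d04 := disjoint_line0_branch hw (D.minus r)
  have d03 := disjoint_line0 hw gE fun q _ _ h => h.elim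
  have d13 := g1.disjoint gE (fun p _ h h' => hw0 (h'.2.2.symm.trans h.2)) fun q _ _ _ h' => h'
  have d35 := gE.disjoint g5 (fun p _ h h' => hw0 (h.2.2.symm.trans h'.2)) fun q _ _ h _ => h
  -- On v3 = 0 the coordinate v1 is nonzero along these curves, so the slopes v2 / v1 = -κ β₅ of the
  -- two curves differ.
  have key {κ κ' : ℂ} (h : κ ≠ κ') (q) (hq : IsBlowUpPoint c q)
      (h1 : q .v2 = -κ * c.β5 * q .v1 ∧ q .v3 = 0)
      (h2 : q .v2 = -κ' * c.β5 * q .v1) : False := by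
    have := hq.2.2.1
    have : (κ - κ') * (c.β5 * q .v1) = 0 := by linear_combination h1.1 - h2
    grind
  have d15 := g1.disjoint g5 (fun p _ h h' => h5 (by linear_combination h'.1 - h.1))
    fun q hq _ h h' => key zero_ne_one q hq h h'.1
  have d14 := g1.disjoint g4
    (fun p _ h h' => h5 (by have := h'.2.1; rw [h.2] at this; linear_combination this - h.1))
    fun q hq _ h h' => key zero_ne_one q hq h (by rw [h'.2.2, h.2]; ring)
  have d25 := g2.disjoint g5
    (fun p _ h h' => h5 (by have := h.2.1; rw [h'.2] at this; linear_combination h'.1 - this))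
    fun q hq _ h h' => key one_ne_zero q hq h' (by rw [h.2.2, h'.2]; ring)
  refine ⟨![line0 r hw, line1B r hw h5 hκ0, (D.plus r).line, E, (D.minus r).line,
    line1B r hw h5 hκ1], ?_⟩
  generalize line0 r hw = L0 at *
  generalize line1B r hw h5 hκ0 = L1 at *
  generalize (D.plus r).line = L2 at *
  generalize (D.minus r).line = L4 at *
  generalize line1B r hw h5 hκ1 = L5 at *
  refine isLineConfiguration ?_ ?_ ?_ ?_ ?_
  · intro v
    fin_cases v
    exacts [g0.isClosed, g1.isClosed, g2.isClosed, gE.isClosed, g4.isClosed, g5.isClosed]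
  · intro p hp h
    rw [isSingularPoint_toBlowUp] at h
    obtain ⟨h1, h2, h3', -, -⟩ := h
    rw [h1] at h2
    have hpw : p .w = -c.β5 / c.β3 := by
      simp only [fs] at h2; field_simp; linear_combination h2
    rw [hpw] at h3'
    exact ⟨3, (gE.inl_mem p hp).2 ⟨(mul_eq_zero.1 h3').resolve_right hw0, h1, hpw⟩⟩
  · intro q hq hq'
    rcases isBlowUpPoint_cases hw hq with h | ⟨h, h'⟩ | ⟨h, h', h''⟩
    · exact ⟨0, (g0.inr_mem q hq hq').2 h⟩
    · rcases mul_eq_zero.1 h' with h' | h'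
      · exact ⟨1, (g1.inr_mem q hq hq').2 ⟨by simp [h'], h⟩⟩
      · exact ⟨5, (g5.inr_mem q hq hq').2 ⟨by linear_combination h', h⟩⟩
    · rcases mul_eq_zero.1 h'' with h'' | h''
      · exact ⟨2, (g2.inr_mem q hq hq').2 ⟨h, h', by simp [h'']⟩⟩
      · exact ⟨4, (g4.inr_mem q hq hq').2 ⟨h, h', by linear_combination h''⟩⟩
  · intro v w hvw h
    fin_cases v <;> fin_cases w <;> first
      | exact absurd hvw (by decide) | exact absurd h (by decide) | assumption
  · intro v w hvw h
    fin_cases v <;> fin_cases w <;> first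
      | exact absurd hvw (by decide) | exact absurd h (by decide) | assumption

theorem c1vec_x (r : Resolution) (x : ℂ) : c1vec r x .x = x := by cases r <;> rfl

theorem c1vec_y (r : Resolution) (x : ℂ) : c1vec r x .y = 0 := by cases r <;> rfl

theorem c1vec_w (r : Resolution) (x : ℂ) : c1vec r x .w = 0 := by cases r <;> rfl

/-- The fibre over a point of codimension two of `Σ₁₀`. -/
theorem exists_isLineConfiguration_sigma10 (r : Resolution) (hw : c.w = 0) (h5 : c.β5 = 0)
    (h3 : c.β3 ≠ 0) (h4 : c.β4 ≠ 0) : ∃ L : Fin 6 → Line (Fibre r c),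
      IsLineConfiguration L (edgeGraph [(0, 1), (1, 4), (1, 5), (2, 4), (3, 4)]) := by
  have hs : fs c 0 0 = 0 := by simp [fs, h5]
  -- On y = w = 0 the singularity condition x t = 0 reads x (x + β₄) = 0, which gives two points; t
  -- = β₄ is nonzero at the first and x at the second.
  obtain ⟨E, gE⟩ := exists_contractedLine r (x₀ := 0) hw hs (by simp) (by simp) (by simp)
    (.inr (.inr (by simpa [ft] using h4)))
  obtain ⟨E', gE'⟩ := exists_contractedLine r (x₀ := -c.β4) hw hs (by simp) (by simp) (by simp [ft])
    (.inl (neg_ne_zero.2 h4))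
  let D := branchData10 hw h5 h3 h4
  have g0 := isGivenBy_line0 (r := r) hw
  have g1 := isGivenBy_line1 (r := r) hw h5
  have g2 := (D.plus r).isGivenBy
  have g3 := (D.minus r).isGivenBy
  have m01 := meet_line0_line1 (r := r) hw h5
  have m14 := gE.meet_line1 hw h5 0 ⟨c1vec_x r 0, c1vec_y r 0, c1vec_w r 0⟩ fun p h => h.1
  have m15 := gE'.meet_line1 hw h5 _ ⟨c1vec_x r _, c1vec_y r _, c1vec_w r _⟩ fun p h => h.1
  have m24 : Meet (D.plus r).line.set E.set :=
    gE.meet_branch (D.plus r) _ ⟨rfl, by simp [Branch.vec, avec], rfl⟩ fun p h => h.2.2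
  have m34 : Meet (D.minus r).line.set E.set :=
    gE.meet_branch (D.minus r) _ ⟨rfl, by simp [Branch.vec, avec, h5], rfl⟩ fun p h => h.2.2
  have d23 := D.disjoint_plus_minus r
  have d02 := disjoint_line0_branch hw (D.plus r)
  have d03 := disjoint_line0_branch hw (D.minus r)
  have d04 := disjoint_line0 hw gE fun q _ _ h => h.elim
  have d05 := disjoint_line0 hw gE' fun q _ _ h => h.elim
  obtain ⟨d12, d13⟩ := D.disjoint_line1 h5 (by simp [D, branchData10])
    (.inl (by simp [D, branchData10, h3, h4])) r
  have d25 := g2.disjoint gE' (fun p _ h h' => h4 (by linear_combination h'.1 - h.1))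
    fun q _ _ _ h' => h'
  have d35 := g3.disjoint gE' (fun p _ h h' => h4 (by linear_combination h'.1 - h.1))
    fun q _ _ _ h' => h'
  have d45 := gE.disjoint gE' (fun p _ h h' => h4 (by linear_combination h'.1 - h.1))
    fun q _ _ _ h' => h'
  refine ⟨![line0 r hw, line1 r hw h5, (D.plus r).line, (D.minus r).line, E, E'], ?_⟩
  have hB : ∀ q hq hq', inr q hq hq' ∈ (line0 r hw).set ∨ inr q hq hq' ∈ (line1 r hw h5).set ∨
      inr q hq hq' ∈ (D.plus r).line.set ∨ inr q hq hq' ∈ (D.minus r).line.set := by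
    intro q hq hq'
    rw [g0.inr_mem, g1.inr_mem, g2.inr_mem, g3.inr_mem]
    have := isBlowUpPoint_cases hw hq
    simp only [h5] at this ⊢
    grind
  generalize line0 r hw = L0 at *
  generalize line1 r hw h5 = L1 at *
  generalize (D.plus r).line = L2 at *
  generalize (D.minus r).line = L3 at *
  refine isLineConfiguration ?_ ?_ ?_ ?_ ?_
  · intro v
    fin_cases v
    exacts [g0.isClosed, g1.isClosed, g2.isClosed, g3.isClosed, gE.isClosed, gE'.isClosed]
  · intro p hp h
    rw [isSingularPoint_toBlowUp] at h
    obtain ⟨h1, h2, -, -, h6⟩ := h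
    have hpw : p .w = 0 := by simpa [h1, fs, h5, h3] using h2
    rcases mul_eq_zero.1 h6 with h6 | h6
    · exact ⟨4, (gE.inl_mem p hp).2 ⟨h6, h1, hpw⟩⟩
    · refine ⟨5, (gE'.inl_mem p hp).2 ⟨?_, h1, hpw⟩⟩
      simp only [ft, hpw] at h6
      linear_combination h6
  · intro q hq hq'
    rcases hB q hq hq' with h | h | h | h
    exacts [⟨0, h⟩, ⟨1, h⟩, ⟨2, h⟩, ⟨3, h⟩]
  · intro v w hvw h
    fin_cases v <;> fin_cases w <;> first
      | exact absurd hvw (by decide) | exact absurd h (by decide) | assumption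
  · intro v w hvw h
    fin_cases v <;> fin_cases w <;> first
      | exact absurd hvw (by decide) | exact absurd h (by decide) | assumption

/-- The edges of the dual graph over a point of `Π₄`. -/
def edges4 : Resolution → List (Fin 6 × Fin 6)
  | .wx | .wt => [(0, 1), (2, 5), (3, 4), (4, 5), (1, 4)]
  | .tw | .xw => [(0, 1), (2, 5), (3, 4), (4, 5), (1, 5)]
  | .xt | .tx => [(0, 1), (2, 5), (3, 4), (4, 5), (1, 4), (1, 5)]

set_option maxHeartbeats 1000000 in
/-- The fibre over a point of `Π₄`. -/
theorem exists_isLineConfiguration_pi4 (r : Resolution) (hw : c.w = 0) (h5 : c.β5 = 0)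
    (h4 : c.β4 = 0) (h3 : c.β3 ≠ 0) : ∃ L : Fin 6 → Line (Fibre r c),
      IsLineConfiguration L (edgeGraph (edges4 r)) ∧
      (r = .xt ∨ r = .tx → ((L 1).set ∩ (L 4).set ∩ (L 5).set).Nonempty) := by
  obtain ⟨E, E', gE, gE', m45⟩ := exists_contractedLines r hw h5 h4
  let D := branchData4 hw h5 h4 h3
  have g0 := isGivenBy_line0 (r := r) hw
  have g1 := isGivenBy_line1 (r := r) hw h5
  have g2 := (D.plus r).isGivenBy
  have g3 := (D.minus r).isGivenBy
  have m01 := meet_line0_line1 (r := r) hw h5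
  have hEr : r = .wx ∨ r = .wt ∨ r = .xt ∨ r = .tx → c1vec r 0 .αm = 0 := by
    rintro (rfl | rfl | rfl | rfl) <;> rfl
  have hEr' : r = .tw ∨ r = .xw ∨ r = .xt ∨ r = .tx → c1vec r 0 .αp = 0 := by
    rintro (rfl | rfl | rfl | rfl) <;> rfl
  -- The point x = 0 of C₁ lies on E if α₋ = 0 there and on E' if α₊ = 0. Both hold exactly when u_k
  -- = w.
  have m14 : r = .wx ∨ r = .wt ∨ r = .xt ∨ r = .tx → Meet (line1 r hw h5).set E.set := fun hr =>
    gE.meet_line1 hw h5 0 ⟨c1vec_x r 0, c1vec_y r 0, c1vec_w r 0, hEr hr⟩ fun p h => h.1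
  have m15 : r = .tw ∨ r = .xw ∨ r = .xt ∨ r = .tx → Meet (line1 r hw h5).set E'.set := fun hr =>
    gE'.meet_line1 hw h5 0 ⟨c1vec_x r 0, c1vec_y r 0, c1vec_w r 0, hEr' hr⟩ fun p h => h.1
  have d14 : r = .tw ∨ r = .xw → Disjoint (line1 r hw h5).set E.set := fun hr =>
    g1.disjoint gE (fun p hp h h' => by
      have := hp.2.1
      rcases hr with rfl | rfl <;> simp only [c1vec, avec] at h <;> grind) fun q _ _ _ h' => h'
  have d15 : r = .wx ∨ r = .wt → Disjoint (line1 r hw h5).set E'.set := fun hr =>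
    g1.disjoint gE' (fun p hp h h' => by
      have := hp.1
      rcases hr with rfl | rfl <;> simp only [c1vec, avec] at h <;> grind) fun q _ _ _ h' => h'
  -- At w = 0 the component with y = 0 has α₊ = 0 and α₋ ≠ 0, so it reaches E' and avoids E; the
  -- component with s = 0 does the opposite.
  have m25 : Meet (D.plus r).line.set E'.set :=
    gE'.meet_branch (D.plus r) 0 ⟨rfl, by simp [Branch.vec, avec], rfl, by
      cases r <;> simp [Branch.vec, avec, BranchData.plus, D, branchData4]⟩ fun p h => h.2.2.1
  have m34 : Meet (D.minus r).line.set E.set :=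
    gE.meet_branch (D.minus r) 0 ⟨rfl, by simp [Branch.vec, avec, h5], rfl, by
      cases r <;> simp [Branch.vec, avec, BranchData.minus, D, branchData4]⟩ fun p h => h.2.2.1
  have d24 : Disjoint (D.plus r).line.set E.set := g2.disjoint gE (fun p hp h h' => by
    obtain ⟨-, -, -, h⟩ := h
    rw [h'.2.2.1] at h
    have := hp.2.1
    cases r <;> simp [BranchData.plus, D, branchData4] at h <;> grind) fun q _ _ _ h' => h'
  have d35 : Disjoint (D.minus r).line.set E'.set := g3.disjoint gE' (fun p hp h h' => by
    obtain ⟨-, -, h, -⟩ := h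
    rw [h'.2.2.1] at h
    have := hp.1
    cases r <;> simp [BranchData.minus, D, branchData4] at h <;> grind) fun q _ _ _ h' => h'
  have d23 := D.disjoint_plus_minus r
  have d02 := disjoint_line0_branch hw (D.plus r)
  have d03 := disjoint_line0_branch hw (D.minus r)
  have d04 := disjoint_line0 hw gE fun q _ _ h => h.elim
  have d05 := disjoint_line0 hw gE' fun q _ _ h => h.elim
  obtain ⟨d12, d13⟩ := D.disjoint_line1 h5 (by simp [D, branchData4])
    (.inr (by simp [D, branchData4, h3])) r
  have hc : r = .xt ∨ r = .tx → ((line1 r hw h5).set ∩ E.set ∩ E'.set).Nonempty := fun hr =>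
    ⟨inl (c1vec r 0) (c1vec_isResolutionPoint hw h5 0), ⟨(line1 r hw h5).γ_mem 0,
      (gE.inl_mem _ _).2 ⟨c1vec_x r 0, c1vec_y r 0, c1vec_w r 0, hEr (by tauto)⟩⟩,
      (gE'.inl_mem _ _).2 ⟨c1vec_x r 0, c1vec_y r 0, c1vec_w r 0, hEr' (by tauto)⟩⟩
  refine ⟨![line0 r hw, line1 r hw h5, (D.plus r).line, (D.minus r).line, E, E'], ?_, hc⟩
  have hB : ∀ q hq hq', inr q hq hq' ∈ (line0 r hw).set ∨ inr q hq hq' ∈ (line1 r hw h5).set ∨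
      inr q hq hq' ∈ (D.plus r).line.set ∨ inr q hq hq' ∈ (D.minus r).line.set := by
    intro q hq hq'
    rw [g0.inr_mem, g1.inr_mem, g2.inr_mem, g3.inr_mem]
    have := isBlowUpPoint_cases hw hq
    simp only [h5] at this ⊢
    grind
  clear hEr hEr' hc
  generalize line0 r hw = L0 at *
  generalize line1 r hw h5 = L1 at *
  generalize (D.plus r).line = L2 at *
  generalize (D.minus r).line = L3 at *
  refine isLineConfiguration ?_ ?_ ?_ ?_ ?_
  · intro v
    fin_cases v
    exacts [g0.isClosed, g1.isClosed, g2.isClosed, g3.isClosed, gE.isClosed, gE'.isClosed]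
  · intro p hp h
    rw [isSingularPoint_toBlowUp] at h
    obtain ⟨h1, h2, -, -, h6⟩ := h
    have hpw : p .w = 0 := by simpa [h1, fs, h5, h3] using h2
    have hpx : p .x = 0 := by simpa [hpw, ft, h4] using h6
    -- Over the only singular point u_k = 0, so α₋α₊ = 0: the fibre of the resolution is E ∪ E'.
    have h7 := (isResolutionPoint_iff.1 hp).2.2.2.2.2
    have hu : (uvals r c (p .x) (p .w)).2.2 = 0 := by
      rw [hpx, hpw]
      cases r <;> simp [uvals, Resolution.perm, ft, h4]
    rw [hu, mul_zero] at h7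
    rcases mul_eq_zero.1 h7 with h7 | h7
    · exact ⟨4, (gE.inl_mem p hp).2 ⟨hpx, h1, hpw, h7⟩⟩
    · exact ⟨5, (gE'.inl_mem p hp).2 ⟨hpx, h1, hpw, h7⟩⟩
  · intro q hq hq'
    rcases hB q hq hq' with h | h | h | h
    exacts [⟨0, h⟩, ⟨1, h⟩, ⟨2, h⟩, ⟨3, h⟩]
  · intro v w hvw h
    fin_cases v <;> fin_cases w <;> first
      | exact absurd hvw (by decide) | assumption
      | (cases r <;> first | exact absurd h (by decide) | exact m14 (by simp) | exact m15 (by simp))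
  · intro v w hvw h
    fin_cases v <;> fin_cases w <;> first
      | exact absurd hvw (by decide) | assumption
      | (cases r <;> first | exact absurd h (by decide) | exact d14 (by simp) | exact d15 (by simp))

/-- Coordinates on the component with `x = y = 0` over a point of `Π₃`. -/
def c2vec (r : Resolution) (w : ℂ) : AVar → ℂ :=
  -- Along x = y = s = 0 the functions w and t are generically nonzero, so α and σ are constant.
  -- These are the values on C₁ with x in place of w.
  match r with
  | .xt | .xw => avec 0 0 w 1 0 0 1
  | .tw | .wt => avec 0 0 w 0 1 0 1
  | .wx | .tx => avec 0 0 w 0 1 1 0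

/-- The component with `x = y = 0` over a point of `Π₃`. -/
noncomputable def branch3 (r : Resolution) (hw : c.w = 0) (h5 : c.β5 = 0) (h3 : c.β3 = 0)
    (h0 : c.β0 ≠ 0) : Branch r c 0 where
  αp := .C (c2vec r 0 .αp)
  σp := .C (c2vec r 0 .σp)
  αm := .C (c2vec r 0 .αm)
  σm := .C (c2vec r 0 .σm)
  hw := hw
  hκ := by simp
  hc := .inr h0
  isResolutionPoint t := by
    simp only [Polynomial.eval_C]
    cases r <;> simp [IsResolutionPoint, avec, Resolution.perm, fs, c2vec, h3, h5, hw]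

/-- The constant values of α and σ depend only on whether the vanishing function is u_i, u_j or u_k,
and these three points of ℙ¹ × ℙ¹ are distinct. The function is w on C₁ and x on C₂. -/
theorem disjoint_line1_branch3 (r : Resolution) (hw : c.w = 0) (h5 : c.β5 = 0) (h3 : c.β3 = 0)
    (h0 : c.β0 ≠ 0) : Disjoint (line1 r hw h5).set (branch3 r hw h5 h3 h0).line.set := by
  refine (isGivenBy_line1 hw h5).disjoint (Branch.isGivenBy _) (fun p hp => ?_)
    fun q hq hq' h h' => ?_
  · rintro ⟨-, -, h1, h2⟩ ⟨-, -, h3, h4⟩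
    have h8 := hp.1
    have h9 := hp.2.1
    simp only [branch3, Polynomial.eval_C] at h3 h4
    cases r <;> simp only [c1vec, c2vec, avec] at h1 h2 h3 h4 <;> grind
  · have hu : q .u3 ≠ 0 := by have := hq.2.1; tauto
    have hv : q .v1 ≠ 0 := by have := hq.2.2.1; tauto
    exact hq' ⟨hu, hv, by simp [h], by simp [h, fs, h5], by simp [h], by simp [h], by simp [h'.1]⟩

/-- The fibre over a point of `Π₃`. -/
theorem exists_isLineConfiguration_pi3 (r : Resolution) (hw : c.w = 0) (h5 : c.β5 = 0)
    (h3 : c.β3 = 0) (h4 : c.β4 ≠ 0) (h0 : c.β0 ≠ 0) (hd : c.β2 ^ 2 - 4 * c.β4 * c.β0 ≠ 0) :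
    ∃ L : Fin 7 → Line (Fibre r c),
      IsLineConfiguration L (edgeGraph [(1, 2), (2, 3), (3, 4), (4, 5), (0, 2), (4, 6)]) := by
  -- The roots a, b of t on x = 0 are found from a square root d of the discriminant. They are
  -- distinct as d ≠ 0, and nonzero as t = β₄ ≠ 0 at w = 0.
  obtain ⟨d, hd'⟩ := IsAlgClosed.exists_pow_nat_eq (c.β2 ^ 2 - 4 * c.β4 * c.β0) two_pos
  have hd0 : d ≠ 0 := by rintro rfl; exact hd (by rw [← hd']; simp)
  have h00 : 2 * c.β0 ≠ 0 := mul_ne_zero two_ne_zero h0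
  obtain ⟨a, ha⟩ : ∃ a, 2 * c.β0 * a = -c.β2 + d := ⟨(-c.β2 + d) / (2 * c.β0), by field_simp⟩
  obtain ⟨b, hb⟩ : ∃ b, 2 * c.β0 * b = -c.β2 - d := ⟨(-c.β2 - d) / (2 * c.β0), by field_simp⟩
  have hab : a ≠ b := by rintro rfl; exact hd0 (by linear_combination (ha - hb) / -2)
  have hfac (w : ℂ) : ft c 0 w = c.β0 * (w - a) * (w - b) := by
    refine mul_left_cancel₀ (mul_ne_zero h00 two_ne_zero) ?_
    simp only [ft]
    linear_combination hd' + (2 * c.β0 * w - 2 * c.β0 * b) * ha + (2 * c.β0 * w + c.β2 - d) * hb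
  have hs (w) : fs c 0 w = 0 := by simp [fs, h5, h3]
  have ha0 : a ≠ 0 := by
    rintro rfl; exact h4 (by simpa [ft] using hfac 0)
  have hb0 : b ≠ 0 := by
    rintro rfl; exact h4 (by simpa [ft] using hfac 0)
  -- Since s = y, the singular points are the pairwise intersections of x = 0, w = 0 and t = 0 in
  -- the plane y = 0: one with w = t = 0, one with x = w = 0, and two with x = t = 0.
  obtain ⟨E0, gE0⟩ := exists_contractedLine r (x₀ := -c.β4) hw (hs 0) (by simp) (by simp)
    (by simp [ft]) (.inl (neg_ne_zero.2 h4))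
  obtain ⟨E3, gE3⟩ := exists_contractedLine r (x₀ := 0) hw (hs 0) (by simp) (by simp) (by simp)
    (.inr (.inr (by simpa [ft] using h4)))
  obtain ⟨E5, gE5⟩ := exists_contractedLine r (x₀ := 0) hw (hs a) (by simp) (by simp [hfac]) (by simp)
    (.inr (.inl ha0))
  obtain ⟨E6, gE6⟩ := exists_contractedLine r (x₀ := 0) hw (hs b) (by simp) (by simp [hfac]) (by simp)
    (.inr (.inl hb0))
  have g1 := isGivenBy_line0 (r := r) hw
  have g2 := isGivenBy_line1 (r := r) hw h5
  let C := branch3 r hw h5 h3 h0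
  have g4 := C.isGivenBy
  have m12 := meet_line0_line1 (r := r) hw h5
  have m02 := (gE0.meet_line1 hw h5 _ ⟨c1vec_x r _, c1vec_y r _, c1vec_w r _⟩ fun p h => h.1).symm
  have m23 := gE3.meet_line1 hw h5 0 ⟨c1vec_x r 0, c1vec_y r 0, c1vec_w r 0⟩ fun p h => h.1
  have m34 := (gE3.meet_branch C _ ⟨rfl, by simp [Branch.vec, avec], rfl⟩ fun p h => h.2.2).symm
  have m45 := gE5.meet_branch C _ ⟨rfl, by simp [Branch.vec, avec], rfl⟩ fun p h => h.2.2
  have m46 := gE6.meet_branch C _ ⟨rfl, by simp [Branch.vec, avec], rfl⟩ fun p h => h.2.2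
  have d01 := (disjoint_line0 hw gE0 fun q _ _ h => h.elim).symm
  have d13 := disjoint_line0 hw gE3 fun q _ _ h => h.elim
  have d15 := disjoint_line0 hw gE5 fun q _ _ h => h.elim
  have d16 := disjoint_line0 hw gE6 fun q _ _ h => h.elim
  have d14 := disjoint_line0_branch hw C
  have d03 := gE0.disjoint gE3 (fun p _ h h' => h4 (by linear_combination h.1 - h'.1))
    fun q _ _ _ h' => h'
  have d04 := gE0.disjoint g4 (fun p _ h h' => h4 (by linear_combination h.1 - h'.1))
    fun q _ _ h _ => h
  have d05 := gE0.disjoint gE5 (fun p _ h h' => h4 (by linear_combination h.1 - h'.1))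
    fun q _ _ _ h' => h'
  have d06 := gE0.disjoint gE6 (fun p _ h h' => h4 (by linear_combination h.1 - h'.1))
    fun q _ _ _ h' => h'
  have d25 := g2.disjoint gE5 (fun p _ h h' => ha0 (h'.2.2.symm.trans h.2.1)) fun q _ _ _ h' => h'
  have d26 := g2.disjoint gE6 (fun p _ h h' => hb0 (h'.2.2.symm.trans h.2.1)) fun q _ _ _ h' => h'
  have d35 := gE3.disjoint gE5 (fun p _ h h' => ha0 (h'.2.2.symm.trans h.2.2)) fun q _ _ _ h' => h'
  have d36 := gE3.disjoint gE6 (fun p _ h h' => hb0 (h'.2.2.symm.trans h.2.2)) fun q _ _ _ h' => h'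
  have d56 := gE5.disjoint gE6 (fun p _ h h' => hab (h.2.2.symm.trans h'.2.2)) fun q _ _ _ h' => h'
  have d24 := disjoint_line1_branch3 r hw h5 h3 h0
  refine ⟨![E0, line0 r hw, line1 r hw h5, E3, C.line, E5, E6], ?_⟩
  have hB : ∀ q hq hq', inr q hq hq' ∈ (line0 r hw).set ∨ inr q hq hq' ∈ (line1 r hw h5).set ∨
      inr q hq hq' ∈ C.line.set := by
    intro q hq hq'
    rw [g1.inr_mem, g2.inr_mem, g4.inr_mem]
    have := isBlowUpPoint_cases hw hq
    simp only [h5, h3] at this ⊢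
    grind
  generalize line0 r hw = L0 at *
  generalize line1 r hw h5 = L1 at *
  generalize C.line = L2 at *
  refine isLineConfiguration ?_ ?_ ?_ ?_ ?_
  · intro v
    fin_cases v
    exacts [gE0.isClosed, g1.isClosed, g2.isClosed, gE3.isClosed, g4.isClosed, gE5.isClosed,
      gE6.isClosed]
  · intro p hp h
    rw [isSingularPoint_toBlowUp] at h
    obtain ⟨h1, -, h2, h6, h7⟩ := h
    rcases mul_eq_zero.1 h2 with hx | hpw
    · rw [hx, hfac] at h6
      simp only [mul_eq_zero, h0, false_or, sub_eq_zero] at h6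
      rcases h6 with h6 | h6 | h6
      · exact ⟨3, (gE3.inl_mem p hp).2 ⟨hx, h1, h6⟩⟩
      · exact ⟨5, (gE5.inl_mem p hp).2 ⟨hx, h1, h6⟩⟩
      · exact ⟨6, (gE6.inl_mem p hp).2 ⟨hx, h1, h6⟩⟩
    · rcases mul_eq_zero.1 h7 with h7 | h7
      · exact ⟨3, (gE3.inl_mem p hp).2 ⟨h7, h1, hpw⟩⟩
      · refine ⟨0, (gE0.inl_mem p hp).2 ⟨?_, h1, hpw⟩⟩
        simp only [ft, hpw] at h7
        linear_combination h7
  · intro q hq hq'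
    rcases hB q hq hq' with h | h | h
    exacts [⟨1, h⟩, ⟨2, h⟩, ⟨4, h⟩]
  · intro v w hvw h
    fin_cases v <;> fin_cases w <;> first
      | exact absurd hvw (by decide) | exact absurd h (by decide) | assumption
  · intro v w hvw h
    fin_cases v <;> fin_cases w <;> first
      | exact absurd hvw (by decide) | exact absurd h (by decide) | assumption

end Fibre

end SU5

/-! ### Graphs -/

/-- A graph whose vertices have levels such that the levels of adjacent vertices differ by one
contains no triangle. -/
theorem SimpleGraph.not_adj_of_level {V : Type*} {G : SimpleGraph V} (l : V → ℕ)
    (hl : ∀ u v, G.Adj u v → l v = l u + 1 ∨ l u = l v + 1) (u v w : V) (huv : G.Adj u v)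
    (huw : G.Adj u w) : ¬ G.Adj v w := fun hvw => by
  have h1 := hl u v huv
  have h2 := hl u w huw
  have h3 := hl v w hvw
  omega

/-- The level is the distance from the common end of the three chains. -/
theorem graphT_not_adj {p q r : ℕ} : ∀ u v w, (graphT p q r).Adj u v → (graphT p q r).Adj u w →
    ¬ (graphT p q r).Adj v w := by
  refine SimpleGraph.not_adj_of_level (fun a => match a with | none => 0 | some ⟨_, k⟩ => k.val + 1) ?_
  rintro (_ | ⟨i, k⟩) (_ | ⟨j, l⟩) ⟨-, h⟩
  all_goals simp at h ⊢
  all_goals omega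

/-- The extra leaves 0 and n get the levels of their twins 1 and n - 1. -/
theorem graphAffineD_not_adj {n : ℕ} (hn : 4 ≤ n) : ∀ u v w, (graphAffineD n).Adj u v →
    (graphAffineD n).Adj u w → ¬ (graphAffineD n).Adj v w := by
  refine SimpleGraph.not_adj_of_level
    (fun a => if a.val = 0 then 1 else if a.val = n then n - 1 else a.val) ?_
  intro a b hab
  rw [graphAffineD, SimpleGraph.fromRel_adj, ne_eq, Fin.ext_iff] at hab
  split_ifs <;> omega

/-- A Dynkin diagram with six vertices contains no triangle. -/
theorem not_isADE_of_triangle {V : Type*} {G : SimpleGraph V} (hV : Nat.card V = 6) {u v w : V}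
    (huv : G.Adj u v) (huw : G.Adj u w) (hvw : G.Adj v w) : ¬ IsADE G := by
  have key : ∀ {W : Type} {H : SimpleGraph W}, (∀ u v w, H.Adj u v → H.Adj u w → ¬ H.Adj v w) →
      ¬ Nonempty (G ≃g H) := fun hH ⟨e⟩ =>
    hH _ _ _ (e.map_adj_iff.2 huv) (e.map_adj_iff.2 huw) (e.map_adj_iff.2 hvw)
  rintro (⟨n, -, h⟩ | ⟨n, -, h⟩ | ⟨n, -, -, h⟩ | ⟨n, -, h⟩ | ⟨n, hn, h⟩ | h | h | h)
  · refine key (SimpleGraph.not_adj_of_level (fun a => a.val) fun u v huv => ?_) h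
    rw [SimpleGraph.pathGraph_adj] at huv
    omega
  · exact key graphT_not_adj h
  · exact key graphT_not_adj h
  -- Among the cycles only the one of length three contains a triangle; counting vertices leaves the
  -- hexagon.
  · have hn : n = 6 := by
      rw [← hV, Nat.card_congr h.some.toEquiv, Nat.card_eq_fintype_card, Fintype.card_fin]
    subst hn
    exact key (by decide) h
  · exact key (graphAffineD_not_adj hn) h
  · exact key graphT_not_adj h
  · exact key graphT_not_adj h
  · exact key graphT_not_adj h

theorem edgeGraph_iso_cycleGraph :
    Nonempty (edgeGraph (n := 6) [(0, 1), (1, 2), (2, 3), (3, 4), (4, 5), (0, 5)] ≃g SimpleGraph.cycleGraph 6) :=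
  ⟨⟨Equiv.refl _, by decide⟩⟩

theorem edgeGraph_iso_graphAffineD :
    Nonempty (edgeGraph (n := 7) [(1, 2), (2, 3), (3, 4), (4, 5), (0, 2), (4, 6)] ≃g graphAffineD 6) := by
  refine ⟨⟨Equiv.refl _, fun {a b} => ?_⟩⟩
  simp only [graphAffineD, edgeGraph, SimpleGraph.fromRel_adj, Equiv.refl_apply]
  revert a b
  decide

/-! ### The dual graphs of the fibres -/

namespace SU5

open Fibre

/-- The trivalent vertex is the inserted line met by C₁: E (vertex 4) for `wx` and `wt`, treated by
`f`, and E' (vertex 5) for `tw` and `xw`, treated by `g`. -/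
theorem edgeGraph_edges4_iso_graphT {r : Resolution} (h : r ≠ .xt) (h' : r ≠ .tx) :
    Nonempty (edgeGraph (edges4 r) ≃g graphT 2 3 3) := by
  let f : Fin 6 → Option (Σ i : Fin 3, Fin (![2, 3, 3] i - 1)) :=
    ![some ⟨2, (1 : Fin 2)⟩, some ⟨2, (0 : Fin 2)⟩, some ⟨1, (1 : Fin 2)⟩, some ⟨0, (0 : Fin 1)⟩,
      none, some ⟨1, (0 : Fin 2)⟩]
  let g : Fin 6 → Option (Σ i : Fin 3, Fin (![2, 3, 3] i - 1)) :=
    ![some ⟨2, (1 : Fin 2)⟩, some ⟨2, (0 : Fin 2)⟩, some ⟨0, (0 : Fin 1)⟩, some ⟨1, (1 : Fin 2)⟩,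
      some ⟨1, (0 : Fin 2)⟩, none]
  have hf : Nonempty (edgeGraph (edges4 .wx) ≃g graphT 2 3 3) := by
    refine ⟨⟨Equiv.ofBijective f (by decide), fun {a b} => ?_⟩⟩
    fin_cases a <;> fin_cases b <;> simp [f, edgeGraph, edges4, graphT] <;> decide
  have hg : Nonempty (edgeGraph (edges4 .tw) ≃g graphT 2 3 3) := by
    refine ⟨⟨Equiv.ofBijective g (by decide), fun {a b} => ?_⟩⟩
    fin_cases a <;> fin_cases b <;> simp [g, edgeGraph, edges4, graphT] <;> decide
  cases r
  exacts [hf, hg, absurd rfl h, hf, hg, absurd rfl h']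

namespace Fibre

variable {r : Resolution} {c : Coeffs}

theorem edges4_no_triangle (h : r ≠ .xt) (h' : r ≠ .tx) : ∀ u v w, (edgeGraph (edges4 r)).Adj u v →
    (edgeGraph (edges4 r)).Adj u w → ¬ (edgeGraph (edges4 r)).Adj v w := by
  cases r
  exacts [by decide, by decide, absurd rfl h, by decide, by decide, absurd rfl h']

theorem nodes_eq {n : ℕ} {L : Fin n → Line (Fibre r c)} {G : SimpleGraph (Fin n)}
    (h : IsLineConfiguration L G) : nodes r c = n := by
  rw [nodes, h.ncard_irreducibleComponents, Nat.card_eq_fintype_card, Fintype.card_fin]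

theorem hasDualGraph_sigma5 (r : Resolution) (hw : c.w = 0) (hP : c.P = 0) (h5 : c.β5 ≠ 0)
    (h3 : c.β3 ≠ 0) : HasDualGraph (Fibre r c) (SimpleGraph.cycleGraph 6) := by
  obtain ⟨L, hL⟩ := exists_isLineConfiguration_sigma5 r hw hP h5 h3
  exact hL.hasDualGraph (by decide) edgeGraph_iso_cycleGraph

theorem hasDualGraph_pi3 (r : Resolution) (hw : c.w = 0) (h5 : c.β5 = 0)
    (h3 : c.β3 = 0) (h4 : c.β4 ≠ 0) (h0 : c.β0 ≠ 0) (hd : c.β2 ^ 2 - 4 * c.β4 * c.β0 ≠ 0) :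
    HasDualGraph (Fibre r c) (graphAffineD 6) := by
  obtain ⟨L, hL⟩ := exists_isLineConfiguration_pi3 r hw h5 h3 h4 h0 hd
  exact hL.hasDualGraph (by decide) edgeGraph_iso_graphAffineD

theorem hasDualGraph_pi4 (hw : c.w = 0) (h5 : c.β5 = 0) (h4 : c.β4 = 0) (h3 : c.β3 ≠ 0)
    (h : r ≠ .xt) (h' : r ≠ .tx) : HasDualGraph (Fibre r c) (graphT 2 3 3) := by
  obtain ⟨L, hL, -⟩ := exists_isLineConfiguration_pi4 r hw h5 h4 h3
  exact hL.hasDualGraph (edges4_no_triangle h h') (edgeGraph_edges4_iso_graphT h h')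

theorem isBouquet_pi4 (hw : c.w = 0) (h5 : c.β5 = 0) (h4 : c.β4 = 0) (h3 : c.β3 ≠ 0)
    (hr : r = .xt ∨ r = .tx) : IsBouquetOfThreeTwoChains (Fibre r c) ∧
      ¬ IsADE (dualGraph (Fibre r c)) := by
  obtain ⟨L, hL, hp⟩ := exists_isLineConfiguration_pi4 r hw h5 h4 h3
  obtain ⟨p, ⟨hp1, hp4⟩, hp5⟩ := hp hr
  have hr' : edges4 r = edges4 .xt := by rcases hr with rfl | rfl <;> rfl
  rw [hr'] at hL
  have key {v w x} (h : x ∈ (L v).set) (hvw : v ≠ w ∧ ¬ (edgeGraph (edges4 .xt)).Adj v w) :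
      x ∉ (L w).set := Set.disjoint_left.1 (hL.disjoint v w hvw.1 hvw.2) h
  refine ⟨⟨hL.isConfigurationOfLines, ?_⟩, ?_⟩
  -- The three chains are C₁, C₀, then E with the component s = 0 of C₂, then E' with the component
  -- y = 0 of C₂.
  · let e : Fin 3 → Fin 2 → Fin 6 := ![![1, 0], ![4, 3], ![5, 2]]
    have he : Function.Bijective fun k : Fin 3 × Fin 2 => e k.1 k.2 := by decide
    refine ⟨fun i j => (L (e i j)).set, hL.set_injective.comp he.1, ?_, ⟨p, fun i => ⟨?_, ?_⟩⟩,
      fun i => ?_, fun i j hij => ⟨?_, ?_⟩⟩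
    · rw [hL.irreducibleComponents_eq]
      exact he.2.range_comp fun v => (L v).set
    · fin_cases i
      exacts [hp1, hp4, hp5]
    · fin_cases i
      exacts [key hp4 (by decide), key hp1 (by decide), key hp1 (by decide)]
    · exact (hL.adj_iff.1 (by revert i; decide)).2
    · exact hL.disjoint _ _ (by revert i j; decide) (by revert i j; decide)
    · exact hL.disjoint _ _ (by revert i j; decide) (by revert i j; decide)
  · obtain ⟨f⟩ := hL.dualGraph_iso
    -- The concurrent lines C₁, E, E' form a triangle in the intersection graph.
    refine not_isADE_of_triangle (u := f.symm 1) (v := f.symm 4) (w := f.symm 5) ?_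
      (f.symm.map_adj_iff.2 (by decide)) (f.symm.map_adj_iff.2 (by decide))
      (f.symm.map_adj_iff.2 (by decide))
    rw [Nat.card_congr f.toEquiv, Nat.card_eq_fintype_card, Fintype.card_fin]

end Fibre

end SU5

/-! ### The loci in the base -/

namespace SU5Model

variable {B : Type*} (M : SU5Model B) {b : B} {i j : M.I}

theorem w_eq_zero_iff (hi : b ∈ M.U i) (hj : b ∈ M.U j) :
    (M.coeffs i b).w = 0 ↔ (M.coeffs j b).w = 0 := by
  simp [M.w_glue i j b hi hj]

theorem β3_eq_zero_iff (hi : b ∈ M.U i) (hj : b ∈ M.U j) :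
    (M.coeffs i b).β3 = 0 ↔ (M.coeffs j b).β3 = 0 := by
  simp [M.β3_glue i j b hi hj]

theorem β4_eq_zero_iff (hi : b ∈ M.U i) (hj : b ∈ M.U j) :
    (M.coeffs i b).β4 = 0 ↔ (M.coeffs j b).β4 = 0 := by
  simp [M.β4_glue i j b hi hj]

theorem β5_eq_zero_iff (hi : b ∈ M.U i) (hj : b ∈ M.U j) :
    (M.coeffs i b).β5 = 0 ↔ (M.coeffs j b).β5 = 0 := by
  simp [M.β5_glue i j b hi hj]

theorem mem_pi3_iff (hi : b ∈ M.U i) : b ∈ M.pi3 ↔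
    (M.coeffs i b).w = 0 ∧ (M.coeffs i b).β5 = 0 ∧ (M.coeffs i b).β3 = 0 := by
  refine ⟨fun h => h i hi, fun h j hj => ?_⟩
  beta_reduce
  rwa [M.w_eq_zero_iff hj hi, M.β5_eq_zero_iff hj hi, M.β3_eq_zero_iff hj hi]

theorem mem_pi4_iff (hi : b ∈ M.U i) : b ∈ M.pi4 ↔
    (M.coeffs i b).w = 0 ∧ (M.coeffs i b).β5 = 0 ∧ (M.coeffs i b).β4 = 0 := by
  refine ⟨fun h => h i hi, fun h j hj => ?_⟩
  beta_reduce
  rwa [M.w_eq_zero_iff hj hi, M.β5_eq_zero_iff hj hi, M.β4_eq_zero_iff hj hi]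

/-- Where β₅ = 0, the polynomial P reduces to β₃ ^ 2 β₄. -/
theorem sigma5_inter_sigma10 : M.sigma5 ∩ M.sigma10 = M.pi3 ∪ M.pi4 := by
  ext b
  constructor
  · rintro ⟨h, h'⟩
    obtain ⟨i, hi⟩ := M.cover b
    obtain ⟨hw, hP⟩ := h i hi
    obtain ⟨-, h5⟩ := h' i hi
    simp only [SU5.Coeffs.P, h5] at hP
    have : (M.coeffs i b).β3 = 0 ∨ (M.coeffs i b).β4 = 0 := by simpa using hP
    rcases this with h | h
    · exact .inl ((M.mem_pi3_iff hi).2 ⟨hw, h5, h⟩)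
    · exact .inr ((M.mem_pi4_iff hi).2 ⟨hw, h5, h⟩)
  · rintro (h | h)
    · refine ⟨fun i hi => ?_, fun i hi => ⟨(h i hi).1, (h i hi).2.1⟩⟩
      obtain ⟨hw, h5, h3⟩ := h i hi
      exact ⟨hw, by simp [SU5.Coeffs.P, h5, h3]⟩
    · refine ⟨fun i hi => ?_, fun i hi => ⟨(h i hi).1, (h i hi).2.1⟩⟩
      obtain ⟨hw, h5, h4⟩ := h i hi
      exact ⟨hw, by simp [SU5.Coeffs.P, h5, h4]⟩

/-- The points of `Π₇` that are not in `Π₃` are points of codimension two of `Σ₅`. -/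
theorem generalSigma5_of_mem_pi7 (hM : M.IsGeneral) (hb : b ∈ M.pi7) (hb' : b ∉ M.pi3) :
    b ∈ M.generalSigma5 := fun i hi => by
  obtain ⟨hw, hP, hR⟩ := hb i hi
  rw [M.mem_pi3_iff hi] at hb'
  -- Where β₅ = 0, R reduces to -β₃ ^ 3, so the point would lie in Π₃. Where β₃ = 0 and β₅ ≠ 0, P =
  -- 0 gives β₀ = 0 and then R = 0 gives β₂ = 0, against generality.
  have h5 : (M.coeffs i b).β5 ≠ 0 := fun h5 =>
    hb' ⟨hw, h5, by simpa [SU5.Coeffs.R, h5] using hR⟩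
  refine ⟨hw, hP, h5, fun h3 => (hM i b hi hw).2 ?_⟩
  have h0 : (M.coeffs i b).β0 = 0 := by simpa [SU5.Coeffs.P, h3, h5] using hP
  exact ⟨h3, by simpa [SU5.Coeffs.R, h3, h5, h0] using hR, h0⟩

end SU5Model

/-! ### The classification of the fibres -/

theorem mainTheorem5 {B : Type*} (M : SU5Model B) (hM : M.IsGeneral) :
    -- `Σ₅ ∩ Σ₁₀ = Π₃ ∪ Π₄`
    M.sigma5 ∩ M.sigma10 = M.pi3 ∪ M.pi4 ∧
    -- over `Π₃`, for all resolutions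
    (∀ b ∈ M.pi3, ∀ i, b ∈ M.U i → ∀ r : SU5.Resolution,
      HasDualGraph (SU5.Fibre r (M.coeffs i b)) (graphAffineD 6)) ∧
    -- over `Π₄`: the number of nodes is the same as over the general points of the two curves
    (∀ b ∈ M.pi4, ∀ i, b ∈ M.U i → ∀ r : SU5.Resolution,
      SU5.nodes r (M.coeffs i b) = 6 ∧
      ∀ b' ∈ M.generalSigma5 ∪ M.generalSigma10, ∀ i', b' ∈ M.U i' →
        SU5.nodes r (M.coeffs i b) = SU5.nodes r (M.coeffs i' b')) ∧
    -- over `Π₄`: the projective `E₆`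
    (∀ b ∈ M.pi4, ∀ i, b ∈ M.U i → ∀ r : SU5.Resolution, r ≠ .xt → r ≠ .tx →
      HasDualGraph (SU5.Fibre r (M.coeffs i b)) (graphT 2 3 3)) ∧
    -- over `Π₄`: the exotic fibre, which is not of type ADE
    (∀ b ∈ M.pi4, ∀ i, b ∈ M.U i → ∀ r : SU5.Resolution, r = .xt ∨ r = .tx →
      IsBouquetOfThreeTwoChains (SU5.Fibre r (M.coeffs i b)) ∧
      ¬ IsADE (dualGraph (SU5.Fibre r (M.coeffs i b)))) ∧
    -- over `Π₇` (away from `Π₃`): no enhancement, the fibre is as over the general points of `Σ₅`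
    (∀ b ∈ M.pi7, b ∉ M.pi3 → ∀ i, b ∈ M.U i → ∀ r : SU5.Resolution,
      HasDualGraph (SU5.Fibre r (M.coeffs i b)) (SimpleGraph.cycleGraph 6) ∧
      ∀ b' ∈ M.generalSigma5, ∀ i', b' ∈ M.U i' →
        Nonempty (dualGraph (SU5.Fibre r (M.coeffs i b)) ≃g
          dualGraph (SU5.Fibre r (M.coeffs i' b')))) := by
  have h4 : ∀ b ∈ M.pi4, ∀ i, b ∈ M.U i → (M.coeffs i b).w = 0 ∧ (M.coeffs i b).β5 = 0 ∧
      (M.coeffs i b).β4 = 0 ∧ (M.coeffs i b).β3 ≠ 0 := fun b hb i hi => by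
    obtain ⟨hw, h5, h4⟩ := hb i hi
    exact ⟨hw, h5, h4, fun h3 => ((hM i b hi hw).1 h5 h3).1 h4⟩
  refine ⟨M.sigma5_inter_sigma10, fun b hb i hi r => ?_, fun b hb i hi r => ?_,
    fun b hb i hi r hr hr' => ?_, fun b hb i hi r hr => ?_, fun b hb hb' i hi r => ?_⟩
  · obtain ⟨hw, h5, h3⟩ := hb i hi
    obtain ⟨h4, h0, hd⟩ := (hM i b hi hw).1 h5 h3
    exact SU5.Fibre.hasDualGraph_pi3 r hw h5 h3 h4 h0 hd
  · obtain ⟨hw, h5, h4, h3⟩ := h4 b hb i hi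
    obtain ⟨L, hL, -⟩ := SU5.Fibre.exists_isLineConfiguration_pi4 r hw h5 h4 h3
    have h6 := SU5.Fibre.nodes_eq hL
    refine ⟨h6, fun b' hb' i' hi' => h6.trans ?_⟩
    rcases hb' with hb' | hb'
    · obtain ⟨hw, hP, h5, h3⟩ := hb' i' hi'
      obtain ⟨L, hL⟩ := SU5.Fibre.exists_isLineConfiguration_sigma5 r hw hP h5 h3
      exact (SU5.Fibre.nodes_eq hL).symm
    · obtain ⟨hw, h5, h3, h4⟩ := hb' i' hi'
      obtain ⟨L, hL⟩ := SU5.Fibre.exists_isLineConfiguration_sigma10 r hw h5 h3 h4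
      exact (SU5.Fibre.nodes_eq hL).symm
  · obtain ⟨hw, h5, h4, h3⟩ := h4 b hb i hi
    exact SU5.Fibre.hasDualGraph_pi4 hw h5 h4 h3 hr hr'
  · obtain ⟨hw, h5, h4, h3⟩ := h4 b hb i hi
    exact SU5.Fibre.isBouquet_pi4 hw h5 h4 h3 hr
  · obtain ⟨hw, hP, h5, h3⟩ := M.generalSigma5_of_mem_pi7 hM hb hb' i hi
    have h := SU5.Fibre.hasDualGraph_sigma5 r hw hP h5 h3
    refine ⟨h, fun b' hb' i' hi' => ?_⟩
    obtain ⟨hw', hP', h5', h3'⟩ := hb' i' hi'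
    obtain ⟨e⟩ := h.2.2
    obtain ⟨e'⟩ := (SU5.Fibre.hasDualGraph_sigma5 r hw' hP' h5' h3').2.2
    exact ⟨e.trans e'.symm⟩
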